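/- Let $\Bbbk$ be a commutative ring with $\mathbb{Q}\subseteq\Bbbk$. Chain complexes are unbounded complexes of $\Bbbk$-modules with differential of degree $-1$; all tensor products, permutations and tensor products of maps follow the Koszul sign rule, and $\partial(\varphi)=d\varphi-(-1)^{|\varphi|}\varphi d$. Let $\mathscr{D}$ be a contraction: $f\colon A\to B$ and $g\colon B\to A$ are morphisms of chain complexes (degree $0$, $\partial f=0$, $\partial g=0$) and $h\colon A\to A$ is a map of degree $1$ with $$\partial(h)=gf-1_A,\quad fg=1_B,\quad fh=0,\quad hh=0,\quad hg=0.$$ A thick map $\boldsymbol{\varphi}\colon A\to B$ of degree $p$ is a sequence of maps $\varphi_n\colon A^{\otimes n}\to B^{\otimes n}$, $n\ge 0$, of degree $p$. Composition, differential and units of thick maps are levelwise. It is symmetric if each $\varphi_n$ is $\Sigma_n$-equivariant. It is a morphism if it has degree $0$ and $\varphi_n=\varphi_1^{\otimes n}$ for all $n$. A thick map $\mathbf{h}\colon A\to A$ is a pseudo-derivation if for all $p,q\ge 0$ $$(h_p\otimes 1-1\otimes h_q)h_{p+q}=-h_{p+q}(h_p\otimes 1-1\otimes h_q)=h_p\otimes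 h_q .$$ A symmetric thick contraction consists of symmetric thick maps $\mathbf{F},\mathbf{G},\mathbf{H}$ of degrees $0,0,1$ satisfying the identities of a contraction (at every level $n\ge 0$). Let $\mathcal{O}=\{\mathcal{O}(n)\}_{n\ge 0}$ be any symmetric sequence, i.e. $\mathcal{O}(n)$ is a chain complex with an action of $\Sigma_n$. Its Schur functor is $\mathcal{O}[A]=\bigoplus_{n\ge0}\mathcal{O}(n)\otimes_{\Sigma_n}A^{\otimes n}$, with $\mathcal{O}[f]=\bigoplus_n 1\otimes_{\Sigma_n}f^{\otimes n}$. For a symmetric thick map $\boldsymbol{\varphi}\colon A\to B$, let $\mathcal{O}_\bullet[\boldsymbol{\varphi}]\colon\mathcal{O}[A]\to\mathcal{O}[B]$ be the thick map whose $n$-th level, under $$\mathcal{O}[A]^{\otimes n}\cong\bigoplus_{r_1,\dots,r_n\ge0}(\mathcal{O}(r_1)\otimes\dots\otimes\mathcal{O}(r_n))\otimes_{\Sigma_{r_1}\times\dots\times\Sigma_{r_n}}A^{\otimes(r_1+\dots+r_n)},$$ is $1\otimes\varphi_{r_1+\dots+r_n}$ on the summand $(r_1,\dots,r_n)$. Let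 $\mathbf{f}=\{f^{\otimes n}\}_{n}$, $\mathbf{g}=\{g^{\otimes n}\}_{n}$, and let $\mathbf{h}^\Sigma$ be the symmetrized tensor trick homotopy $$h^\Sigma_n=\frac1{n!}\sum_{\sigma\in\Sigma_n}\sigma^{-1}h_n\sigma,\qquad h_n=\sum_{i+1+j=n}1^{\otimes i}\otimes h\otimes(gf)^{\otimes j}.$$ Then $\mathbf{F}=\mathcal{O}_\bullet[\mathbf{f}]\colon\mathcal{O}[A]\to\mathcal{O}[B]$, $\mathbf{G}=\mathcal{O}_\bullet[\mathbf{g}]\colon\mathcal{O}[B]\to\mathcal{O}[A]$ and $\mathbf{H}=\mathcal{O}_\bullet[\mathbf{h}^\Sigma]\colon\mathcal{O}[A]\to\mathcal{O}[A]$ form a symmetric thick contraction, in which $\mathbf{F}$ and $\mathbf{G}$ are the morphisms induced by $f$ and $g$ (that is, $\mathbf{F}$ and $\mathbf{G}$ are morphisms with first levels $F_1=\mathcal{O}[f]$ and $G_1=\mathcal{O}[g]$), and $\mathbf{H}$ is a pseudo-derivation. -/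

import Mathlib

open scoped TensorProduct DirectSum

universe u v w x

noncomputable section

/-- A chain complex of `k`-modules (unbounded, differential of degree `-1`), presented as its total
module `⨁ i, A_i` together with the internal `ℤ`-grading and the total differential. -/
structure DGMod (k : Type u) [CommRing k] where
  carrier : Type v
  [addCommGroup : AddCommGroup carrier]
  [module : Module k carrier]
  /-- the submodule of elements of degree `i` -/
  gr : ℤ → Submodule k carrier
  isInternal : DirectSum.IsInternal gr
  d : carrier →ₗ[k] carrier
  d_mem : ∀ (i : ℤ) (x : carrier), x ∈ gr i → d x ∈ gr (i - 1)
  d_d : ∀ x : carrier, d (d x) = 0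

namespace DGMod

instance (k : Type u) [CommRing k] : CoeSort (DGMod.{u, v} k) (Type v) := ⟨DGMod.carrier⟩

attribute [instance] DGMod.addCommGroup DGMod.module

end DGMod

/-- The sign `(-1)^x` of a parity `x`, as an element of `k`. -/
def ksgn (k : Type u) [CommRing k] (x : ZMod 2) : k := if x = 0 then 1 else -1

theorem ksgn_zero (k : Type u) [CommRing k] : ksgn k 0 = 1 := by simp [ksgn]

theorem ksgn_one (k : Type u) [CommRing k] : ksgn k 1 = -1 := by simp [ksgn]

theorem zmod2_cases (x : ZMod 2) : x = 0 ∨ x = 1 := by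
  revert x; decide

theorem ksgn_add (k : Type u) [CommRing k] (x y : ZMod 2) :
    ksgn k (x + y) = ksgn k x * ksgn k y := by
  have h : (1 : ZMod 2) + 1 = 0 := by decide
  rcases zmod2_cases x with rfl | rfl <;> rcases zmod2_cases y with rfl | rfl <;>
    simp [ksgn, h]

theorem ksgn_mul_self (k : Type u) [CommRing k] (x : ZMod 2) : ksgn k x * ksgn k x = 1 := by
  rcases zmod2_cases x with rfl | rfl <;> simp [ksgn]

section Grading

variable {k : Type u} [CommRing k] {M : Type v} [AddCommGroup M] [Module k M]

/-- A family of submodules that spans and admits a coaction of `ℤ` is a grading. -/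
theorem isInternal_of_coaction (gr : ℤ → Submodule k M) (c : M →ₗ[k] (ℤ →₀ M))
    (hc : ∀ i, ∀ x ∈ gr i, c x = Finsupp.single i x)
    (htop : ∀ x : M, x ∈ ⨆ i, gr i) : DirectSum.IsInternal gr := by
  classical
  constructor
  · rw [injective_iff_map_eq_zero]
    intro x hx
    have key : ∀ y : ⨁ i, gr i, ∀ j, c (DirectSum.coeAddMonoidHom gr y) j = (y j : M) := by
      intro y j
      induction y using DirectSum.induction_on with
      | zero => simp
      | of i z =>
        rw [DirectSum.coeAddMonoidHom_of, hc i z z.2, DirectSum.of_apply, Finsupp.single_apply]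
        split_ifs with h
        · subst h; rfl
        · rfl
      | add a b ha hb => simp [ha, hb]
    ext j
    rw [← key x j, hx]; simp
  · intro x
    refine Submodule.iSup_induction gr
      (motive := fun x => ∃ y, DirectSum.coeAddMonoidHom gr y = x) (htop x) ?_ ⟨0, map_zero _⟩ ?_
    · intro i y hy
      exact ⟨DirectSum.of (fun i => gr i) i ⟨y, hy⟩, by simp⟩
    · rintro _ _ ⟨y, rfl⟩ ⟨z, rfl⟩
      exact ⟨y + z, map_add _ _ _⟩

end Grading

namespace DGMod

variable {k : Type u} [CommRing k]

/-- The map sending `x = ∑ x_i` to the family of its homogeneous components. -/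
def coact (A : DGMod.{u, v} k) : A →ₗ[k] (ℤ →₀ A) :=
  (DirectSum.toModule k ℤ (ℤ →₀ A) fun i => Finsupp.lsingle i ∘ₗ (A.gr i).subtype) ∘ₗ
    (LinearEquiv.ofBijective (DirectSum.coeLinearMap A.gr) A.isInternal).symm.toLinearMap

theorem coact_of_mem (A : DGMod.{u, v} k) {i : ℤ} {x : A} (hx : x ∈ A.gr i) :
    A.coact x = Finsupp.single i x := by
  have : (LinearEquiv.ofBijective (DirectSum.coeLinearMap A.gr) A.isInternal).symm x =
      DirectSum.lof k ℤ (fun i => A.gr i) i ⟨x, hx⟩ := by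
    rw [LinearEquiv.symm_apply_eq]
    exact (DirectSum.coeLinearMap_lof A.gr i ⟨x, hx⟩).symm
  simp [coact, this]

theorem mem_iSup (A : DGMod.{u, v} k) (x : A) : x ∈ ⨆ i, A.gr i := by
  rw [A.isInternal.submodule_iSup_eq_top]; trivial

theorem induction_hom (A : DGMod.{u, v} k) {P : A → Prop} (x : A)
    (h : ∀ i, ∀ y ∈ A.gr i, P y) (h0 : P 0) (hadd : ∀ y z, P y → P z → P (y + z)) : P x :=
  Submodule.iSup_induction A.gr (motive := P) (A.mem_iSup x) h h0 hadd

/-- The homogeneous elements of `A`. -/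
abbrev Homog (A : DGMod.{u, v} k) : Type v := {x : A // ∃ i, x ∈ A.gr i}

theorem span_homog (A : DGMod.{u, v} k) :
    Submodule.span k (Set.range (fun x : A.Homog => (x : A))) = ⊤ := by
  rw [eq_top_iff]
  intro x _
  induction x using A.induction_hom with
  | h i y hy => exact Submodule.subset_span ⟨⟨y, i, hy⟩, rfl⟩
  | h0 => exact zero_mem _
  | hadd y z hy hz => exact add_mem (hy trivial) (hz trivial)

theorem hom_ext {A : DGMod.{u, v} k} {N : Type w} [AddCommGroup N] [Module k N] {f g : A →ₗ[k] N}
    (h : ∀ i, ∀ x ∈ A.gr i, f x = g x) : f = g := by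
  ext x
  induction x using A.induction_hom with
  | h i y hy => exact h i y hy
  | h0 => simp
  | hadd y z hy hz => simp [hy, hz]

/-- The operator acting on elements of degree `i` as multiplication by the scalar `c i`. -/
def diag (A : DGMod.{u, v} k) (c : ℤ → k) : A →ₗ[k] A :=
  (Finsupp.lsum k fun i : ℤ => c i • (LinearMap.id : A →ₗ[k] A)) ∘ₗ A.coact

theorem diag_of_mem (A : DGMod.{u, v} k) (c : ℤ → k) {i : ℤ} {x : A} (hx : x ∈ A.gr i) :
    A.diag c x = c i • x := by
  simp [diag, A.coact_of_mem hx]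

/-- The Koszul sign operator `x ↦ (-1)^{p|x|} x`, by which a map of degree `p` passes `x`. -/
def sgn (A : DGMod.{u, v} k) (p : ZMod 2) : A →ₗ[k] A :=
  A.diag fun i => ksgn k (p * (i : ZMod 2))

/-- The projection of `A` onto the sum of the components whose degree has parity `s`. -/
def par (A : DGMod.{u, v} k) (s : ZMod 2) : A →ₗ[k] A :=
  A.diag fun i => if (i : ZMod 2) = s then 1 else 0

theorem sgn_of_mem (A : DGMod.{u, v} k) (p : ZMod 2) {i : ℤ} {x : A} (hx : x ∈ A.gr i) :
    A.sgn p x = ksgn k (p * (i : ZMod 2)) • x := A.diag_of_mem _ hx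

theorem par_of_mem (A : DGMod.{u, v} k) (s : ZMod 2) {i : ℤ} {x : A} (hx : x ∈ A.gr i) :
    A.par s x = if (i : ZMod 2) = s then x else 0 := by
  rw [par, A.diag_of_mem _ hx]; split_ifs <;> simp

/-- A linear map `f : A → B` is homogeneous of degree `p`. -/
def HasDegree {A : DGMod.{u, v} k} {B : DGMod.{u, w} k} (p : ℤ) (f : A →ₗ[k] B) : Prop :=
  ∀ (i : ℤ) (x : A), x ∈ A.gr i → f x ∈ B.gr (i + p)

/-- The differential `∂ f = d f - (-1)^p f d` of a map `f` of degree `p` in the dg-category of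
chain complexes. -/
def bdry {A : DGMod.{u, v} k} {B : DGMod.{u, w} k} (p : ℤ) (f : A →ₗ[k] B) : A →ₗ[k] B :=
  B.d ∘ₗ f - ksgn k (p : ZMod 2) • (f ∘ₗ A.d)

theorem sgn_comm {A : DGMod.{u, v} k} {B : DGMod.{u, w} k} {p : ℤ} {f : A →ₗ[k] B}
    (hf : HasDegree p f) (q : ZMod 2) (x : A) :
    B.sgn q (f x) = ksgn k (q * (p : ZMod 2)) • f (A.sgn q x) := by
  induction x using A.induction_hom with
  | h i y hy =>
    rw [A.sgn_of_mem _ hy, B.sgn_of_mem _ (hf i y hy), map_smul, smul_smul, ← ksgn_add]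
    congr 2; push_cast; ring
  | h0 => simp
  | hadd y z hy hz => simp [hy, hz]

theorem hasDegree_d (A : DGMod.{u, v} k) : HasDegree (-1) A.d := fun i x hx => by
  simpa [sub_eq_add_neg] using A.d_mem i x hx

end DGMod

namespace DGMod

variable {k : Type u} [CommRing k]

theorem ksgn_sub_one (k : Type u) [CommRing k] (x : ZMod 2) : ksgn k (x - 1) = - ksgn k x := by
  rw [sub_eq_add_neg, ksgn_add]
  have : (-1 : ZMod 2) = 1 := by decide
  simp [this, ksgn]

/-! ### Tensor product of two complexes -/

theorem tensor_ext {A : DGMod.{u, v} k} {B : DGMod.{u, w} k} {N : Type*} [AddCommGroup N]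
    [Module k N] {f g : A ⊗[k] B →ₗ[k] N}
    (h : ∀ i j, ∀ x ∈ A.gr i, ∀ y ∈ B.gr j, f (x ⊗ₜ y) = g (x ⊗ₜ y)) : f = g := by
  apply TensorProduct.ext
  apply hom_ext
  intro i x hx
  apply hom_ext
  intro j y hy
  exact h i j x hx y hy

/-- Elements of degree `m` in `A ⊗ B`. -/
def tensorGr (A : DGMod.{u, v} k) (B : DGMod.{u, w} k) (m : ℤ) : Submodule k (A ⊗[k] B) :=
  Submodule.span k {z | ∃ i j, i + j = m ∧ ∃ x ∈ A.gr i, ∃ y ∈ B.gr j, z = x ⊗ₜ[k] y}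

/-- The differential `d (x ⊗ y) = d x ⊗ y + (-1)^|x| x ⊗ d y`. -/
def tensorD (A : DGMod.{u, v} k) (B : DGMod.{u, w} k) : A ⊗[k] B →ₗ[k] A ⊗[k] B :=
  TensorProduct.map A.d LinearMap.id + TensorProduct.map (A.sgn 1) B.d

theorem tensorD_tmul (A : DGMod.{u, v} k) (B : DGMod.{u, w} k) {i : ℤ} {x : A} (hx : x ∈ A.gr i)
    (y : B) : tensorD A B (x ⊗ₜ y) = A.d x ⊗ₜ y + ksgn k (i : ZMod 2) • (x ⊗ₜ[k] B.d y) := by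
  simp [tensorD, A.sgn_of_mem _ hx, TensorProduct.smul_tmul']

/-- The tensor product of two chain complexes. -/
@[reducible] def tensor (A : DGMod.{u, v} k) (B : DGMod.{u, w} k) : DGMod.{u, max v w} k where
  carrier := A ⊗[k] B
  gr := tensorGr A B
  isInternal := by
    classical
    refine isInternal_of_coaction _
      (Finsupp.lmapDomain (A ⊗[k] B) k (fun p : ℤ × ℤ => p.1 + p.2) ∘ₗ
        (finsuppTensorFinsupp k k A B ℤ ℤ).toLinearMap ∘ₗ
        TensorProduct.map A.coact B.coact) ?_ ?_
    · intro m z hz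
      induction hz using Submodule.span_induction with
      | mem z hz =>
        obtain ⟨i, j, rfl, x, hx, y, hy, rfl⟩ := hz
        simp [A.coact_of_mem hx, B.coact_of_mem hy, Finsupp.mapDomain_single]
      | zero => simp
      | add a b _ _ ha hb => rw [map_add, ha, hb, Finsupp.single_add]
      | smul c a _ ha => rw [map_smul, ha, Finsupp.smul_single]
    · intro z
      induction z using TensorProduct.induction_on with
      | zero => exact zero_mem _
      | add a b ha hb => exact add_mem ha hb
      | tmul x y =>
        induction x using A.induction_hom with
        | h0 => simp
        | hadd a b ha hb => rw [TensorProduct.add_tmul]; exact add_mem ha hb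
        | h i x hx =>
          induction y using B.induction_hom with
          | h0 => simp
          | hadd a b ha hb => rw [TensorProduct.tmul_add]; exact add_mem ha hb
          | h j y hy =>
            exact Submodule.mem_iSup_of_mem (i + j)
              (Submodule.subset_span ⟨i, j, rfl, x, hx, y, hy, rfl⟩)
  d := tensorD A B
  d_mem := by
    intro m z hz
    induction hz using Submodule.span_induction with
    | mem z hz =>
      obtain ⟨i, j, rfl, x, hx, y, hy, rfl⟩ := hz
      rw [tensorD_tmul A B hx]
      refine add_mem ?_ (Submodule.smul_mem _ _ ?_)
      · exact Submodule.subset_span ⟨i - 1, j, by ring, _, A.d_mem i x hx, y, hy, rfl⟩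
      · exact Submodule.subset_span ⟨i, j - 1, by ring, x, hx, _, B.d_mem j y hy, rfl⟩
    | zero => simp
    | add a b _ _ ha hb => rw [map_add]; exact add_mem ha hb
    | smul c a _ ha => rw [map_smul]; exact Submodule.smul_mem _ _ ha
  d_d := by
    have : tensorD A B ∘ₗ tensorD A B = 0 := by
      apply tensor_ext
      intro i j x hx y hy
      simp only [LinearMap.comp_apply, LinearMap.zero_apply]
      rw [tensorD_tmul A B hx, map_add, map_smul, tensorD_tmul A B hx,
        tensorD_tmul A B (A.d_mem i x hx)]
      push_cast
      simp [A.d_d, B.d_d, ksgn_sub_one]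
    intro z
    exact LinearMap.congr_fun this z

/-! ### Tensor powers -/

theorem tpow_ext {A : DGMod.{u, v} k} {n : ℕ} {N : Type*} [AddCommGroup N] [Module k N]
    {f g : (⨂[k]^n A) →ₗ[k] N}
    (h : ∀ (e : Fin n → ℤ) (a : Fin n → A), (∀ i, a i ∈ A.gr (e i)) →
      f (PiTensorProduct.tprod k a) = g (PiTensorProduct.tprod k a)) : f = g := by
  refine PiTensorProduct.ext_of_span_eq_top (γ := fun _ => A.Homog)
    (g := fun _ x => (x : A)) (fun _ => A.span_homog) ?_
  intro j
  exact h (fun i => (j i).2.choose) _ (fun i => (j i).2.choose_spec)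

/-- Elements of degree `m` in `A^{⊗ n}`: the span of the tensors `a_1 ⊗ ⋯ ⊗ a_n` of homogeneous
elements whose degrees add up to `m`. -/
def tpowGr (A : DGMod.{u, v} k) (n : ℕ) (m : ℤ) : Submodule k (⨂[k]^n A) :=
  Submodule.span k {z | ∃ e : Fin n → ℤ, ∑ i, e i = m ∧
    ∃ a : Fin n → A, (∀ i, a i ∈ A.gr (e i)) ∧ z = PiTensorProduct.tprod k a}

theorem tprod_mem_tpowGr (A : DGMod.{u, v} k) {n : ℕ} {e : Fin n → ℤ} {a : Fin n → A}
    (ha : ∀ i, a i ∈ A.gr (e i)) {m : ℤ} (hm : ∑ i, e i = m) :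
    PiTensorProduct.tprod k a ∈ A.tpowGr n m :=
  Submodule.subset_span ⟨e, hm, a, ha, rfl⟩

/-- The map `1 ⊗ ⋯ ⊗ 1 ⊗ φ ⊗ ψ ⊗ ⋯ ⊗ ψ` on `A^{⊗ n}` with `φ` in position `i`, where `φ` has a
degree of parity `p` and `ψ` has degree `0`; the factors before position `i` carry the Koszul sign
of being passed by `φ`. -/
def insertAt (A : DGMod.{u, v} k) {n : ℕ} (p : ZMod 2) (φ ψ : A →ₗ[k] A) (i : Fin n) :
    (⨂[k]^n A) →ₗ[k] (⨂[k]^n A) :=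
  PiTensorProduct.map fun j => if j < i then A.sgn p else if j = i then φ else ψ

theorem insertAt_tprod (A : DGMod.{u, v} k) {n : ℕ} (p : ZMod 2) (φ ψ : A →ₗ[k] A) (i : Fin n)
    {e : Fin n → ℤ} {a : Fin n → A} (ha : ∀ i, a i ∈ A.gr (e i)) :
    A.insertAt p φ ψ i (PiTensorProduct.tprod k a) =
      ksgn k (p * ∑ j, if j < i then (e j : ZMod 2) else 0) •
        PiTensorProduct.tprod k
          (fun j => if j < i then a j else if j = i then φ (a j) else ψ (a j)) := by
  rw [insertAt, PiTensorProduct.map_tprod]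
  have h1 : (fun j => (if j < i then A.sgn p else if j = i then φ else ψ) (a j)) =
      fun j => (if j < i then ksgn k (p * (e j : ZMod 2)) else 1) •
        (if j < i then a j else if j = i then φ (a j) else ψ (a j)) := by
    funext j
    split_ifs with h h'
    · rw [A.sgn_of_mem _ (ha j)]
    · simp
    · simp
  rw [h1, MultilinearMap.map_smul_univ]
  congr 1
  rw [Finset.mul_sum]
  have : ∀ s : Finset (Fin n), (∏ j ∈ s, if j < i then ksgn k (p * (e j : ZMod 2)) else 1) =
      ksgn k (∑ j ∈ s, p * if j < i then (e j : ZMod 2) else 0) := by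
    intro s
    induction s using Finset.induction_on with
    | empty => simp [ksgn_zero]
    | insert a s ha ih =>
      rw [Finset.prod_insert ha, Finset.sum_insert ha, ksgn_add, ih]
      split_ifs <;> simp [ksgn_zero]
  exact this _

/-- The differential of `A^{⊗ n}`: `∑_{i+1+j=n} 1^{⊗ i} ⊗ d ⊗ 1^{⊗ j}`. -/
def tpowD (A : DGMod.{u, v} k) (n : ℕ) : (⨂[k]^n A) →ₗ[k] (⨂[k]^n A) :=
  ∑ i, A.insertAt 1 A.d LinearMap.id i

theorem insertAt_id_tprod (A : DGMod.{u, v} k) {n : ℕ} (p : ZMod 2) (φ : A →ₗ[k] A) (i : Fin n)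
    {e : Fin n → ℤ} {a : Fin n → A} (ha : ∀ i, a i ∈ A.gr (e i)) :
    A.insertAt p φ LinearMap.id i (PiTensorProduct.tprod k a) =
      ksgn k (p * ∑ j, if j < i then (e j : ZMod 2) else 0) •
        PiTensorProduct.tprod k (Function.update a i (φ (a i))) := by
  rw [insertAt_tprod A p φ _ i ha]
  congr 2
  funext j
  by_cases h : j = i
  · subst h; simp
  · simp [h, Function.update_of_ne]

theorem update_mem {A : DGMod.{u, v} k} {n : ℕ} {e : Fin n → ℤ} {a : Fin n → A}
    (ha : ∀ i, a i ∈ A.gr (e i)) (i : Fin n) {p : ℤ} {y : A} (hy : y ∈ A.gr p) (j : Fin n) :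
    Function.update a i y j ∈ A.gr (Function.update e i p j) := by
  by_cases h : j = i
  · subst h; simpa using hy
  · simpa [Function.update_of_ne h] using ha j

theorem tpowD_mem (A : DGMod.{u, v} k) (n : ℕ) (m : ℤ) (x : ⨂[k]^n A) (hx : x ∈ A.tpowGr n m) :
    A.tpowD n x ∈ A.tpowGr n (m - 1) := by
  induction hx using Submodule.span_induction with
  | mem z hz =>
    obtain ⟨e, rfl, a, ha, rfl⟩ := hz
    rw [tpowD, LinearMap.sum_apply]
    refine Submodule.sum_mem _ fun i _ => ?_
    rw [insertAt_id_tprod A _ _ i ha]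
    refine Submodule.smul_mem _ _ (tprod_mem_tpowGr A (update_mem ha i (A.d_mem _ _ (ha i))) ?_)
    rw [Finset.sum_update_of_mem (Finset.mem_univ i),
      ← Finset.add_sum_erase _ e (Finset.mem_univ i), Finset.sdiff_singleton_eq_erase]
    ring
  | zero => simp
  | add a b _ _ ha hb => rw [map_add]; exact add_mem ha hb
  | smul c a _ ha => rw [map_smul]; exact Submodule.smul_mem _ _ ha

theorem sum_lt_update {n : ℕ} (e : Fin n → ℤ) (i j : Fin n) :
    (∑ l, if l < j then ((Function.update e i (e i - 1) l : ℤ) : ZMod 2) else 0) =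
      (∑ l, if l < j then (e l : ZMod 2) else 0) + if i < j then 1 else 0 := by
  have h : ∀ l, (if l < j then ((Function.update e i (e i - 1) l : ℤ) : ZMod 2) else 0) =
      (if l < j then (e l : ZMod 2) else 0) + if l = i then (if i < j then 1 else 0) else 0 := by
    intro l
    by_cases hl : l = i
    · subst hl
      simp only [Function.update_self, if_true]
      split_ifs
      · push_cast
        have : (-1 : ZMod 2) = 1 := by decide
        rw [sub_eq_add_neg, this]
      · simp
    · simp [hl, Function.update_of_ne]
  rw [Finset.sum_congr rfl fun l _ => h l, Finset.sum_add_distrib]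
  simp

theorem tpowD_tpowD (A : DGMod.{u, v} k) (n : ℕ) : A.tpowD n ∘ₗ A.tpowD n = 0 := by
  apply tpow_ext
  intro e a ha
  simp only [LinearMap.comp_apply, LinearMap.zero_apply]
  have h1 : A.tpowD n (A.tpowD n (PiTensorProduct.tprod k a)) =
      ∑ p : Fin n × Fin n, A.insertAt 1 A.d LinearMap.id p.1
        (A.insertAt 1 A.d LinearMap.id p.2 (PiTensorProduct.tprod k a)) := by
    rw [Fintype.sum_prod_type]
    simp only [tpowD, LinearMap.sum_apply, map_sum]
    rw [Finset.sum_comm]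
  rw [h1]
  have h2 : ∀ i j : Fin n, A.insertAt 1 A.d LinearMap.id i
        (A.insertAt 1 A.d LinearMap.id j (PiTensorProduct.tprod k a)) =
      (ksgn k (∑ l, if l < j then (e l : ZMod 2) else 0) *
        (ksgn k (∑ l, if l < i then (e l : ZMod 2) else 0) * ksgn k (if j < i then 1 else 0))) •
        PiTensorProduct.tprod k (Function.update (Function.update a j (A.d (a j))) i
          (A.d (Function.update a j (A.d (a j)) i))) := by
    intro i j
    rw [insertAt_id_tprod A _ _ j ha, map_smul,
      insertAt_id_tprod A _ _ i (update_mem ha j (A.d_mem _ _ (ha j))), smul_smul, one_mul, one_mul,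
      sum_lt_update, ksgn_add]
  refine Finset.sum_involution (fun p _ => p.swap) ?_ ?_ (by simp) (by simp)
  · rintro ⟨i, j⟩ _
    simp only [Prod.swap_prod_mk]
    rw [h2, h2]
    by_cases hij : i = j
    · subst hij
      have : PiTensorProduct.tprod k (Function.update (Function.update a i (A.d (a i))) i
          (A.d (Function.update a i (A.d (a i)) i))) = 0 := by
        apply (PiTensorProduct.tprod k).map_coord_zero i
        simp [A.d_d]
      simp only [this, smul_zero, add_zero]
    · rw [Function.update_of_ne hij, Function.update_of_ne (Ne.symm hij),
        Function.update_comm hij, ← add_smul]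
      convert zero_smul k _
      rcases lt_or_gt_of_ne hij with h | h
      · simp [h, not_lt_of_gt h, ksgn_one, ksgn_zero]; ring
      · simp [h, not_lt_of_gt h, ksgn_one, ksgn_zero]; ring
  · rintro ⟨i, j⟩ _ hne heq
    simp only [Prod.swap_prod_mk, Prod.mk.injEq] at heq
    obtain ⟨rfl, -⟩ := heq
    apply hne
    simp only [h2]
    have : PiTensorProduct.tprod k (Function.update (Function.update a j (A.d (a j))) j
        (A.d (Function.update a j (A.d (a j)) j))) = 0 := by
      apply (PiTensorProduct.tprod k).map_coord_zero j
      simp [A.d_d]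
    simp only [this, smul_zero]

/-- The tensor power `A^{⊗ n}` as a chain complex; `A^{⊗ 0}` is `k` in degree `0`. -/
@[reducible] def tpow (A : DGMod.{u, v} k) (n : ℕ) : DGMod.{u, max u v} k where
  carrier := ⨂[k]^n A
  gr := A.tpowGr n
  isInternal := by
    classical
    have hco : ∀ (e : Fin n → ℤ) (a : Fin n → A), (∀ i, a i ∈ A.gr (e i)) →
        (Finsupp.lmapDomain (⨂[k]^n A) k (fun p : Fin n → ℤ => ∑ i, p i) ∘ₗ
        (PiTensorProduct.ofFinsuppEquiv (R := k) (κ := fun _ : Fin n => ℤ)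
          (M := fun _ => A)).toLinearMap ∘ₗ
        PiTensorProduct.map (fun _ => A.coact)) (PiTensorProduct.tprod k a) =
          Finsupp.single (∑ i, e i) (PiTensorProduct.tprod k a) := by
      intro e a ha
      simp only [LinearMap.comp_apply, PiTensorProduct.map_tprod, LinearEquiv.coe_coe]
      have : (fun i => A.coact (a i)) = fun i => Finsupp.single (e i) (a i) := by
        funext i; exact A.coact_of_mem (ha i)
      rw [this, PiTensorProduct.ofFinsuppEquiv_tprod_single]
      simp [Finsupp.mapDomain_single]
    refine isInternal_of_coaction _ (Finsupp.lmapDomain (⨂[k]^n A) k (fun p : Fin n → ℤ => ∑ i, p i) ∘ₗ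
        (PiTensorProduct.ofFinsuppEquiv (R := k) (κ := fun _ : Fin n => ℤ)
          (M := fun _ => A)).toLinearMap ∘ₗ
        PiTensorProduct.map (fun _ => A.coact)) ?_ ?_
    · intro m z hz
      induction hz using Submodule.span_induction with
      | mem z hz =>
        obtain ⟨e, rfl, a, ha, rfl⟩ := hz
        exact hco e a ha
      | zero => simp
      | add a b _ _ ha hb => rw [map_add, ha, hb, Finsupp.single_add]
      | smul c a _ ha => rw [map_smul, ha, Finsupp.smul_single]
    · intro z
      have h : (⨆ m, A.tpowGr n m).mkQ = 0 := by
        apply tpow_ext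
        intro e a ha
        rw [LinearMap.zero_apply, Submodule.mkQ_apply, Submodule.Quotient.mk_eq_zero]
        exact Submodule.mem_iSup_of_mem _ (tprod_mem_tpowGr A ha rfl)
      have := LinearMap.congr_fun h z
      rwa [LinearMap.zero_apply, Submodule.mkQ_apply, Submodule.Quotient.mk_eq_zero] at this
  d := A.tpowD n
  d_mem := A.tpowD_mem n
  d_d := fun x => LinearMap.congr_fun (A.tpowD_tpowD n) x

end DGMod

/-! ### The Koszul sign of a permutation -/

section KoszulSign

variable {ι : Type*} [Fintype ι] [LinearOrder ι]

/-- The exponent of the Koszul sign by which `σ` permutes homogeneous elements with parities `e`: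
the sum of `e x * e y` over the inversions `x < y`, `σ y < σ x`. -/
def koszulExp (σ : Equiv.Perm ι) (e : ι → ZMod 2) : ZMod 2 :=
  ∑ x, ∑ y, if x < y ∧ σ y < σ x then e x * e y else 0

theorem koszulExp_one (e : ι → ZMod 2) : koszulExp 1 e = 0 := by
  unfold koszulExp
  refine Finset.sum_eq_zero fun x _ => Finset.sum_eq_zero fun y _ => ?_
  rw [if_neg]
  rintro ⟨h1, h2⟩
  exact absurd h1 (not_lt_of_gt h2)

theorem koszulExp_mul (τ σ : Equiv.Perm ι) (e : ι → ZMod 2) :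
    koszulExp (τ * σ) e = koszulExp σ e + koszulExp τ (fun x => e (σ.symm x)) := by
  have hr : koszulExp τ (fun x => e (σ.symm x)) =
      ∑ x, ∑ y, if σ x < σ y ∧ τ (σ y) < τ (σ x) then e x * e y else 0 := by
    unfold koszulExp
    rw [← Equiv.sum_comp σ]
    refine Finset.sum_congr rfl fun x _ => ?_
    rw [← Equiv.sum_comp σ]
    simp
  have h2 : ∀ z : ZMod 2, z + z = 0 := by decide
  rw [← sub_eq_zero, hr]
  have hneg : ∀ z : ZMod 2, -z = z := by decide
  rw [sub_eq_add_neg, hneg]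
  simp only [koszulExp, ← Finset.sum_add_distrib, ← Fintype.sum_prod_type']
  refine Finset.sum_involution (fun p _ => p.swap) ?_ ?_ (by simp) (by simp)
  · rintro ⟨x, y⟩ _
    simp only [Prod.swap_prod_mk, Equiv.Perm.mul_apply]
    rw [mul_comm (e y) (e x)]
    rcases lt_trichotomy x y with h | rfl | h
    · have a1 : σ x ≠ σ y := fun hh => h.ne (σ.injective hh)
      have a2 : τ (σ x) ≠ τ (σ y) := fun hh => a1 (τ.injective hh)
      rcases lt_or_gt_of_ne a1 with h1 | h1 <;> rcases lt_or_gt_of_ne a2 with h2' | h2' <;>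
        simp [h, h1, h2', not_lt_of_gt h, not_lt_of_gt h1, not_lt_of_gt h2', h2]
    · simp
    · have a1 : σ x ≠ σ y := fun hh => h.ne' (σ.injective hh)
      have a2 : τ (σ x) ≠ τ (σ y) := fun hh => a1 (τ.injective hh)
      rcases lt_or_gt_of_ne a1 with h1 | h1 <;> rcases lt_or_gt_of_ne a2 with h2' | h2' <;>
        simp [h, h1, h2', not_lt_of_gt h, not_lt_of_gt h1, not_lt_of_gt h2', h2]
  · rintro ⟨x, y⟩ _ hne heq
    simp only [Prod.swap_prod_mk, Prod.mk.injEq] at heq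
    obtain ⟨rfl, -⟩ := heq
    simp at hne

theorem koszulExp_update (σ : Equiv.Perm ι) (e : ι → ZMod 2) (i : ι) :
    koszulExp σ (fun x => e x + if x = i then 1 else 0) + (∑ l, if l < i then e l else 0) =
      koszulExp σ e + ∑ l, if l < σ i then e (σ.symm l) else 0 := by
  have h2 : ∀ z : ZMod 2, z + z = 0 := by decide
  have h1 : koszulExp σ (fun x => e x + if x = i then 1 else 0) = koszulExp σ e +
      ((∑ y, if i < y ∧ σ y < σ i then e y else 0) +
        ∑ x, if x < i ∧ σ i < σ x then e x else 0) := by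
    have : ∀ x y, (if x < y ∧ σ y < σ x then
          (e x + if x = i then 1 else 0) * (e y + if y = i then 1 else 0) else 0) =
        (if x < y ∧ σ y < σ x then e x * e y else 0) +
        ((if x = i then (if i < y ∧ σ y < σ i then e y else 0) else 0) +
        (if y = i then (if x < i ∧ σ i < σ x then e x else 0) else 0)) := by
      intro x y
      by_cases hx : x = i <;> by_cases hy : y = i
      · subst hx; subst hy; simp
      · subst hx; simp only [hy, if_true, if_false, add_zero]; split_ifs <;> ring
      · subst hy; simp only [hx, if_true, if_false, add_zero, zero_add]; split_ifs <;> ring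
      · simp [hx, hy]
    unfold koszulExp
    simp only [this, Finset.sum_add_distrib]
    congr 2
    · rw [Finset.sum_comm]; simp
    · simp
  have h3 : (∑ l, if l < σ i then e (σ.symm l) else 0) = ∑ l, if σ l < σ i then e l else 0 := by
    rw [← Equiv.sum_comp σ]; simp
  rw [h1, h3, add_assoc]
  congr 1
  rw [← Finset.sum_add_distrib, ← Finset.sum_add_distrib]
  refine Finset.sum_congr rfl fun l _ => ?_
  rcases lt_trichotomy l i with h | rfl | h
  · have a1 : σ l ≠ σ i := fun hh => h.ne (σ.injective hh)
    rcases lt_or_gt_of_ne a1 with h1 | h1 <;>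
      simp [h, h1, not_lt_of_gt h, not_lt_of_gt h1, h2]
  · simp
  · have a1 : σ l ≠ σ i := fun hh => h.ne' (σ.injective hh)
    rcases lt_or_gt_of_ne a1 with h1 | h1 <;>
      simp [h, h1, not_lt_of_gt h, not_lt_of_gt h1]

end KoszulSign

namespace DGMod

variable {k : Type u} [CommRing k]

/-! ### The action of the symmetric group on tensor powers -/

/-- The permutation `σ` acting on `A^{⊗ n}` by permuting tensor factors with Koszul signs,
`σ (a_1 ⊗ ⋯ ⊗ a_n) = ± a_{σ⁻¹ 1} ⊗ ⋯ ⊗ a_{σ⁻¹ n}`. Each tensor is first split into its components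
of parities `s : Fin n → ZMod 2`, on which the sign is constant. -/
def perm (A : DGMod.{u, v} k) {n : ℕ} (σ : Equiv.Perm (Fin n)) : A.tpow n →ₗ[k] A.tpow n :=
  ∑ s : Fin n → ZMod 2, ksgn k (koszulExp σ s) •
    ((PiTensorProduct.reindex k (fun _ : Fin n => (A : Type v)) σ).toLinearMap ∘ₗ
      PiTensorProduct.map fun i => A.par (s i))

theorem map_par_tprod (A : DGMod.{u, v} k) {n : ℕ} (s : Fin n → ZMod 2)
    {e : Fin n → ℤ} {a : Fin n → A} (ha : ∀ i, a i ∈ A.gr (e i)) :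
    PiTensorProduct.map (fun i => A.par (s i)) (PiTensorProduct.tprod k a) =
      if s = (fun i => (e i : ZMod 2)) then PiTensorProduct.tprod k a else 0 := by
  rw [PiTensorProduct.map_tprod]
  split_ifs with h
  · congr 1
    funext i
    rw [A.par_of_mem _ (ha i), if_pos (congrFun h i).symm]
  · obtain ⟨i, hi⟩ := Function.ne_iff.mp h
    apply (PiTensorProduct.tprod k).map_coord_zero i
    rw [A.par_of_mem _ (ha i), if_neg (Ne.symm hi)]

theorem perm_tprod (A : DGMod.{u, v} k) {n : ℕ} (σ : Equiv.Perm (Fin n))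
    {e : Fin n → ℤ} {a : Fin n → A} (ha : ∀ i, a i ∈ A.gr (e i)) :
    A.perm σ (PiTensorProduct.tprod k a) =
      ksgn k (koszulExp σ fun i => (e i : ZMod 2)) •
        (PiTensorProduct.tprod k fun i => a (σ.symm i) : ⨂[k]^n A) := by
  rw [perm, LinearMap.sum_apply, Finset.sum_eq_single fun i => (e i : ZMod 2)]
  · rw [LinearMap.smul_apply, LinearMap.comp_apply, map_par_tprod A _ ha, if_pos rfl]
    congr 1
    exact PiTensorProduct.reindex_tprod σ a
  · intro s _ hs
    rw [LinearMap.smul_apply, LinearMap.comp_apply, map_par_tprod A _ ha, if_neg hs]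
    simp
  · simp

/-- The representation of the symmetric group on `A^{⊗ n}`. -/
def permRep (A : DGMod.{u, v} k) (n : ℕ) :
    Representation k (Equiv.Perm (Fin n)) (A.tpow n) where
  toFun σ := A.perm σ
  map_one' := by
    refine tpow_ext fun e a ha => ?_
    rw [perm_tprod A _ ha, koszulExp_one, ksgn_zero, one_smul]
    rfl
  map_mul' τ σ := by
    refine tpow_ext fun e a ha => ?_
    rw [Module.End.mul_apply, perm_tprod A _ ha, perm_tprod A σ ha, map_smul,
      perm_tprod A τ (fun i => ha (σ.symm i)), koszulExp_mul, ksgn_add, mul_smul]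
    rfl

theorem perm_mem (A : DGMod.{u, v} k) {n : ℕ} (σ : Equiv.Perm (Fin n)) :
    HasDegree 0 (A.perm σ) := by
  intro m z hz
  rw [add_zero]
  change z ∈ A.tpowGr n m at hz
  change A.perm σ z ∈ A.tpowGr n m
  induction hz using Submodule.span_induction with
  | mem z hz =>
    obtain ⟨e, rfl, a, ha, rfl⟩ := hz
    rw [perm_tprod A σ ha]
    refine Submodule.smul_mem _ _ (tprod_mem_tpowGr A (fun i => ha (σ.symm i)) ?_)
    exact Equiv.sum_comp σ.symm e
  | zero => simp
  | add a b _ _ ha hb => rw [map_add]; exact add_mem ha hb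
  | smul c a _ ha => rw [map_smul]; exact Submodule.smul_mem _ _ ha

theorem perm_d (A : DGMod.{u, v} k) {n : ℕ} (σ : Equiv.Perm (Fin n)) (x : A.tpow n) :
    A.perm σ ((A.tpow n).d x) = (A.tpow n).d (A.perm σ x) := by
  have : A.perm σ ∘ₗ A.tpowD n = A.tpowD n ∘ₗ A.perm σ := by
    refine tpow_ext fun e a ha => ?_
    rw [LinearMap.comp_apply, LinearMap.comp_apply, perm_tprod A σ ha, map_smul, tpowD,
      LinearMap.sum_apply, LinearMap.sum_apply, map_sum, Finset.smul_sum,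
      ← Equiv.sum_comp σ (fun i => ksgn k _ • A.insertAt 1 A.d LinearMap.id i _)]
    refine Finset.sum_congr rfl fun i _ => ?_
    rw [insertAt_id_tprod A _ _ i ha,
      insertAt_id_tprod A _ _ (σ i) (fun j => ha (σ.symm j)), map_smul,
      perm_tprod A σ (update_mem ha i (A.d_mem _ _ (ha i))), smul_smul, smul_smul,
      ← ksgn_add, ← ksgn_add, one_mul, one_mul, ← koszulExp_update σ _ i, add_comm]
    congr 3
    · congr 1
      funext j
      by_cases h : j = i
      · subst h
        have : (-1 : ZMod 2) = 1 := by decide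
        simp [sub_eq_add_neg, this]
      · simp [h, Function.update_of_ne]
    · funext j
      by_cases h : j = σ i
      · subst h; simp
      · have : σ.symm j ≠ i := fun hh => h (by rw [← hh]; simp)
        simp [h, Function.update_of_ne, this]
  exact LinearMap.congr_fun this x

/-! ### Coinvariants and direct sums -/

/-- The complex of coinvariants of a group acting on a complex by chain maps of degree `0`. -/
@[reducible] def coinv {G : Type} [Group G] (A : DGMod.{u, v} k) (ρ : Representation k G A)
    (hdeg : ∀ g, HasDegree 0 (ρ g)) (hd : ∀ g x, ρ g (A.d x) = A.d (ρ g x)) :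
    DGMod.{u, v} k where
  carrier := ρ.Coinvariants
  gr i := (A.gr i).map (Representation.Coinvariants.mk ρ)
  isInternal := by
    refine isInternal_of_coaction _ (Representation.Coinvariants.lift ρ
      (Finsupp.mapRange.linearMap (Representation.Coinvariants.mk ρ) ∘ₗ A.coact) ?_) ?_ ?_
    · intro g
      refine hom_ext fun i x hx => ?_
      have h1 := hdeg g i x hx
      rw [add_zero] at h1
      simp [A.coact_of_mem hx, A.coact_of_mem h1]
    · rintro i _ ⟨x, hx, rfl⟩
      simp [A.coact_of_mem hx]
    · intro x
      induction x using Representation.Coinvariants.induction_on with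
      | h x =>
        induction x using A.induction_hom with
        | h i y hy => exact Submodule.mem_iSup_of_mem i ⟨y, hy, rfl⟩
        | h0 => simp
        | hadd y z hy hz => rw [map_add]; exact add_mem hy hz
  d := Representation.Coinvariants.lift ρ (Representation.Coinvariants.mk ρ ∘ₗ A.d) fun g => by
    ext x
    simp only [LinearMap.comp_apply]
    rw [← hd, Representation.Coinvariants.mk_self_apply]
  d_mem := by
    rintro i _ ⟨x, hx, rfl⟩
    exact ⟨A.d x, A.d_mem i x hx, rfl⟩
  d_d x := by
    induction x using Representation.Coinvariants.induction_on with
    | h x =>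
      rw [Representation.Coinvariants.lift_mk, LinearMap.comp_apply,
        Representation.Coinvariants.lift_mk, LinearMap.comp_apply, A.d_d, map_zero]

/-- The direct sum of a sequence of complexes. -/
@[reducible] def dsum (A : ℕ → DGMod.{u, v} k) : DGMod.{u, v} k where
  carrier := ⨁ n, A n
  gr i := ⨆ n, ((A n).gr i).map (DirectSum.lof k ℕ (fun n => A n) n)
  isInternal := by
    refine isInternal_of_coaction _ (DirectSum.toModule k ℕ _ fun n =>
      Finsupp.mapRange.linearMap (DirectSum.lof k ℕ (fun n => A n) n) ∘ₗ (A n).coact) ?_ ?_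
    · intro i x hx
      induction hx using Submodule.iSup_induction' with
      | mem n x hx =>
        obtain ⟨y, hy, rfl⟩ := hx
        simp [(A n).coact_of_mem hy]
      | zero => simp
      | add x y _ _ hx hy => rw [map_add, hx, hy, Finsupp.single_add]
    · intro x
      induction x using DirectSum.induction_on with
      | zero => exact zero_mem _
      | of n x =>
        change DirectSum.lof k ℕ (fun n => A n) n x ∈ _
        induction x using (A n).induction_hom with
        | h i y hy =>
          exact Submodule.mem_iSup_of_mem i (Submodule.mem_iSup_of_mem n ⟨y, hy, rfl⟩)
        | h0 => simp
        | hadd y z hy hz => rw [map_add]; exact add_mem hy hz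
      | add x y hx hy => exact add_mem hx hy
  d := DirectSum.toModule k ℕ _ fun n => DirectSum.lof k ℕ (fun n => A n) n ∘ₗ (A n).d
  d_mem := by
    intro i x hx
    induction hx using Submodule.iSup_induction' with
    | mem n x hx =>
      obtain ⟨y, hy, rfl⟩ := hx
      rw [DirectSum.toModule_lof]
      exact Submodule.mem_iSup_of_mem n ⟨_, (A n).d_mem i y hy, rfl⟩
    | zero => simp
    | add x y _ _ hx hy => rw [map_add]; exact add_mem hx hy
  d_d := by
    intro x
    induction x using DirectSum.induction_on with
    | zero => simp
    | of n x =>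
      rw [← DirectSum.lof_eq_of k]
      rw [DirectSum.toModule_lof, LinearMap.comp_apply, DirectSum.toModule_lof,
        LinearMap.comp_apply, (A n).d_d, map_zero]
    | add x y hx hy => rw [map_add, map_add, hx, hy, add_zero]

end DGMod

namespace DGMod

variable {k : Type u} [CommRing k]

/-- `(f, g, h)` is a contraction of `A` onto `B`: `f : A → B` and `g : B → A` are morphisms of
chain complexes and `h : A → A` is a map of degree `1` with `∂ h = g f - 1`, `f g = 1` and
`f h = 0`, `h h = 0`, `h g = 0`. -/
structure IsContraction {A : DGMod.{u, v} k} {B : DGMod.{u, w} k}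
    (f : A →ₗ[k] B) (g : B →ₗ[k] A) (h : A →ₗ[k] A) : Prop where
  deg_f : HasDegree 0 f
  deg_g : HasDegree 0 g
  deg_h : HasDegree 1 h
  bdry_f : bdry 0 f = 0
  bdry_g : bdry 0 g = 0
  bdry_h : bdry 1 h = g ∘ₗ f - LinearMap.id
  fg : f ∘ₗ g = LinearMap.id
  fh : f ∘ₗ h = 0
  hh : h ∘ₗ h = 0
  hg : h ∘ₗ g = 0

end DGMod

open DGMod

/-! ### Thick maps -/

section Thick

variable {k : Type u} [CommRing k]

/-- A sequence of linear maps `φ_n : A^{⊗ n} → B^{⊗ n}`, `n ≥ 0`. -/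
abbrev ThickSeq (A : DGMod.{u, v} k) (B : DGMod.{u, w} k) : Type _ :=
  ∀ n : ℕ, A.tpow n →ₗ[k] B.tpow n

namespace ThickSeq

variable {A : DGMod.{u, v} k} {B : DGMod.{u, w} k}

/-- `φ` is a thick map of degree `p`: all its levels are homogeneous of degree `p`. -/
def IsThick (p : ℤ) (φ : ThickSeq A B) : Prop := ∀ n, HasDegree p (φ n)

/-- `φ` is symmetric: every level is equivariant for the permutations of the tensor factors. -/
def IsSymmetric (φ : ThickSeq A B) : Prop :=
  ∀ (n : ℕ) (σ : Equiv.Perm (Fin n)), φ n ∘ₗ A.perm σ = B.perm σ ∘ₗ φ n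

/-- The first level of `φ`, seen as a map `A → B` through `A^{⊗ 1} = A` and `B^{⊗ 1} = B`. -/
def first (φ : ThickSeq A B) : A →ₗ[k] B :=
  (PiTensorProduct.subsingletonEquiv (R := k) (s := fun _ : Fin 1 => (B : Type w)) 0).toLinearMap ∘ₗ
    φ 1 ∘ₗ
    (PiTensorProduct.subsingletonEquiv (R := k) (s := fun _ : Fin 1 => (A : Type v)) 0).symm.toLinearMap

/-- The sequence `f^{⊗ n}` of tensor powers of a map `f` of degree `0`. -/
def pow (f : A →ₗ[k] B) : ThickSeq A B := fun _ => PiTensorProduct.map fun _ => f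

/-- A thick map `φ` of degree `0` is a morphism if `φ_n = φ_1^{⊗ n}` for all `n`. -/
def IsMorphism (φ : ThickSeq A B) : Prop := IsThick 0 φ ∧ φ = pow φ.first

/-- The tensor product `α ⊗ β : A^{⊗ (p + q)} → B^{⊗ (p + q)}` of maps `α : A^{⊗ p} → B^{⊗ p}` and
`β : A^{⊗ q} → B^{⊗ q}`, where `β` has degree `δ`: `(α ⊗ β)(x ⊗ y) = (-1)^(δ|x|) α x ⊗ β y`. -/
def tens {p q : ℕ} (δ : ℤ) (α : A.tpow p →ₗ[k] B.tpow p) (β : A.tpow q →ₗ[k] B.tpow q) :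
    A.tpow (p + q) →ₗ[k] B.tpow (p + q) :=
  TensorPower.mulEquiv.toLinearMap ∘ₗ
    TensorProduct.map (α ∘ₗ (A.tpow p).sgn (δ : ZMod 2)) β ∘ₗ
    (TensorPower.mulEquiv (R := k) (M := A) (n := p) (m := q)).symm.toLinearMap

/-- A thick map `h : A → A` of degree `δ` is a pseudo-derivation if
`(h_p ⊗ 1 - 1 ⊗ h_q) h_{p+q} = - h_{p+q} (h_p ⊗ 1 - 1 ⊗ h_q) = h_p ⊗ h_q` for all `p, q ≥ 0`. -/
def IsPseudoDerivation (δ : ℤ) (h : ThickSeq A A) : Prop :=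
  IsThick δ h ∧ ∀ p q : ℕ,
    (tens 0 (h p) (LinearMap.id : A.tpow q →ₗ[k] A.tpow q) -
        tens δ (LinearMap.id : A.tpow p →ₗ[k] A.tpow p) (h q)) ∘ₗ h (p + q) =
      tens δ (h p) (h q) ∧
    -(h (p + q) ∘ₗ (tens 0 (h p) (LinearMap.id : A.tpow q →ₗ[k] A.tpow q) -
        tens δ (LinearMap.id : A.tpow p →ₗ[k] A.tpow p) (h q))) =
      tens δ (h p) (h q)

/-- A symmetric thick contraction: `F`, `G` and `H` are symmetric thick maps that form a
contraction in the dg-category of thick maps. As differentials, composition and units of that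
category are levelwise, this says that each level is a contraction of `A^{⊗ n}` onto `B^{⊗ n}`. -/
structure IsSymmetricThickContraction (F : ThickSeq A B) (G : ThickSeq B A) (H : ThickSeq A A) :
    Prop where
  contraction : ∀ n, IsContraction (F n) (G n) (H n)
  symm_F : F.IsSymmetric
  symm_G : G.IsSymmetric
  symm_H : H.IsSymmetric

theorem pow_symmetric {f : A →ₗ[k] B} (hf : HasDegree 0 f) : (pow f).IsSymmetric := by
  intro n σ
  refine tpow_ext fun e a ha => ?_
  have hfa : ∀ i, f (a i) ∈ B.gr (e i) := fun i => by simpa using hf _ _ (ha i)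
  rw [LinearMap.comp_apply, LinearMap.comp_apply, perm_tprod A σ ha, map_smul, pow,
    PiTensorProduct.map_tprod, PiTensorProduct.map_tprod, perm_tprod B σ hfa]

/-- The tensor trick homotopy `h_n = ∑_{i+1+j=n} 1^{⊗ i} ⊗ h ⊗ (g f)^{⊗ j}` of a contraction. -/
def trick (f : A →ₗ[k] B) (g : B →ₗ[k] A) (h : A →ₗ[k] A) : ThickSeq A A :=
  fun _ => ∑ i, A.insertAt 1 h (g ∘ₗ f) i

/-- The symmetrized tensor trick homotopy `h^Σ_n = (1 / n!) ∑_σ σ⁻¹ h_n σ`. -/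
def symTrick [Algebra ℚ k] (f : A →ₗ[k] B) (g : B →ₗ[k] A) (h : A →ₗ[k] A) : ThickSeq A A :=
  fun n => algebraMap ℚ k (1 / (n.factorial : ℚ)) •
    ∑ σ : Equiv.Perm (Fin n), A.perm σ⁻¹ ∘ₗ trick f g h n ∘ₗ A.perm σ

theorem perm_mul (A : DGMod.{u, v} k) {n : ℕ} (σ τ : Equiv.Perm (Fin n)) :
    A.perm (σ * τ) = A.perm σ ∘ₗ A.perm τ := (A.permRep n).map_mul σ τ

theorem symTrick_symmetric [Algebra ℚ k] (f : A →ₗ[k] B) (g : B →ₗ[k] A) (h : A →ₗ[k] A) :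
    (symTrick f g h).IsSymmetric := by
  intro n τ
  rw [symTrick, LinearMap.smul_comp, LinearMap.comp_smul]
  congr 1
  refine LinearMap.ext fun x => ?_
  simp only [LinearMap.comp_apply, LinearMap.sum_apply, map_sum]
  rw [← Equiv.sum_comp (Equiv.mulRight τ)
    (fun σ => A.perm τ (A.perm σ⁻¹ (trick f g h n (A.perm σ x))))]
  refine Finset.sum_congr rfl fun σ _ => ?_
  rw [Equiv.coe_mulRight, ← LinearMap.comp_apply (A.perm τ), ← perm_mul, perm_mul A σ τ]
  simp only [mul_inv_rev, mul_inv_cancel_left]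
  rfl

end ThickSeq

end Thick

/-! ### Schur functors -/

/-- A symmetric sequence: chain complexes `O(n)`, `n ≥ 0`, with actions of the symmetric groups by
chain maps of degree `0`. -/
structure SymSeq (k : Type u) [CommRing k] where
  obj : ℕ → DGMod.{u, v} k
  act : ∀ n, Representation k (Equiv.Perm (Fin n)) (obj n)
  act_mem : ∀ n σ, HasDegree 0 (act n σ)
  act_d : ∀ n σ x, act n σ ((obj n).d x) = (obj n).d (act n σ x)

section Schur

variable {k : Type u} [CommRing k]

namespace SymSeq

/-- The diagonal action of the symmetric group on `O(n) ⊗ A^{⊗ n}`. -/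
def diagAct (O : SymSeq.{u, v} k) (A : DGMod.{u, w} k) (n : ℕ) :
    Representation k (Equiv.Perm (Fin n)) (tensor (O.obj n) (A.tpow n)) :=
  (O.act n).tprod (A.permRep n)

theorem diagAct_tmul (O : SymSeq.{u, v} k) (A : DGMod.{u, w} k) {n : ℕ}
    (σ : Equiv.Perm (Fin n)) (o : O.obj n) (y : A.tpow n) :
    O.diagAct A n σ (o ⊗ₜ[k] y) = O.act n σ o ⊗ₜ[k] A.perm σ y := rfl

theorem diagAct_mem (O : SymSeq.{u, v} k) (A : DGMod.{u, w} k) {n : ℕ}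
    (σ : Equiv.Perm (Fin n)) : HasDegree 0 (O.diagAct A n σ) := by
  intro m z hz
  rw [add_zero]
  change z ∈ tensorGr (O.obj n) (A.tpow n) m at hz
  change O.diagAct A n σ z ∈ tensorGr (O.obj n) (A.tpow n) m
  induction hz using Submodule.span_induction with
  | mem z hz =>
    obtain ⟨i, j, rfl, o, ho, y, hy, rfl⟩ := hz
    rw [diagAct_tmul]
    exact Submodule.subset_span ⟨i, j, rfl, _, by simpa using O.act_mem n σ i o ho, _,
      by simpa using A.perm_mem σ j y hy, rfl⟩
  | zero => simp
  | add a b _ _ ha hb => rw [map_add]; exact add_mem ha hb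
  | smul c a _ ha => rw [map_smul]; exact Submodule.smul_mem _ _ ha

theorem diagAct_d (O : SymSeq.{u, v} k) (A : DGMod.{u, w} k) {n : ℕ}
    (σ : Equiv.Perm (Fin n)) (z : tensor (O.obj n) (A.tpow n)) :
    O.diagAct A n σ ((tensor (O.obj n) (A.tpow n)).d z) =
      (tensor (O.obj n) (A.tpow n)).d (O.diagAct A n σ z) := by
  have : O.diagAct A n σ ∘ₗ tensorD (O.obj n) (A.tpow n) =
      tensorD (O.obj n) (A.tpow n) ∘ₗ O.diagAct A n σ := by
    refine tensor_ext fun i j o ho y hy => ?_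
    have h1 : O.act n σ o ∈ (O.obj n).gr i := by simpa using O.act_mem n σ i o ho
    rw [LinearMap.comp_apply, LinearMap.comp_apply, tensorD_tmul _ _ ho, diagAct_tmul,
      tensorD_tmul _ _ h1, map_add, map_smul, diagAct_tmul, diagAct_tmul, O.act_d, A.perm_d]
  exact LinearMap.congr_fun this z

/-- The complex `O(n) ⊗_{Σ_n} A^{⊗ n}`. The left action on `O(n)` stands for the right action
`o σ = σ⁻¹ o`, so that this is the complex of coinvariants of the diagonal action. -/
@[reducible] def piece (O : SymSeq.{u, v} k) (A : DGMod.{u, w} k) (n : ℕ) : DGMod k :=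
  coinv (tensor (O.obj n) (A.tpow n)) (O.diagAct A n) (fun σ => O.diagAct_mem A σ)
    (fun σ z => O.diagAct_d A σ z)

/-- The Schur functor on objects, `O[A] = ⨁ n, O(n) ⊗_{Σ_n} A^{⊗ n}`. -/
@[reducible] def schur (O : SymSeq.{u, v} k) (A : DGMod.{u, w} k) : DGMod k :=
  dsum (O.piece A)

/-- The canonical map `O(n) ⊗ A^{⊗ n} → O(n) ⊗_{Σ_n} A^{⊗ n}`. -/
def proj (O : SymSeq.{u, v} k) (A : DGMod.{u, w} k) (n : ℕ) :
    (O.obj n) ⊗[k] (A.tpow n) →ₗ[k] O.piece A n :=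
  Representation.Coinvariants.mk (O.diagAct A n)

/-- The canonical map `O(n) ⊗ A^{⊗ n} → O[A]`. -/
def incl (O : SymSeq.{u, v} k) (A : DGMod.{u, w} k) (n : ℕ) :
    (O.obj n) ⊗[k] (A.tpow n) →ₗ[k] O.schur A :=
  DirectSum.lof k ℕ (fun n => O.piece A n) n ∘ₗ O.proj A n

theorem proj_act (O : SymSeq.{u, v} k) (A : DGMod.{u, w} k) {n : ℕ}
    (σ : Equiv.Perm (Fin n)) (o : O.obj n) (y : A.tpow n) :
    O.proj A n (O.act n σ o ⊗ₜ[k] A.perm σ y) = O.proj A n (o ⊗ₜ[k] y) :=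
  Representation.Coinvariants.mk_self_apply (ρ := O.diagAct A n) σ (o ⊗ₜ[k] y)

/-- The Schur functor on morphisms, `O[f] = ⨁ n, 1 ⊗_{Σ_n} f^{⊗ n}`. -/
def schurMap (O : SymSeq.{u, v} k) {A : DGMod.{u, w} k} {B : DGMod.{u, x} k} (f : A →ₗ[k] B)
    (hf : HasDegree 0 f) : O.schur A →ₗ[k] O.schur B :=
  DirectSum.toModule k ℕ _ fun n => Representation.Coinvariants.lift (O.diagAct A n)
    (O.incl B n ∘ₗ TensorProduct.map LinearMap.id (ThickSeq.pow f n)) fun σ => by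
      apply TensorProduct.ext'
      intro o y
      have := LinearMap.congr_fun (ThickSeq.pow_symmetric hf n σ) y
      simp only [LinearMap.comp_apply] at this
      rw [LinearMap.comp_apply, diagAct_tmul, LinearMap.comp_apply, LinearMap.comp_apply,
        TensorProduct.map_tmul, TensorProduct.map_tmul, this, incl, LinearMap.comp_apply,
        LinearMap.comp_apply, LinearMap.id_apply, LinearMap.id_apply, proj_act]

end SymSeq

end Schur

section Multilinear

variable {k : Type u} [CommRing k]

/-- A function of `n` generators extends to a multilinear map as soon as it extends to a linear
map in each variable separately. -/
theorem exists_multilinear {ι : Type*} [Fintype ι] [DecidableEq ι] {X : ι → Type*} {N : ι → Type*}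
    {W : Type*} [∀ i, AddCommGroup (N i)] [∀ i, Module k (N i)] [AddCommGroup W] [Module k W]
    (gen : ∀ i, X i → N i) (hgen : ∀ i, Submodule.span k (Set.range (gen i)) = ⊤)
    (φ : (∀ i, X i) → W)
    (h : ∀ (i : ι) (x : ∀ i, X i), ∃ l : N i →ₗ[k] W, ∀ y, l (gen i y) =
      φ (Function.update x i y)) :
    ∃ F : MultilinearMap k N W, ∀ x : ∀ i, X i, F (fun i => gen i (x i)) = φ x := by
  classical
  let F0 : MultilinearMap k (fun i => X i →₀ k) W :=
    ((Finsupp.linearCombination k φ) ∘ₗ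
      (PiTensorProduct.ofFinsuppEquiv' (R := k) (κ := X)).toLinearMap).compMultilinearMap
      (PiTensorProduct.tprod k)
  have hF0 : ∀ x : ∀ i, X i, F0 (fun i => Finsupp.single (x i) 1) = φ x := by
    intro x
    simp [F0]
  let g : ∀ i, (X i →₀ k) →ₗ[k] N i := fun i => Finsupp.linearCombination k (gen i)
  have hg : ∀ i, Function.Surjective (g i) := by
    intro i
    rw [← LinearMap.range_eq_top, Finsupp.range_linearCombination, hgen]
  have hker : ∀ (i : ι) (z : X i →₀ k), g i z = 0 → ∀ l : ∀ i, X i →₀ k,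
      F0 (Function.update l i z) = 0 := by
    intro i z hz l
    let T : (⨂[k] j : ((({i} : Set ι)ᶜ : Set ι)), (X j →₀ k)) →ₗ[k] W :=
      PiTensorProduct.lift F0 ∘ₗ
        (PiTensorProduct.equivPiTensorComplSingletonTensor k (fun i => X i →₀ k) i).symm.toLinearMap ∘ₗ
        (TensorProduct.mk k _ _).flip z
    have hT : ∀ l : ∀ i, X i →₀ k, T (PiTensorProduct.tprod k fun j => l j) =
        F0 (Function.update l i z) := by
      intro l
      have := PiTensorProduct.equivPiTensorComplSingletonTensor_tprod (R := k)
        (M := fun i => X i →₀ k) i (Function.update l i z)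
      simp only [T, LinearMap.comp_apply, LinearMap.flip_apply, TensorProduct.mk_apply,
        LinearEquiv.coe_coe]
      rw [← PiTensorProduct.lift.tprod (φ := F0)]
      congr 1
      rw [LinearEquiv.symm_apply_eq, this]
      congr 1
      · congr 1
        funext j
        rw [Function.update_of_ne]
        exact j.2
      · simp
    have hT0 : T = 0 := by
      refine PiTensorProduct.ext_of_span_eq_top (γ := fun j : ((({i} : Set ι)ᶜ : Set ι)) => X j)
        (g := fun j y => Finsupp.single y (1 : k)) ?_ ?_
      · rintro ⟨j, hj⟩
        rw [eq_top_iff, ← (Finsupp.basisSingleOne (R := k) (ι := X j)).span_eq]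
        apply Submodule.span_mono
        rintro _ ⟨y, rfl⟩
        exact ⟨y, by simp⟩
      · intro y
        by_cases hne : Nonempty (X i)
        · obtain ⟨y0⟩ := hne
          let y' : ∀ j, X j := fun j => if hj : j = i then hj ▸ y0 else y ⟨j, hj⟩
          have hy' : ∀ j : (({i} : Set ι)ᶜ : Set ι), y' j = y j := by
            intro j
            have : (j : ι) ≠ i := j.2
            simp [y', this]
          have := hT (fun j => Finsupp.single (y' j) 1)
          simp only [hy'] at this
          rw [this, LinearMap.zero_apply]
          obtain ⟨L, hL⟩ := h i y'
          have key : (F0.toLinearMap (fun j => Finsupp.single (y' j) (1 : k)) i) = L ∘ₗ g i := by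
            apply Finsupp.lhom_ext'
            intro c
            apply LinearMap.ext_ring
            simp only [LinearMap.comp_apply, Finsupp.lsingle_apply, g,
              Finsupp.linearCombination_single, one_smul, hL, MultilinearMap.toLinearMap_apply]
            rw [← hF0]
            congr 1
            funext j
            by_cases hj : j = i
            · subst hj; simp
            · simp [Function.update_of_ne hj]
          have := LinearMap.congr_fun key z
          rw [LinearMap.comp_apply, hz, map_zero, MultilinearMap.toLinearMap_apply] at this
          exact this
        · have : IsEmpty (X i) := not_nonempty_iff.mp hne
          have hz0 : z = 0 := Subsingleton.elim _ _
          simp [T, hz0]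
    rw [← hT, hT0, LinearMap.zero_apply]
  let c : ∀ i, N i → (X i →₀ k) := fun i => Function.surjInv (hg i)
  have hc : ∀ i y, g i (c i y) = y := fun i => Function.surjInv_eq (hg i)
  have hcongr1 : ∀ (i : ι) (z z' : X i →₀ k) (l : ∀ i, X i →₀ k), g i z = g i z' →
      F0 (Function.update l i z) = F0 (Function.update l i z') := by
    intro i z z' l hzz
    rw [← sub_eq_zero, ← MultilinearMap.map_update_sub]
    exact hker i _ (by rw [map_sub, hzz, sub_self]) l
  have hcongr : ∀ l l' : ∀ i, X i →₀ k, (∀ i, g i (l i) = g i (l' i)) → F0 l = F0 l' := by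
    intro l l' hl
    have : ∀ s : Finset ι, F0 (s.piecewise l' l) = F0 l := by
      intro s
      induction s using Finset.induction_on with
      | empty => simp
      | insert i s hi ih =>
        rw [Finset.piecewise_insert, hcongr1 i (l' i) (l i) _ (hl i).symm, ← ih]
        congr 1
        have : s.piecewise l' l i = l i := by simp [hi]
        rw [← this, Function.update_eq_self]
    rw [← this Finset.univ, Finset.piecewise_univ]
  have hup : ∀ (i : ι) (m : ∀ i, N i) (y : N i) (z : X i →₀ k), g i z = y →
      F0 (fun j => c j (Function.update m i y j)) =
        F0 (Function.update (fun j => c j (m j)) i z) := by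
    intro i m y z hz
    apply hcongr
    intro j
    by_cases hj : j = i
    · subst hj; simp [hc, hz]
    · simp [Function.update_of_ne hj]
  refine ⟨MultilinearMap.mk' (fun m => F0 (fun i => c i (m i))) ?_ ?_, ?_⟩
  · intro m i y y'
    rw [hup i m (y + y') (c i y + c i y') (by rw [map_add, hc, hc]),
      hup i m y (c i y) (hc i y), hup i m y' (c i y') (hc i y'), MultilinearMap.map_update_add]
  · intro m i r y
    rw [hup i m (r • y) (r • c i y) (by rw [map_smul, hc]),
      hup i m y (c i y) (hc i y), MultilinearMap.map_update_smul]
  · intro x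
    change F0 _ = _
    rw [← hF0]
    apply hcongr
    intro i
    rw [hc]
    simp [g]

end Multilinear

/-! ### Block permutations -/

section Blocks

variable {n : ℕ} (r : Fin n → ℕ)

/-- The permutation of `r_1 + ⋯ + r_n` letters that acts on the `i`-th block as `τ i`. -/
def blockPerm (τ : ∀ i, Equiv.Perm (Fin (r i))) : Equiv.Perm (Fin (∑ i, r i)) :=
  finSigmaFinEquiv.permCongr (Equiv.sigmaCongrRight τ)

theorem blockPerm_apply (τ : ∀ i, Equiv.Perm (Fin (r i))) (i : Fin n) (j : Fin (r i)) :
    blockPerm r τ (finSigmaFinEquiv ⟨i, j⟩) = finSigmaFinEquiv ⟨i, τ i j⟩ := by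
  simp [blockPerm, Equiv.permCongr_apply]

theorem blockPerm_symm_apply (τ : ∀ i, Equiv.Perm (Fin (r i))) (i : Fin n) (j : Fin (r i)) :
    (blockPerm r τ).symm (finSigmaFinEquiv ⟨i, j⟩) = finSigmaFinEquiv ⟨i, (τ i).symm j⟩ := by
  rw [Equiv.symm_apply_eq, blockPerm_apply]; simp

theorem finSigma_lt_of_lt {i i' : Fin n} (h : i < i') (j : Fin (r i)) (j' : Fin (r i')) :
    (finSigmaFinEquiv ⟨i, j⟩ : Fin (∑ i, r i)) < finSigmaFinEquiv ⟨i', j'⟩ := by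
  rw [Fin.lt_def, finSigmaFinEquiv_apply, finSigmaFinEquiv_apply]
  have key : ∀ (a b : ℕ) (hab : a < b) (hb : b ≤ n),
      (∑ l : Fin a, r (Fin.castLE (hab.le.trans hb) l)) + r ⟨a, hab.trans_le hb⟩ ≤
        ∑ l : Fin b, r (Fin.castLE hb l) := by
    intro a b hab hb
    have h1 : ∑ l : Fin (a + 1), r (Fin.castLE (hab.trans_le hb) l) =
        (∑ l : Fin a, r (Fin.castLE (hab.le.trans hb) l)) + r ⟨a, hab.trans_le hb⟩ := by
      rw [Fin.sum_univ_castSucc]; rfl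
    rw [← h1]
    obtain ⟨c, rfl⟩ := Nat.exists_eq_add_of_le (Nat.succ_le_of_lt hab)
    rw [Fin.sum_univ_add (b := c)]
    exact Nat.le_add_right _ _
  have h1 := key i i' h i'.2.le
  have h2 : (j : ℕ) < r i := j.2
  have h4 := lt_of_lt_of_le (Nat.add_lt_add_left h2 _) h1
  exact lt_of_lt_of_le h4 (Nat.le_add_right _ _)

theorem finSigma_lt_iff (i : Fin n) (j j' : Fin (r i)) :
    (finSigmaFinEquiv ⟨i, j⟩ : Fin (∑ i, r i)) < finSigmaFinEquiv ⟨i, j'⟩ ↔ j < j' := by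
  rw [Fin.lt_def, finSigmaFinEquiv_apply, finSigmaFinEquiv_apply, Fin.lt_def]
  simp

theorem koszulExp_blockPerm (τ : ∀ i, Equiv.Perm (Fin (r i))) (e : Fin (∑ i, r i) → ZMod 2) :
    koszulExp (blockPerm r τ) e =
      ∑ i, koszulExp (τ i) fun j => e (finSigmaFinEquiv ⟨i, j⟩) := by
  unfold koszulExp
  rw [← Equiv.sum_comp finSigmaFinEquiv, Fintype.sum_sigma]
  refine Finset.sum_congr rfl fun i _ => Finset.sum_congr rfl fun j _ => ?_
  rw [← Equiv.sum_comp finSigmaFinEquiv, Fintype.sum_sigma, Finset.sum_eq_single i]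
  · refine Finset.sum_congr rfl fun j' _ => ?_
    simp only [blockPerm_apply, finSigma_lt_iff]
  · intro i' _ hi'
    refine Finset.sum_eq_zero fun j' _ => if_neg ?_
    simp only [blockPerm_apply]
    rintro ⟨h1, h2⟩
    rcases lt_or_gt_of_ne hi' with h | h
    · exact absurd h1 (not_lt_of_gt (finSigma_lt_of_lt r h _ _))
    · exact absurd h2 (not_lt_of_gt (finSigma_lt_of_lt r h _ _))
  · simp

end Blocks

section ExtSchur

variable {k : Type u} [CommRing k]

theorem ksgn_sum (k : Type u) [CommRing k] {ι : Type*} (s : Finset ι) (e : ι → ZMod 2) :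
    ksgn k (∑ i ∈ s, e i) = ∏ i ∈ s, ksgn k (e i) := by
  classical
  induction s using Finset.induction_on with
  | empty => simp [ksgn_zero]
  | insert a s ha ih => rw [Finset.sum_insert ha, Finset.prod_insert ha, ksgn_add, ih]

namespace DGMod

theorem split_aux (A : DGMod.{u, v} k) {n : ℕ} (r : Fin n → ℕ) (b : Fin (∑ i, r i) → A) (i : Fin n)
    (j : Fin (r i)) (z : A) :
    (fun i' => (PiTensorProduct.tprod k fun j' =>
      Function.update b (finSigmaFinEquiv ⟨i, j⟩) z (finSigmaFinEquiv ⟨i', j'⟩) :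
        A.tpow (r i'))) =
      Function.update (fun i' => (PiTensorProduct.tprod k fun j' =>
        b (finSigmaFinEquiv ⟨i', j'⟩) : A.tpow (r i'))) i
        (PiTensorProduct.tprod k
          (Function.update (fun j' => b (finSigmaFinEquiv ⟨i, j'⟩)) j z)) := by
  funext i'
  by_cases hi : i' = i
  · subst hi
    rw [Function.update_self]
    congr 1
    funext j'
    by_cases hj : j' = j
    · subst hj; simp
    · rw [Function.update_of_ne hj, Function.update_of_ne]
      simpa using hj
  · rw [Function.update_of_ne hi]
    congr 1
    funext j'
    rw [Function.update_of_ne]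
    intro hh
    exact hi (congrArg Sigma.fst (finSigmaFinEquiv.injective hh))

/-- The canonical isomorphism `A^{⊗ (r_1 + ⋯ + r_n)} → A^{⊗ r_1} ⊗ ⋯ ⊗ A^{⊗ r_n}`, which cuts a
tensor into consecutive blocks. -/
def split (A : DGMod.{u, v} k) {n : ℕ} (r : Fin n → ℕ) :
    A.tpow (∑ i, r i) →ₗ[k] ⨂[k] i, A.tpow (r i) :=
  PiTensorProduct.lift <| MultilinearMap.mk'
    (fun b => PiTensorProduct.tprod k fun i =>
      (PiTensorProduct.tprod k fun j => b (finSigmaFinEquiv ⟨i, j⟩) : A.tpow (r i)))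
    (fun b l y y' => by
      obtain ⟨⟨i, j⟩, rfl⟩ := finSigmaFinEquiv.surjective l
      simp only [split_aux, MultilinearMap.map_update_add])
    (fun b l c y => by
      obtain ⟨⟨i, j⟩, rfl⟩ := finSigmaFinEquiv.surjective l
      simp only [split_aux, MultilinearMap.map_update_smul])

theorem split_tprod (A : DGMod.{u, v} k) {n : ℕ} (r : Fin n → ℕ) (b : Fin (∑ i, r i) → A) :
    A.split r (PiTensorProduct.tprod k b) = PiTensorProduct.tprod k fun i =>
      (PiTensorProduct.tprod k fun j => b (finSigmaFinEquiv ⟨i, j⟩) : A.tpow (r i)) := by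
  simp [split]

theorem split_blockPerm (A : DGMod.{u, v} k) {n : ℕ} (r : Fin n → ℕ)
    (τ : ∀ i, Equiv.Perm (Fin (r i))) :
    A.split r ∘ₗ A.perm (blockPerm r τ) =
      PiTensorProduct.map (fun i => A.perm (τ i)) ∘ₗ A.split r := by
  refine tpow_ext fun e a ha => ?_
  rw [LinearMap.comp_apply, LinearMap.comp_apply, perm_tprod A _ ha, map_smul, split_tprod,
    split_tprod, PiTensorProduct.map_tprod]
  have : (fun i => A.perm (τ i) (PiTensorProduct.tprod k fun j => a (finSigmaFinEquiv ⟨i, j⟩))) =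
      fun i => ksgn k (koszulExp (τ i) fun j => (e (finSigmaFinEquiv ⟨i, j⟩) : ZMod 2)) •
        (PiTensorProduct.tprod k fun j => a (finSigmaFinEquiv ⟨i, (τ i).symm j⟩) :
          A.tpow (r i)) := by
    funext i
    exact perm_tprod A (τ i) (fun j => ha (finSigmaFinEquiv ⟨i, j⟩))
  rw [this, MultilinearMap.map_smul_univ, ← ksgn_sum, koszulExp_blockPerm]
  simp only [blockPerm_symm_apply]

/-- The map on `A^{⊗ (r_1 + ⋯ + r_n)}` that multiplies the elements whose `i`-th block has degree
`m_i` by the sign `∏ i, (-1)^(t_i m_i)`. -/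
def blockSgn (A : DGMod.{u, v} k) {n : ℕ} (r : Fin n → ℕ) (t : Fin n → ZMod 2) :
    A.tpow (∑ i, r i) →ₗ[k] A.tpow (∑ i, r i) :=
  PiTensorProduct.map fun l => A.sgn (t (finSigmaFinEquiv.symm l).1)

theorem sgn_mem (A : DGMod.{u, v} k) (t : ZMod 2) {i : ℤ} {y : A} (hy : y ∈ A.gr i) :
    A.sgn t y ∈ A.gr i := by
  rw [sgn_of_mem _ _ hy]; exact Submodule.smul_mem _ _ hy

theorem blockSgn_blockPerm (A : DGMod.{u, v} k) {n : ℕ} (r : Fin n → ℕ) (t : Fin n → ZMod 2)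
    (τ : ∀ i, Equiv.Perm (Fin (r i))) :
    A.blockSgn r t ∘ₗ A.perm (blockPerm r τ) = A.perm (blockPerm r τ) ∘ₗ A.blockSgn r t := by
  refine tpow_ext fun e a ha => ?_
  rw [LinearMap.comp_apply, LinearMap.comp_apply, perm_tprod A _ ha, map_smul, blockSgn,
    PiTensorProduct.map_tprod, PiTensorProduct.map_tprod,
    perm_tprod A _ (fun l => sgn_mem A _ (ha l))]
  congr 2
  funext l
  obtain ⟨⟨i, j⟩, rfl⟩ := finSigmaFinEquiv.surjective l
  simp [blockPerm_symm_apply]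

end DGMod

namespace SymSeq

/-- The unsigned map `(o_1 ⊗ ⋯ ⊗ o_n, x_1 ⊗ ⋯ ⊗ x_n) ↦ [o_1 ⊗ x_1] ⊗ ⋯ ⊗ [o_n ⊗ x_n]`, from
`(O(r_1) ⊗ ⋯ ⊗ O(r_n)) × (A^{⊗ r_1} ⊗ ⋯ ⊗ A^{⊗ r_n})` to `O[A]^{⊗ n}`. -/
def join (O : SymSeq.{u, v} k) (A : DGMod.{u, w} k) {n : ℕ} (r : Fin n → ℕ) :
    (⨂[k] i, O.obj (r i)) →ₗ[k] (⨂[k] i, A.tpow (r i)) →ₗ[k] (O.schur A).tpow n :=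
  PiTensorProduct.map₂ fun i => (TensorProduct.mk k (O.obj (r i)) (A.tpow (r i))).compr₂
    (O.incl A (r i))

/-- The parity of `o_{i+1} ⊗ ⋯ ⊗ o_n` when `o_j` has parity `s_j`. -/
def after {n : ℕ} (s : Fin n → ZMod 2) (i : Fin n) : ZMod 2 := ∑ j, if i < j then s j else 0

/-- The summand `(r_1, …, r_n)` of the `n`-th level of the extended Schur functor, applied to a
sequence `φ` of degree `p`: the map `1 ⊗ φ_{r_1 + ⋯ + r_n}` on
`(O(r_1) ⊗ ⋯ ⊗ O(r_n)) ⊗ A^{⊗ (r_1 + ⋯ + r_n)}`, followed by the shuffle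
`O(r_1) ⊗ ⋯ ⊗ O(r_n) ⊗ B^{⊗ r_1} ⊗ ⋯ ⊗ B^{⊗ r_n} → ⨂ i, O(r_i) ⊗ B^{⊗ r_i}` and preceded by the
inverse shuffle for `A`. For `o_i` of parity `s_i`, the shuffles carry the Koszul sign of moving the
`i`-th block of letters past `o_{i+1}, …, o_n`, and `φ` passes `o_1, …, o_n`. See
`schurLevel_of_mem` for the formula on homogeneous `o_i`. -/
def schurLevel (O : SymSeq.{u, v} k) {A : DGMod.{u, w} k} {B : DGMod.{u, x} k} (p : ℤ)
    (φ : ThickSeq A B) {n : ℕ} (r : Fin n → ℕ) :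
    (⨂[k] i, O.obj (r i)) →ₗ[k] A.tpow (∑ i, r i) →ₗ[k] (O.schur B).tpow n :=
  ∑ s : Fin n → ZMod 2, ksgn k ((p : ZMod 2) * ∑ i, s i) •
    (((O.join B r).compl₂ (B.split r ∘ₗ B.blockSgn r (after s) ∘ₗ φ (∑ i, r i) ∘ₗ
      A.blockSgn r (after s))) ∘ₗ PiTensorProduct.map fun i => (O.obj (r i)).par (s i))

theorem schurLevel_of_mem (O : SymSeq.{u, v} k) {A : DGMod.{u, w} k} {B : DGMod.{u, x} k} (p : ℤ)
    (φ : ThickSeq A B) {n : ℕ} (r : Fin n → ℕ) (d : Fin n → ℤ) (o : ∀ i, O.obj (r i))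
    (ho : ∀ i, o i ∈ (O.obj (r i)).gr (d i)) (y : A.tpow (∑ i, r i)) :
    O.schurLevel p φ r (PiTensorProduct.tprod k o) y =
      ksgn k ((p : ZMod 2) * ∑ i, (d i : ZMod 2)) •
        O.join B r (PiTensorProduct.tprod k o)
          (B.split r (B.blockSgn r (after fun i => (d i : ZMod 2))
            (φ (∑ i, r i) (A.blockSgn r (after fun i => (d i : ZMod 2)) y)))) := by
  simp only [schurLevel, LinearMap.sum_apply, LinearMap.smul_apply, LinearMap.comp_apply,
    LinearMap.compl₂_apply, PiTensorProduct.map_tprod]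
  rw [Finset.sum_eq_single fun i => (d i : ZMod 2)]
  · congr 4
    funext i
    rw [par_of_mem _ _ (ho i), if_pos rfl]
  · intro s _ hs
    obtain ⟨i, hi⟩ := Function.ne_iff.mp hs
    rw [(PiTensorProduct.tprod k).map_coord_zero i]
    · simp
    · rw [par_of_mem _ _ (ho i), if_neg (Ne.symm hi)]
  · simp

theorem par_act (O : SymSeq.{u, v} k) {m : ℕ} (σ : Equiv.Perm (Fin m)) (s : ZMod 2) (o : O.obj m) :
    (O.obj m).par s (O.act m σ o) = O.act m σ ((O.obj m).par s o) := by
  induction o using (O.obj m).induction_hom with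
  | h i y hy =>
    have h1 : O.act m σ y ∈ (O.obj m).gr i := by simpa using O.act_mem m σ i y hy
    rw [par_of_mem _ _ hy, par_of_mem _ _ h1]
    split_ifs <;> simp
  | h0 => simp
  | hadd y z hy hz => simp [hy, hz]

theorem join_act (O : SymSeq.{u, v} k) (A : DGMod.{u, w} k) {n : ℕ} (r : Fin n → ℕ)
    (τ : ∀ i, Equiv.Perm (Fin (r i))) (o : ∀ i, O.obj (r i)) (y : ⨂[k] i, A.tpow (r i)) :
    O.join A r (PiTensorProduct.tprod k fun i => O.act (r i) (τ i) (o i))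
        (PiTensorProduct.map (fun i => A.perm (τ i)) y) =
      O.join A r (PiTensorProduct.tprod k o) y := by
  have : O.join A r (PiTensorProduct.tprod k fun i => O.act (r i) (τ i) (o i)) ∘ₗ
      PiTensorProduct.map (fun i => A.perm (τ i)) = O.join A r (PiTensorProduct.tprod k o) := by
    apply PiTensorProduct.ext
    ext y
    simp only [LinearMap.compMultilinearMap_apply, LinearMap.comp_apply,
      PiTensorProduct.map_tprod, join, PiTensorProduct.map₂_tprod_tprod]
    congr 1
    funext i
    change O.incl A (r i) _ = O.incl A (r i) _
    rw [incl, LinearMap.comp_apply, LinearMap.comp_apply]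
    exact congrArg _ (O.proj_act A (τ i) (o i) (y i))
  exact LinearMap.congr_fun this y

theorem schurLevel_act (O : SymSeq.{u, v} k) {A : DGMod.{u, w} k} {B : DGMod.{u, x} k} (p : ℤ)
    (φ : ThickSeq A B) (hφ : φ.IsSymmetric) {n : ℕ} (r : Fin n → ℕ)
    (τ : ∀ i, Equiv.Perm (Fin (r i))) (o : ∀ i, O.obj (r i)) (y : A.tpow (∑ i, r i)) :
    O.schurLevel p φ r (PiTensorProduct.tprod k fun i => O.act (r i) (τ i) (o i))
        (A.perm (blockPerm r τ) y) =
      O.schurLevel p φ r (PiTensorProduct.tprod k o) y := by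
  simp only [schurLevel, LinearMap.sum_apply, LinearMap.smul_apply, LinearMap.comp_apply,
    LinearMap.compl₂_apply, PiTensorProduct.map_tprod]
  refine Finset.sum_congr rfl fun s _ => ?_
  congr 1
  simp only [par_act]
  have h1 := fun z => LinearMap.congr_fun (A.blockSgn_blockPerm r (after s) τ) z
  have h2 := fun z => LinearMap.congr_fun (B.blockSgn_blockPerm r (after s) τ) z
  have h3 := fun z => LinearMap.congr_fun (hφ _ (blockPerm r τ)) z
  have h4 := fun z => LinearMap.congr_fun (B.split_blockPerm r τ) z
  simp only [LinearMap.comp_apply] at h1 h2 h3 h4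
  rw [h1, h3, h2, h4, join_act]

/-- The concatenation of a family of finite sequences. -/
def flat {n : ℕ} {r : Fin n → ℕ} {X : Type*} (a : ∀ i, Fin (r i) → X) : Fin (∑ i, r i) → X :=
  fun l => a (finSigmaFinEquiv.symm l).1 (finSigmaFinEquiv.symm l).2

theorem flat_apply {n : ℕ} {r : Fin n → ℕ} {X : Type*} (a : ∀ i, Fin (r i) → X) (i : Fin n)
    (j : Fin (r i)) : flat a (finSigmaFinEquiv ⟨i, j⟩) = a i j := by
  unfold flat
  rw [Equiv.symm_apply_apply]

theorem flat_update {n : ℕ} {r : Fin n → ℕ} {X : Type*} (a : ∀ i, Fin (r i) → X) (i : Fin n)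
    (b : Fin (r i) → X) (j : Fin (r i)) (y : X) :
    flat (Function.update a i (Function.update b j y)) =
      Function.update (flat (Function.update a i b)) (finSigmaFinEquiv ⟨i, j⟩) y := by
  funext l
  obtain ⟨⟨i', j'⟩, rfl⟩ := finSigmaFinEquiv.surjective l
  rw [flat_apply]
  by_cases hi : i' = i
  · subst hi
    simp only [Function.update_self]
    by_cases hj : j' = j
    · subst hj; simp
    · rw [Function.update_of_ne hj, Function.update_of_ne]
      · rw [flat_apply, Function.update_self]
      · simpa using hj
  · rw [Function.update_of_ne hi, Function.update_of_ne]
    · rw [flat_apply, Function.update_of_ne hi]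
    · intro hh
      exact hi (congrArg Sigma.fst (finSigmaFinEquiv.injective hh))

/-- Insertion of `x_i ∈ A^{⊗ r_i}` in the `i`-th block of a tensor. -/
def insertBlock (A : DGMod.{u, w} k) {n : ℕ} {r : Fin n → ℕ} (a : ∀ i, Fin (r i) → A) (i : Fin n) :
    A.tpow (r i) →ₗ[k] A.tpow (∑ i, r i) :=
  PiTensorProduct.lift <| MultilinearMap.mk'
    (fun b => (PiTensorProduct.tprod k (flat (Function.update a i b)) : A.tpow (∑ i, r i)))
    (fun b j y y' => by simp only [flat_update, MultilinearMap.map_update_add])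
    (fun b j c y => by simp only [flat_update, MultilinearMap.map_update_smul])

theorem insertBlock_tprod (A : DGMod.{u, w} k) {n : ℕ} {r : Fin n → ℕ} (a : ∀ i, Fin (r i) → A)
    (i : Fin n) (b : Fin (r i) → A) :
    insertBlock A a i (PiTensorProduct.tprod k b) =
      PiTensorProduct.tprod k (flat (Function.update a i b)) := by
  simp [insertBlock]

theorem insertBlock_perm (A : DGMod.{u, w} k) {n : ℕ} {r : Fin n → ℕ} (e : ∀ i, Fin (r i) → ℤ)
    (a : ∀ i, Fin (r i) → A) (ha : ∀ i j, a i j ∈ A.gr (e i j)) (i : Fin n)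
    (σ : Equiv.Perm (Fin (r i))) (y : A.tpow (r i)) :
    insertBlock A a i (A.perm σ y) =
      A.perm (blockPerm r (Function.update (fun _ => 1) i σ)) (insertBlock A a i y) := by
  have : insertBlock A a i ∘ₗ A.perm σ =
      A.perm (blockPerm r (Function.update (fun _ => 1) i σ)) ∘ₗ insertBlock A a i := by
    refine tpow_ext fun d b hb => ?_
    have hm : ∀ l, flat (Function.update a i b) l ∈ A.gr (flat (Function.update e i d) l) := by
      intro l
      obtain ⟨⟨i', j'⟩, rfl⟩ := finSigmaFinEquiv.surjective l
      rw [flat_apply, flat_apply]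
      by_cases hi : i' = i
      · subst hi; simpa using hb j'
      · simpa [Function.update_of_ne hi] using ha i' j'
    have hsum : (∑ i', koszulExp (Function.update (fun i => (1 : Equiv.Perm (Fin (r i)))) i σ i')
        fun j => ((flat (Function.update e i d) (finSigmaFinEquiv ⟨i', j⟩) : ℤ) : ZMod 2)) =
        koszulExp σ fun j => (d j : ZMod 2) := by
      rw [Finset.sum_eq_single_of_mem i (Finset.mem_univ i)]
      · simp only [flat_apply, Function.update_self]
      · intro i' _ hi
        rw [Function.update_of_ne hi, koszulExp_one]
    rw [LinearMap.comp_apply, LinearMap.comp_apply, perm_tprod A _ hb, map_smul,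
      insertBlock_tprod, insertBlock_tprod, perm_tprod A _ hm, koszulExp_blockPerm, hsum]
    congr 2
    funext l
    obtain ⟨⟨i', j'⟩, rfl⟩ := finSigmaFinEquiv.surjective l
    rw [blockPerm_symm_apply, flat_apply, flat_apply]
    by_cases hi : i' = i
    · subst hi; simp
    · simp only [Function.update_of_ne hi]; rfl
  exact LinearMap.congr_fun this y

theorem span_proj (O : SymSeq.{u, v} k) (A : DGMod.{u, w} k) (m : ℕ) :
    Submodule.span k (Set.range fun x : O.obj m × (Fin m → A.Homog) =>
      O.proj A m (x.1 ⊗ₜ[k] (PiTensorProduct.tprod k fun j => (x.2 j : A)))) = ⊤ := by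
  rw [← (Submodule.span k _).ker_mkQ, LinearMap.ker_eq_top]
  apply Representation.Coinvariants.hom_ext
  apply TensorProduct.ext
  apply LinearMap.ext
  intro o
  refine tpow_ext fun e a ha => ?_
  refine (Submodule.Quotient.mk_eq_zero _).2 ?_
  exact Submodule.subset_span ⟨(o, fun j => ⟨a j, e j, ha j⟩), rfl⟩

theorem exists_schurLevel (O : SymSeq.{u, v} k) {A : DGMod.{u, w} k} {B : DGMod.{u, x} k} (p : ℤ)
    (φ : ThickSeq A B) (hφ : φ.IsSymmetric) {n : ℕ} (r : Fin n → ℕ) :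
    ∃ F : MultilinearMap k (fun i => O.piece A (r i)) ((O.schur B).tpow n),
      ∀ (x : ∀ i, O.obj (r i) × (Fin (r i) → A.Homog)),
        F (fun i => O.proj A (r i)
          ((x i).1 ⊗ₜ[k] (PiTensorProduct.tprod k fun j => ((x i).2 j : A)))) =
        O.schurLevel p φ r (PiTensorProduct.tprod k fun i => (x i).1)
          (PiTensorProduct.tprod k (flat fun i j => ((x i).2 j : A))) := by
  refine exists_multilinear (X := fun i => O.obj (r i) × (Fin (r i) → A.Homog))
    (N := fun i => O.piece A (r i)) (fun i x => O.proj A (r i)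
      (x.1 ⊗ₜ[k] (PiTensorProduct.tprod k fun j => (x.2 j : A))))
    (fun i => O.span_proj A (r i))
    (fun x => O.schurLevel p φ r (PiTensorProduct.tprod k fun i => (x i).1)
          (PiTensorProduct.tprod k (flat fun i j => ((x i).2 j : A)))) ?_
  intro i x
  let o : ∀ i, O.obj (r i) := fun i => (x i).1
  let a : ∀ i, Fin (r i) → A := fun i j => ((x i).2 j : A)
  let L : (O.obj (r i)) →ₗ[k] A.tpow (r i) →ₗ[k] (O.schur B).tpow n :=
    ((O.schurLevel p φ r).compl₂ (insertBlock A a i)) ∘ₗ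
      (PiTensorProduct.tprod k).toLinearMap o i
  have hL : ∀ o' y, L o' y = O.schurLevel p φ r (PiTensorProduct.tprod k (Function.update o i o'))
      (insertBlock A a i y) := fun _ _ => rfl
  refine ⟨Representation.Coinvariants.lift _ (TensorProduct.lift L) ?_, ?_⟩
  · intro σ
    apply TensorProduct.ext'
    intro o' y
    rw [LinearMap.comp_apply, diagAct_tmul, TensorProduct.lift.tmul, TensorProduct.lift.tmul,
      hL, hL, insertBlock_perm A (fun i j => ((x i).2 j).2.choose) a
        (fun i j => ((x i).2 j).2.choose_spec)]
    rw [← O.schurLevel_act p φ hφ r (Function.update (fun _ => 1) i σ) (Function.update o i o')]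
    congr 2
    congr 1
    funext i'
    by_cases hi : i' = i
    · subst hi; simp
    · simp [Function.update_of_ne hi]
  · rintro ⟨o', b⟩
    change L o' _ = _
    rw [hL, insertBlock_tprod]
    congr 2
    · congr 1
      funext i'
      by_cases hi : i' = i
      · subst hi; simp
      · simp [Function.update_of_ne hi, o]
    · congr 1
      funext i' j'
      by_cases hi : i' = i
      · subst hi; simp
      · simp [Function.update_of_ne hi, a]

/-- The extended Schur functor on symmetric sequences `φ` of degree `p`. On the summand of
`O[A]^{⊗ n}` indexed by `(r_1, …, r_n)`, the map `O_n[φ]` acts on the factor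
`A^{⊗ (r_1 + ⋯ + r_n)}` as `φ_{r_1 + ⋯ + r_n}`. It is the unique linear map with the values of
`extSchur_apply`. -/
def extSchur (O : SymSeq.{u, v} k) {A : DGMod.{u, w} k} {B : DGMod.{u, x} k} (p : ℤ)
    (φ : ThickSeq A B) (hφ : φ.IsSymmetric) : ThickSeq (O.schur A) (O.schur B) :=
  fun n => PiTensorProduct.lift <| MultilinearMap.fromDirectSumEquiv
    (κ := fun _ : Fin n => ℕ) (M := fun _ m => O.piece A m)
    fun r : Fin n → ℕ => (O.exists_schurLevel p φ hφ r).choose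

theorem extSchur_apply (O : SymSeq.{u, v} k) {A : DGMod.{u, w} k} {B : DGMod.{u, x} k} (p : ℤ)
    (φ : ThickSeq A B) (hφ : φ.IsSymmetric) {n : ℕ} (r : Fin n → ℕ) (o : ∀ i, O.obj (r i))
    (a : ∀ i, Fin (r i) → A) :
    O.extSchur p φ hφ n (PiTensorProduct.tprod k fun i =>
        O.incl A (r i) (o i ⊗ₜ[k] (PiTensorProduct.tprod k (a i)))) =
      O.schurLevel p φ r (PiTensorProduct.tprod k o) (PiTensorProduct.tprod k (flat a)) := by
  let L : (A.tpow (∑ i, r i)) →ₗ[k] (O.schur B).tpow n :=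
    O.extSchur p φ hφ n ∘ₗ PiTensorProduct.map
      (fun i => O.incl A (r i) ∘ₗ TensorProduct.mk k (O.obj (r i)) (A.tpow (r i)) (o i)) ∘ₗ
      A.split r
  have hL : ∀ b : ∀ i, Fin (r i) → A, L (PiTensorProduct.tprod k (flat b)) =
      O.extSchur p φ hφ n (PiTensorProduct.tprod k fun i =>
        O.incl A (r i) (o i ⊗ₜ[k] (PiTensorProduct.tprod k (b i)))) := by
    intro b
    simp only [L, LinearMap.comp_apply]
    refine congrArg (O.extSchur p φ hφ n) ?_
    refine (congrArg _ (A.split_tprod r _)).trans ?_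
    refine (PiTensorProduct.map_tprod _ _).trans ?_
    simp only [flat_apply]
    rfl
  have key : L = O.schurLevel p φ r (PiTensorProduct.tprod k o) := by
    refine tpow_ext fun e b hb => ?_
    have hflat : b = flat (fun i j => b (finSigmaFinEquiv ⟨i, j⟩)) := by
      funext l
      obtain ⟨⟨i, j⟩, rfl⟩ := finSigmaFinEquiv.surjective l
      rw [flat_apply]
    rw [hflat, hL, extSchur, PiTensorProduct.lift.tprod]
    have h1 := MultilinearMap.fromDirectSumEquiv_lof (R := k) (M' := (O.schur B).tpow n)
      (κ := fun _ : Fin n => ℕ) (M := fun _ m => O.piece A m)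
      (fun r : Fin n → ℕ => (O.exists_schurLevel p φ hφ r).choose) r
      (fun i => O.proj A (r i)
        (o i ⊗ₜ[k] (PiTensorProduct.tprod k fun j => b (finSigmaFinEquiv ⟨i, j⟩))))
    refine h1.trans ?_
    exact (O.exists_schurLevel p φ hφ r).choose_spec
      (fun i => (o i, fun j => ⟨b (finSigmaFinEquiv ⟨i, j⟩), _, hb _⟩))
  rw [← hL, key]

theorem extSchur_unique (O : SymSeq.{u, v} k) {A : DGMod.{u, w} k} {B : DGMod.{u, x} k} (p : ℤ)
    (φ : ThickSeq A B) (hφ : φ.IsSymmetric) {n : ℕ}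
    (Φ : (O.schur A).tpow n →ₗ[k] (O.schur B).tpow n)
    (hΦ : ∀ (r : Fin n → ℕ) (o : ∀ i, O.obj (r i)) (a : ∀ i, Fin (r i) → A),
      Φ (PiTensorProduct.tprod k fun i =>
        O.incl A (r i) (o i ⊗ₜ[k] (PiTensorProduct.tprod k (a i)))) =
      O.schurLevel p φ r (PiTensorProduct.tprod k o) (PiTensorProduct.tprod k (flat a))) :
    Φ = O.extSchur p φ hφ n := by
  refine PiTensorProduct.ext_of_span_eq_top
    (γ := fun _ => Σ m, O.obj m × (Fin m → A))
    (g := fun _ z => O.incl A z.1 (z.2.1 ⊗ₜ[k] (PiTensorProduct.tprod k z.2.2))) ?_ ?_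
  · intro _
    rw [← (Submodule.span k _).ker_mkQ, LinearMap.ker_eq_top]
    apply DirectSum.linearMap_ext
    intro m
    apply Representation.Coinvariants.hom_ext
    apply TensorProduct.ext
    apply LinearMap.ext
    intro o
    refine tpow_ext fun e a ha => ?_
    refine (Submodule.Quotient.mk_eq_zero _).2 ?_
    exact Submodule.subset_span ⟨⟨m, o, a⟩, rfl⟩
  · intro z
    rw [hΦ (fun i => (z i).1) (fun i => (z i).2.1) (fun i => (z i).2.2)]
    exact (O.extSchur_apply p φ hφ (fun i => (z i).1) (fun i => (z i).2.1)
      (fun i => (z i).2.2)).symm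

end SymSeq

end ExtSchur

end

noncomputable section

namespace DGMod

open PiTensorProduct (tprod)

variable {k : Type u} [CommRing k]

/-! ### Spanning tensors -/

/-! The idempotent `g ∘ f` splits `A` into its image (weight 0) and its kernel (weight 1). The side
conditions say that `h` kills weight 0 and preserves weight 1, and `∂ h = g f - 1` says that `∂ h =
-m` in weight `m`. On tensors of weight-homogeneous elements weights add up: the total weight `m`
counts the factors in the kernel of `g f`, and `(g f)^{⊗ n}` is the projection onto total weight 0.

The decisive point is that in total weight `m` the symmetrized homotopy `h^Σ_n` is `1 / m` times the
derivation of `A^{⊗ n}` that extends `h` (and is zero for `m = 0`). Indeed, the term of the tensor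
trick with `h` in position `i` survives only if no factor of weight 1 stands after `i`. Averaging
over all orders, each of the `m` positions of weight 1 is the last one with frequency `1 / m`. This
is `DGMod.IsContraction.symTrick_tprod`, and `card_argmax_mul` is the count.

The weights pass to `O[A]`, where `[o ⊗ a_1 ⊗ ⋯ ⊗ a_r]` has the total weight of the `a_j`. The map
`D [o ⊗ y] = ±[o ⊗ der h y]` has square zero, preserves weights, vanishes in weight 0 and satisfies
`∂ D = -m` in weight `m` (`isWeightedHomotopy_schurDer`). A comparison of Koszul signs shows that
`O_n[h^Σ]` acts on `O[A]^{⊗ n}` in total weight `m` as `1 / m` times the derivation extending `D`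
(`isAveraged_extSchur_symTrick`).

The rest is formal in the pair of weights and `D`. The anticommutator of the derivations extending
`d` and `D` is `-m` on total weight `m`, so division by `m` gives `∂ H = G F - 1`
(`IsWeightedHomotopy.isContraction`). Equivariance holds because derivations and weights are
compatible with permutations. The pseudo-derivation identities reduce, by `D² = 0` and the Leibniz
rule, to `(1 / (l + m)) (1 / l + 1 / m) = (1 / l) (1 / m)`
(`IsWeightedHomotopy.isPseudoDerivation`). That `F` and `G` are morphisms is `extSchur_pow`. -/

theorem eq_of_eqOn_span_tprod {n : ℕ} {M : Type v} [AddCommGroup M] [Module k M] {N : Type w}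
    [AddCommGroup N] [Module k N] {f g : (⨂[k]^n M) →ₗ[k] N} (S : Fin n → Set M)
    (h : ∀ a : Fin n → M, (∀ i, a i ∈ S i) → f (tprod k a) = g (tprod k a))
    {a : Fin n → M} (ha : ∀ i, a i ∈ Submodule.span k (S i)) : f (tprod k a) = g (tprod k a) := by
  -- The spans need not be all of `M`, and `ι` need not be injective. It suffices that the tensors
  -- in question are in the image of `ι`, on whose source `S i` does span the `i`-th factor.
  let ι : (⨂[k] i, Submodule.span k (S i)) →ₗ[k] ⨂[k]^n M :=
    PiTensorProduct.map fun i => (Submodule.span k (S i)).subtype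
  have key : f ∘ₗ ι = g ∘ₗ ι := by
    refine PiTensorProduct.ext_of_span_eq_top (γ := fun i => S i)
      (g := fun i y => ⟨y, Submodule.subset_span y.2⟩) (fun i => ?_) fun y => ?_
    · rw [← Submodule.span_span_coe_preimage (R := k) (s := S i)]
      congr 1
      ext y
      exact ⟨fun ⟨z, hz⟩ => hz ▸ z.2, fun hy => ⟨⟨y, hy⟩, rfl⟩⟩
    · simp only [LinearMap.comp_apply, ι, PiTensorProduct.map_tprod]
      exact h _ fun i => (y i).2
  have := LinearMap.congr_fun key (tprod k fun i => ⟨a i, ha i⟩)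
  simp only [LinearMap.comp_apply, ι, PiTensorProduct.map_tprod] at this
  exact this

theorem tprod_ext_of_span {n : ℕ} {M : Type v} [AddCommGroup M] [Module k M] {N : Type w}
    [AddCommGroup N] [Module k N] {f g : (⨂[k]^n M) →ₗ[k] N} (S : Set M)
    (hS : Submodule.span k S = ⊤)
    (h : ∀ a : Fin n → M, (∀ i, a i ∈ S) → f (tprod k a) = g (tprod k a)) : f = g :=
  PiTensorProduct.ext_of_span_eq_top (γ := fun _ => S) (g := fun _ y => (y : M))
    (fun _ => by rwa [Subtype.range_coe]) fun y => h _ fun i => (y i).2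

/-- A spanning family of homogeneous submodules consists of the homogeneous components. -/
theorem le_of_iSup_eq_top (A : DGMod.{u, v} k) {V : ℤ → Submodule k A} (hV : ∀ i, V i ≤ A.gr i)
    (htop : ⨆ i, V i = ⊤) (i : ℤ) : A.gr i ≤ V i := by
  intro x hx
  -- As the `V j` span, `y` is a sum of elements of the `V j`, and each of these is its own
  -- component of degree `j`.
  have key : ∀ y : A, A.coact y i ∈ V i := by
    intro y
    refine Submodule.iSup_induction V (motive := fun y => A.coact y i ∈ V i)
      (htop ▸ Submodule.mem_top : y ∈ ⨆ i, V i) ?_ (by simp) ?_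
    · intro j y hy
      rw [A.coact_of_mem (hV j hy), Finsupp.single_apply]
      split_ifs with h
      · exact h ▸ hy
      · exact zero_mem _
    · intro y z hy hz
      simpa using add_mem hy hz
  have := key x
  rwa [A.coact_of_mem hx, Finsupp.single_eq_same] at this

theorem hasDegree_of_iSup_eq_top {A : DGMod.{u, v} k} {B : DGMod.{u, w} k} {V : ℤ → Submodule k A}
    (hV : ∀ i, V i ≤ A.gr i) (htop : ⨆ i, V i = ⊤) {p : ℤ} {f : A →ₗ[k] B}
    (hf : ∀ i, ∀ x ∈ V i, f x ∈ B.gr (i + p)) : HasDegree p f :=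
  fun i x hx => hf i x (le_of_iSup_eq_top A hV htop i hx)

/-! ### Derivations of tensor powers -/

theorem sgn_sgn (A : DGMod.{u, v} k) (p : ZMod 2) (x : A) : A.sgn p (A.sgn p x) = x := by
  induction x using A.induction_hom with
  | h i y hy => rw [A.sgn_of_mem _ hy, map_smul, A.sgn_of_mem _ hy, smul_smul, ksgn_mul_self, one_smul]
  | h0 => simp
  | hadd y z hy hz => simp [hy, hz]

theorem sgn_one_comm {A : DGMod.{u, v} k} {B : DGMod.{u, w} k} {p : ℤ} (hp : (p : ZMod 2) = 1)
    {f : A →ₗ[k] B} (hf : HasDegree p f) (x : A) : B.sgn 1 (f x) = -f (A.sgn 1 x) := by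
  rw [sgn_comm hf, hp, one_mul, ksgn_one, neg_one_smul]

/-- The Koszul rule for two odd maps. For `i < j` the two composites agree in every position except
`i`, where one is `φ` after the sign operator and the other the sign operator after `φ`; these
differ by `-1` because `φ` is odd. -/
theorem insertAt_comm (A : DGMod.{u, v} k) {n : ℕ} {p q : ℤ} (hp : (p : ZMod 2) = 1)
    (hq : (q : ZMod 2) = 1) {φ ψ : A →ₗ[k] A} (hφ : HasDegree p φ) (hψ : HasDegree q ψ)
    {i j : Fin n} (hij : i ≠ j) (x : ⨂[k]^n A) :
    A.insertAt 1 φ LinearMap.id i (A.insertAt 1 ψ LinearMap.id j x) =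
      -A.insertAt 1 ψ LinearMap.id j (A.insertAt 1 φ LinearMap.id i x) := by
  wlog h : i < j generalizing i j p q φ ψ
  · rw [this hq hp hψ hφ hij.symm (lt_of_le_of_ne (not_lt.1 h) hij.symm), neg_neg]
  have : A.insertAt 1 φ LinearMap.id i ∘ₗ A.insertAt 1 ψ LinearMap.id j =
      -(A.insertAt 1 ψ LinearMap.id j ∘ₗ A.insertAt 1 φ LinearMap.id i) := by
    apply PiTensorProduct.ext
    ext a
    simp only [LinearMap.compMultilinearMap_apply, LinearMap.neg_apply, LinearMap.comp_apply,
      insertAt, PiTensorProduct.map_tprod]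
    set G : Fin n → A := fun l => (if l < j then A.sgn 1 else if l = j then ψ else LinearMap.id)
      ((if l < i then A.sgn 1 else if l = i then φ else LinearMap.id) (a l)) with hG
    have hF : (fun l => (if l < i then A.sgn 1 else if l = i then φ else LinearMap.id)
        ((if l < j then A.sgn 1 else if l = j then ψ else LinearMap.id) (a l))) =
        Function.update G i ((-1 : k) • G i) := by
      funext l
      rcases lt_trichotomy l i with hl | rfl | hl
      · simp [hG, hl, hl.trans h, Function.update_of_ne hl.ne]
      · simp [hG, h, sgn_one_comm hp hφ]
      · rw [Function.update_of_ne hl.ne']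
        simp [hG, hl.ne', not_lt_of_gt hl]
    rw [hF, MultilinearMap.map_update_smul, Function.update_eq_self, neg_one_smul]
  exact LinearMap.congr_fun this x

/-- The positions before `i` receive the sign operator twice, so no sign is left. -/
theorem insertAt_insertAt_self (A : DGMod.{u, v} k) {n : ℕ} (φ ψ : A →ₗ[k] A) (i : Fin n)
    (a : Fin n → A) :
    A.insertAt 1 φ LinearMap.id i (A.insertAt 1 ψ LinearMap.id i (tprod k a)) =
      tprod k (Function.update a i (φ (ψ (a i)))) := by
  simp only [insertAt, PiTensorProduct.map_tprod]
  congr 1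
  funext l
  rcases lt_trichotomy l i with hl | rfl | hl
  · simp [hl, hl.ne, sgn_sgn]
  · simp
  · simp [hl.ne', not_lt_of_gt hl]

/-- The derivation `∑_{i+1+j=n} 1^{⊗ i} ⊗ φ ⊗ 1^{⊗ j}` of `A^{⊗ n}` for a map `φ` of odd degree. -/
def der (A : DGMod.{u, v} k) (φ : A →ₗ[k] A) (n : ℕ) : (⨂[k]^n A) →ₗ[k] ⨂[k]^n A :=
  ∑ i, A.insertAt 1 φ LinearMap.id i

theorem der_apply (A : DGMod.{u, v} k) (φ : A →ₗ[k] A) {n : ℕ} (x : ⨂[k]^n A) :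
    A.der φ n x = ∑ i, A.insertAt 1 φ LinearMap.id i x := by
  simp [der]

theorem der_tprod (A : DGMod.{u, v} k) (φ : A →ₗ[k] A) {n : ℕ} {e : Fin n → ℤ} {a : Fin n → A}
    (ha : ∀ i, a i ∈ A.gr (e i)) :
    A.der φ n (tprod k a) = ∑ i, ksgn k (∑ j, if j < i then (e j : ZMod 2) else 0) •
      tprod k (Function.update a i (φ (a i))) := by
  rw [der_apply]
  exact Finset.sum_congr rfl fun i _ => by rw [insertAt_id_tprod A _ _ i ha, one_mul]

theorem der_tprod_of_eq_zero (A : DGMod.{u, v} k) (φ : A →ₗ[k] A) {n : ℕ} {a : Fin n → A}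
    (ha : ∀ i, φ (a i) = 0) : A.der φ n (tprod k a) = 0 := by
  rw [der_apply]
  refine Finset.sum_eq_zero fun i _ => ?_
  rw [insertAt, PiTensorProduct.map_tprod]
  exact MultilinearMap.map_coord_zero _ i (by simp [ha])

/-- The graded commutator of two odd derivations is the derivation of the graded commutator: terms
in different positions cancel by `insertAt_comm`, and position `i` contributes `φ ψ + ψ φ`, here the
scalar `c i`. It serves for `φ = d` and `ψ` a homotopy. -/
theorem der_der_add (A : DGMod.{u, v} k) {n : ℕ} {p q : ℤ} (hp : (p : ZMod 2) = 1)
    (hq : (q : ZMod 2) = 1) {φ ψ : A →ₗ[k] A} (hφ : HasDegree p φ) (hψ : HasDegree q ψ)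
    {a : Fin n → A} {c : Fin n → k} (hc : ∀ i, φ (ψ (a i)) + ψ (φ (a i)) = c i • a i) :
    A.der φ n (A.der ψ n (tprod k a)) + A.der ψ n (A.der φ n (tprod k a)) =
      (∑ i, c i) • tprod k a := by
  simp only [der_apply, map_sum]
  rw [Finset.sum_comm (γ := Fin n) (f := fun i j => A.insertAt 1 ψ LinearMap.id j _),
    ← Finset.sum_add_distrib, Finset.sum_smul]
  refine Finset.sum_congr rfl fun i _ => ?_
  rw [← Finset.sum_add_distrib, Finset.sum_eq_single i]
  · rw [insertAt_insertAt_self, insertAt_insertAt_self, ← MultilinearMap.map_update_add, hc,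
      MultilinearMap.map_update_smul, Function.update_eq_self]
  · intro j _ hj
    rw [A.insertAt_comm hp hq hφ hψ hj, neg_add_cancel]
  · simp

/-- The previous lemma with `φ = ψ` only bounds twice the square. Here the terms `(i, j)` and `(j,
i)` cancel in pairs and the diagonal ones vanish by `φ φ = 0`, over any ring. -/
theorem der_der (A : DGMod.{u, v} k) {n : ℕ} {p : ℤ} (hp : (p : ZMod 2) = 1)
    {φ : A →ₗ[k] A} (hφ : HasDegree p φ) (h0 : ∀ x, φ (φ x) = 0) (x : ⨂[k]^n A) :
    A.der φ n (A.der φ n x) = 0 := by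
  have : A.der φ n ∘ₗ A.der φ n = 0 := by
    apply PiTensorProduct.ext
    ext a
    simp only [LinearMap.compMultilinearMap_apply, LinearMap.comp_apply, LinearMap.zero_apply,
      der_apply, map_sum, ← Fintype.sum_prod_type']
    refine Finset.sum_involution (fun p _ => p.swap) ?_ ?_ (by simp) (by simp)
    · rintro ⟨i, j⟩ _
      by_cases hij : i = j
      · subst hij
        simp only [Prod.swap_prod_mk, insertAt_insertAt_self, h0]
        rw [MultilinearMap.map_coord_zero _ i (by simp), add_zero]
      · simp only [Prod.swap_prod_mk]
        rw [A.insertAt_comm hp hp hφ hφ hij]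
        exact add_neg_cancel (G := ⨂[k]^n A) _
    · rintro ⟨i, j⟩ _ hne heq
      simp only [Prod.swap_prod_mk, Prod.mk.injEq] at heq
      obtain ⟨rfl, -⟩ := heq
      apply hne
      simp only [insertAt_insertAt_self, h0]
      exact MultilinearMap.map_coord_zero _ j (by simp)
  exact LinearMap.congr_fun this x

/-- Changing the parity of the `i`-th factor changes the Koszul sign of `σ` by exactly the
difference between passing the factors before `i` and passing those before `σ i` in the permuted
tensor (`koszulExp_update`). -/
theorem perm_insertAt (A : DGMod.{u, v} k) {n : ℕ} {p : ℤ} (hp : (p : ZMod 2) = 1)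
    {φ : A →ₗ[k] A} (hφ : HasDegree p φ) (σ : Equiv.Perm (Fin n)) (i : Fin n) (x : A.tpow n) :
    A.perm σ (A.insertAt 1 φ LinearMap.id i x) =
      A.insertAt 1 φ LinearMap.id (σ i) (A.perm σ x) := by
  have : A.perm σ ∘ₗ A.insertAt 1 φ LinearMap.id i =
      A.insertAt 1 φ LinearMap.id (σ i) ∘ₗ A.perm σ := by
    refine tpow_ext fun e a ha => ?_
    rw [LinearMap.comp_apply, LinearMap.comp_apply, perm_tprod A σ ha, map_smul,
      insertAt_id_tprod A _ _ i ha,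
      insertAt_id_tprod A _ _ (σ i) (fun j => ha (σ.symm j)), map_smul,
      perm_tprod A σ (update_mem ha i (hφ _ _ (ha i))), smul_smul, smul_smul,
      ← ksgn_add, ← ksgn_add, one_mul, one_mul, ← koszulExp_update σ _ i, add_comm]
    congr 3
    · congr 1
      funext j
      by_cases h : j = i
      · subst h
        simp [hp]
      · simp [h, Function.update_of_ne]
    · funext j
      by_cases h : j = σ i
      · subst h; simp
      · have : σ.symm j ≠ i := fun hh => h (by rw [← hh]; simp)
        simp [h, Function.update_of_ne, this]
  exact LinearMap.congr_fun this x

theorem perm_der (A : DGMod.{u, v} k) {n : ℕ} {p : ℤ} (hp : (p : ZMod 2) = 1)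
    {φ : A →ₗ[k] A} (hφ : HasDegree p φ) (σ : Equiv.Perm (Fin n)) (x : A.tpow n) :
    A.perm σ (A.der φ n x) = A.der φ n (A.perm σ x) := by
  rw [der_apply, der_apply, map_sum, ← Equiv.sum_comp σ fun i => A.insertAt 1 φ _ i _]
  exact Finset.sum_congr rfl fun i _ => A.perm_insertAt hp hφ σ i x

end DGMod

namespace DGMod

open PiTensorProduct (tprod)

variable {k : Type u} [CommRing k]

/-! ### Concatenation of tensors -/

/-- The product `x ⊗ y ∈ A^{⊗ (p + q)}` of `x ∈ A^{⊗ p}` and `y ∈ A^{⊗ q}`. -/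
def tmul (A : DGMod.{u, v} k) {p q : ℕ} : A.tpow p →ₗ[k] A.tpow q →ₗ[k] A.tpow (p + q) :=
  (TensorProduct.mk k (A.tpow p) (A.tpow q)).compr₂
    (TensorPower.mulEquiv (R := k) (M := A) (n := p) (m := q)).toLinearMap

theorem tmul_tprod (A : DGMod.{u, v} k) {p q : ℕ} (a : Fin p → A) (b : Fin q → A) :
    A.tmul (tprod k a) (tprod k b) = tprod k (Fin.append a b) :=
  TensorPower.tprod_mul_tprod k a b

theorem tmul_ext {A : DGMod.{u, v} k} {p q : ℕ} {N : Type*} [AddCommGroup N] [Module k N]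
    {f g : A.tpow (p + q) →ₗ[k] N} (h : ∀ x y, f (A.tmul x y) = g (A.tmul x y)) : f = g := by
  have key : f ∘ₗ (TensorPower.mulEquiv (R := k) (M := A) (n := p) (m := q)).toLinearMap =
      g ∘ₗ (TensorPower.mulEquiv (R := k) (M := A) (n := p) (m := q)).toLinearMap :=
    TensorProduct.ext' h
  refine LinearMap.ext fun z => ?_
  have := LinearMap.congr_fun key
    ((TensorPower.mulEquiv (R := k) (M := A) (n := p) (m := q)).symm z)
  simpa using this

theorem tens_tmul {A : DGMod.{u, v} k} {B : DGMod.{u, w} k} {p q : ℕ} (δ : ℤ)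
    (α : A.tpow p →ₗ[k] B.tpow p) (β : A.tpow q →ₗ[k] B.tpow q) {i : ℤ} {x : A.tpow p}
    (hx : x ∈ (A.tpow p).gr i) (y : A.tpow q) :
    ThickSeq.tens δ α β (A.tmul x y) =
      ksgn k ((δ : ZMod 2) * (i : ZMod 2)) • B.tmul (α x) (β y) := by
  have h : (TensorPower.mulEquiv (R := k) (M := A) (n := p) (m := q)).symm (A.tmul x y) =
      x ⊗ₜ[k] y := LinearEquiv.symm_apply_apply _ _
  rw [ThickSeq.tens, LinearMap.comp_apply, LinearMap.comp_apply]
  refine (congrArg _ (congrArg _ h)).trans ?_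
  rw [TensorProduct.map_tmul, LinearMap.comp_apply, sgn_of_mem _ _ hx, map_smul,
    ← TensorProduct.smul_tmul', map_smul]
  rfl

theorem append_update_left {p q : ℕ} {X : Type*} (a : Fin p → X) (b : Fin q → X) (i : Fin p)
    (x : X) : Fin.append (Function.update a i x) b =
      Function.update (Fin.append a b) (Fin.castAdd q i) x := by
  funext l
  refine Fin.addCases (fun l => ?_) (fun l => ?_) l
  · by_cases h : l = i
    · subst h; simp
    · have : Fin.castAdd q l ≠ Fin.castAdd q i := fun hh => h (Fin.castAdd_injective p q hh)
      rw [Fin.append_left, Function.update_of_ne h, Function.update_of_ne this, Fin.append_left]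
  · have : Fin.natAdd p l ≠ Fin.castAdd q i := fun hh => by
      have := congrArg Fin.val hh; simp at this; omega
    rw [Fin.append_right, Function.update_of_ne this, Fin.append_right]

theorem append_update_right {p q : ℕ} {X : Type*} (a : Fin p → X) (b : Fin q → X) (i : Fin q)
    (x : X) : Fin.append a (Function.update b i x) =
      Function.update (Fin.append a b) (Fin.natAdd p i) x := by
  funext l
  refine Fin.addCases (fun l => ?_) (fun l => ?_) l
  · have : Fin.castAdd q l ≠ Fin.natAdd p i := fun hh => by
      have := congrArg Fin.val hh; simp at this; omega
    rw [Fin.append_left, Function.update_of_ne this, Fin.append_left]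
  · by_cases h : l = i
    · subst h; simp
    · have : Fin.natAdd p l ≠ Fin.natAdd p i := fun hh => h (Fin.natAdd_injective q p hh)
      rw [Fin.append_right, Function.update_of_ne h, Function.update_of_ne this, Fin.append_right]

/-- The Leibniz rule. Positions in the first block see only the factors of `x` before them;
positions in the second block pass all of `x`, whence the sign `(-1)^|x|`. -/
theorem der_tmul (A : DGMod.{u, v} k) {p q : ℕ} (φ : A →ₗ[k] A) {i : ℤ} {x : A.tpow p}
    (hx : x ∈ (A.tpow p).gr i) (y : A.tpow q) :
    A.der φ (p + q) (A.tmul x y) =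
      A.tmul (A.der φ p x) y + ksgn k (i : ZMod 2) • A.tmul x (A.der φ q y) := by
  -- With the sign written as the operator `sgn 1`, both sides are bilinear in `x` and `y`, so pure
  -- tensors of homogeneous elements suffice.
  have key : (A.tmul (p := p) (q := q)).compr₂ (A.der φ (p + q)) =
      (A.tmul (p := p) (q := q)) ∘ₗ A.der φ p +
        ((A.tmul (p := p) (q := q)) ∘ₗ (A.tpow p).sgn 1).compl₂ (A.der φ q) := by
    refine tpow_ext fun e a ha => ?_
    refine tpow_ext fun d b hb => ?_
    have hab : ∀ l, Fin.append a b l ∈ A.gr (Fin.append e d l) := by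
      intro l
      refine Fin.addCases (fun l => ?_) (fun l => ?_) l
      · simpa using ha l
      · simpa using hb l
    have hs := (A.tpow p).sgn_of_mem 1 (A.tprod_mem_tpowGr ha rfl)
    simp only [LinearMap.compr₂_apply, LinearMap.add_apply, LinearMap.comp_apply,
      LinearMap.compl₂_apply]
    rw [hs, tmul_tprod, der_tprod A φ hab, der_tprod A φ ha, der_tprod A φ hb, map_sum, map_sum,
      LinearMap.sum_apply, Fin.sum_univ_add]
    congr 1
    · refine Finset.sum_congr rfl fun l _ => ?_
      rw [map_smul, LinearMap.smul_apply, tmul_tprod, Fin.sum_univ_add]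
      congr 2
      · have h0 : ∀ j : Fin q, ¬ (Fin.natAdd p j < Fin.castAdd q l) := fun j => by
          rw [Fin.lt_def]; simp; omega
        have h1 : ∀ j : Fin p, Fin.castAdd q j < Fin.castAdd q l ↔ j < l := fun _ => Iff.rfl
        simp [h0, h1]
      · rw [append_update_left, Fin.append_left]
    · refine Finset.sum_congr rfl fun l _ => ?_
      rw [map_smul, map_smul, LinearMap.smul_apply, tmul_tprod, smul_smul, ← ksgn_add,
        Fin.sum_univ_add]
      congr 2
      · have h0 : ∀ j : Fin p, Fin.castAdd q j < Fin.natAdd p l := fun j => by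
          rw [Fin.lt_def]; simp; omega
        simp [h0, add_comm (∑ x, (e x : ZMod 2))]
      · rw [append_update_right, Fin.append_right]
  have := LinearMap.congr_fun (LinearMap.congr_fun key x) y
  simp only [LinearMap.compr₂_apply, LinearMap.add_apply, LinearMap.comp_apply,
      LinearMap.compl₂_apply] at this
  rw [this, sgn_of_mem _ _ hx, one_mul, map_smul, LinearMap.smul_apply]

/-! ### Weights on tensor powers -/

/-- Elements of degree `i` and weight `m` in `A^{⊗ n}`, where `W i m` are those of `A`. -/
def tpowWt {A : DGMod.{u, v} k} (W : ℤ → ℕ → Submodule k A) (n : ℕ) (i : ℤ) (m : ℕ) :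
    Submodule k (⨂[k]^n A) :=
  Submodule.span k {z | ∃ (e : Fin n → ℤ) (μ : Fin n → ℕ), ∑ j, e j = i ∧ ∑ j, μ j = m ∧
    ∃ a : Fin n → A, (∀ j, a j ∈ W (e j) (μ j)) ∧ z = tprod k a}

section Weights

variable {A : DGMod.{u, v} k} {W : ℤ → ℕ → Submodule k A}

theorem tprod_mem_tpowWt {n : ℕ} {e : Fin n → ℤ} {μ : Fin n → ℕ} {a : Fin n → A}
    (ha : ∀ j, a j ∈ W (e j) (μ j)) : tprod k a ∈ tpowWt W n (∑ j, e j) (∑ j, μ j) :=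
  Submodule.subset_span ⟨e, μ, rfl, rfl, a, ha, rfl⟩

theorem tpowWt_le (hW : ∀ i m, W i m ≤ A.gr i) (n : ℕ) (i : ℤ) (m : ℕ) :
    tpowWt W n i m ≤ (A.tpow n).gr i := by
  refine Submodule.span_le.2 ?_
  rintro _ ⟨e, μ, he, -, a, ha, rfl⟩
  exact A.tprod_mem_tpowGr (fun j => hW _ _ (ha j)) he

theorem tpowWt_ext (hspan : Submodule.span k {x | ∃ i m, x ∈ W i m} = ⊤) {n : ℕ} {N : Type*}
    [AddCommGroup N] [Module k N] {f g : A.tpow n →ₗ[k] N}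
    (h : ∀ i m, ∀ y ∈ tpowWt W n i m, f y = g y) : f = g := by
  refine tprod_ext_of_span _ hspan fun a ha => ?_
  choose e μ ha using ha
  exact h _ _ _ (tprod_mem_tpowWt ha)

theorem iSup_tpowWt (hspan : Submodule.span k {x | ∃ i m, x ∈ W i m} = ⊤) (n : ℕ) :
    ⨆ i, ⨆ m, tpowWt W n i m = ⊤ := by
  rw [← (⨆ i, ⨆ m, tpowWt W n i m).ker_mkQ, LinearMap.ker_eq_top]
  refine tpowWt_ext hspan fun i m y hy => (Submodule.Quotient.mk_eq_zero _).2 ?_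
  exact Submodule.mem_iSup_of_mem i (Submodule.mem_iSup_of_mem m hy)

theorem tmul_mem_tpowWt {p q : ℕ} {i j : ℤ} {l m : ℕ} {x : A.tpow p} {y : A.tpow q}
    (hx : x ∈ tpowWt W p i l) (hy : y ∈ tpowWt W q j m) :
    A.tmul x y ∈ tpowWt W (p + q) (i + j) (l + m) := by
  induction hx using Submodule.span_induction with
  | mem x hx =>
    obtain ⟨e, μ, rfl, rfl, a, ha, rfl⟩ := hx
    induction hy using Submodule.span_induction with
    | mem y hy =>
      obtain ⟨d, ν, rfl, rfl, b, hb, rfl⟩ := hy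
      rw [tmul_tprod]
      refine Submodule.subset_span ⟨Fin.append e d, Fin.append μ ν, ?_, ?_, _, fun l => ?_, rfl⟩
      · simp [Fin.sum_univ_add]
      · simp [Fin.sum_univ_add]
      · refine Fin.addCases (fun l => ?_) (fun l => ?_) l
        · simpa using ha l
        · simpa using hb l
    | zero => rw [map_zero]; exact zero_mem _
    | add a b _ _ ha hb => rw [map_add]; exact add_mem ha hb
    | smul c a _ ha => rw [map_smul]; exact Submodule.smul_mem _ _ ha
  | zero => rw [map_zero]; exact zero_mem _
  | add a b _ _ ha hb => rw [map_add]; exact add_mem ha hb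
  | smul c a _ ha => rw [map_smul]; exact Submodule.smul_mem _ _ ha

theorem perm_mem_tpowWt (hW : ∀ i m, W i m ≤ A.gr i) {n : ℕ} (σ : Equiv.Perm (Fin n)) {i : ℤ}
    {m : ℕ} {y : A.tpow n} (hy : y ∈ tpowWt W n i m) : A.perm σ y ∈ tpowWt W n i m := by
  induction hy using Submodule.span_induction with
  | mem x hx =>
    obtain ⟨e, μ, rfl, rfl, a, ha, rfl⟩ := hx
    rw [perm_tprod A σ (fun j => hW _ _ (ha j))]
    refine Submodule.smul_mem _ _ (Submodule.subset_span
      ⟨e ∘ σ.symm, μ ∘ σ.symm, ?_, ?_, _, fun j => ha (σ.symm j), rfl⟩)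
    · exact Equiv.sum_comp σ.symm e
    · exact Equiv.sum_comp σ.symm μ
  | zero => rw [map_zero]; exact zero_mem _
  | add a b _ _ ha hb => rw [map_add]; exact add_mem ha hb
  | smul c a _ ha => rw [map_smul]; exact Submodule.smul_mem _ _ ha

theorem der_mem_tpowWt (hW : ∀ i m, W i m ≤ A.gr i) {p : ℤ} {φ : A →ₗ[k] A}
    (hφ : ∀ i m, ∀ x ∈ W i m, φ x ∈ W (i + p) m) {n : ℕ} {i : ℤ} {m : ℕ} {y : A.tpow n}
    (hy : y ∈ tpowWt W n i m) : A.der φ n y ∈ tpowWt W n (i + p) m := by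
  induction hy using Submodule.span_induction with
  | mem x hx =>
    obtain ⟨e, μ, rfl, rfl, a, ha, rfl⟩ := hx
    rw [der_tprod A φ (fun j => hW _ _ (ha j))]
    refine Submodule.sum_mem _ fun j _ => Submodule.smul_mem _ _ (Submodule.subset_span
      ⟨Function.update e j (e j + p), μ, ?_, rfl, _, fun l => ?_, rfl⟩)
    · rw [Finset.sum_update_of_mem (Finset.mem_univ j), ← Finset.add_sum_erase _ e (Finset.mem_univ j),
        Finset.sdiff_singleton_eq_erase]
      ring
    · by_cases h : l = j
      · subst h; simpa using hφ _ _ _ (ha l)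
      · simpa [Function.update_of_ne h] using ha l
  | zero => rw [map_zero]; exact zero_mem _
  | add a b _ _ ha hb => rw [map_add]; exact add_mem ha hb
  | smul c a _ ha => rw [map_smul]; exact Submodule.smul_mem _ _ ha

theorem der_eq_zero_of_mem_tpowWt {φ : A →ₗ[k] A} (h0 : ∀ i, ∀ x ∈ W i 0, φ x = 0) {n : ℕ}
    {i : ℤ} {y : A.tpow n} (hy : y ∈ tpowWt W n i 0) : A.der φ n y = 0 := by
  induction hy using Submodule.span_induction with
  | mem x hx =>
    obtain ⟨e, μ, rfl, hμ, a, ha, rfl⟩ := hx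
    refine der_tprod_of_eq_zero A φ fun j => h0 (e j) _ ?_
    -- Weights are natural numbers, so total weight 0 forces weight 0 in every factor.
    have := Finset.sum_eq_zero_iff.1 hμ j (Finset.mem_univ j)
    exact this ▸ ha j
  | zero => rw [map_zero]
  | add a b _ _ ha hb => rw [map_add, ha, hb, add_zero]
  | smul c a _ ha => rw [map_smul, ha, smul_zero]

end Weights

end DGMod

/-! ### Reciprocals of weights -/

open DGMod

/-- The scalar `1 / m`, which is `0` for `m = 0`. -/
def invNat (k : Type u) [CommRing k] [Algebra ℚ k] (m : ℕ) : k := algebraMap ℚ k (1 / (m : ℚ))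

theorem invNat_zero (k : Type u) [CommRing k] [Algebra ℚ k] : invNat k 0 = 0 := by simp [invNat]

theorem invNat_mul_self (k : Type u) [CommRing k] [Algebra ℚ k] {m : ℕ} (hm : m ≠ 0) :
    invNat k m * m = 1 := by
  have : (m : k) = algebraMap ℚ k m := by simp
  rw [invNat, this, ← map_mul, one_div, inv_mul_cancel₀ (by exact_mod_cast hm), map_one]

/-- The arithmetic behind the pseudo-derivation property. Both weights must be nonzero: with `1 / 0
= 0` the case `l = 0` would read `1 / m² = 0`. -/
theorem invNat_add (k : Type u) [CommRing k] [Algebra ℚ k] {l m : ℕ} (hl : l ≠ 0) (hm : m ≠ 0) :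
    invNat k (l + m) * (invNat k l + invNat k m) = invNat k l * invNat k m := by
  simp only [invNat, ← map_add, ← map_mul]
  congr 1
  have h1 : (l : ℚ) ≠ 0 := by exact_mod_cast hl
  have h2 : (m : ℚ) ≠ 0 := by exact_mod_cast hm
  have h3 : (l : ℚ) + m ≠ 0 := by positivity
  push_cast
  field_simp
  ring

/-! ### Weighted homotopies and their averaged extensions to tensor powers -/

section Weighted

variable {k : Type u} [CommRing k]

/-- A bigrading by degree and weight of a chain complex, with a square-zero map `D` of degree `1`
that preserves weights, vanishes in weight `0`, and satisfies `∂ D = -m` in weight `m`. -/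
structure IsWeightedHomotopy {A : DGMod.{u, v} k} (W : ℤ → ℕ → Submodule k A) (D : A →ₗ[k] A) :
    Prop where
  le : ∀ i m, W i m ≤ A.gr i
  span : Submodule.span k {x | ∃ i m, x ∈ W i m} = ⊤
  map_mem : ∀ i m, ∀ x ∈ W i m, D x ∈ W (i + 1) m
  d_mem : ∀ i m, ∀ x ∈ W i m, A.d x ∈ W (i - 1) m
  sq_zero : ∀ x, D (D x) = 0
  map_zero : ∀ i, ∀ x ∈ W i 0, D x = 0
  bdry : ∀ i m, ∀ x ∈ W i m, A.d (D x) + D (A.d x) = -(m : k) • x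

/-- The sequence `H` acts on tensors of total weight `m` as `1 / m` times the derivation
extending `D`. -/
def IsAveraged [Algebra ℚ k] {A : DGMod.{u, v} k} (W : ℤ → ℕ → Submodule k A) (D : A →ₗ[k] A)
    (H : ThickSeq A A) : Prop :=
  ∀ n i m, ∀ y ∈ tpowWt W n i m, H n y = invNat k m • A.der D n y

theorem hasDegree_of_span {A : DGMod.{u, v} k} {B : DGMod.{u, w} k} {W : ℤ → ℕ → Submodule k A}
    (hW : ∀ i m, W i m ≤ A.gr i) (htop : ⨆ i, ⨆ m, W i m = ⊤) {p : ℤ} {f : A →ₗ[k] B}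
    (hf : ∀ i m, ∀ x ∈ W i m, f x ∈ B.gr (i + p)) : HasDegree p f := by
  refine hasDegree_of_iSup_eq_top (fun i => iSup_le (hW i)) htop fun i x hx => ?_
  have : (⨆ m, W i m) ≤ (B.gr (i + p)).comap f := iSup_le fun m x hx => hf i m x hx
  exact this hx

namespace IsWeightedHomotopy

variable {A : DGMod.{u, v} k} {W : ℤ → ℕ → Submodule k A} {D : A →ₗ[k] A}

theorem hasDegree (hD : IsWeightedHomotopy W D) : HasDegree 1 D := by
  refine hasDegree_of_span hD.le ?_ fun i m x hx => hD.le _ _ (hD.map_mem i m x hx)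
  rw [eq_top_iff, ← hD.span, Submodule.span_le]
  rintro x ⟨i, m, hx⟩
  exact Submodule.mem_iSup_of_mem i (Submodule.mem_iSup_of_mem m hx)

/-- The `j`-th factor contributes `-μ j` by `der_der_add`, and the weights of the factors add up to
`m`. The map `A.der A.d n` is the differential of `A^{⊗ n}`. -/
theorem der_bdry (hD : IsWeightedHomotopy W D) {n : ℕ} {i : ℤ} {m : ℕ} {y : A.tpow n}
    (hy : y ∈ tpowWt W n i m) :
    A.der A.d n (A.der D n y) + A.der D n (A.der A.d n y) = -(m : k) • y := by
  induction hy using Submodule.span_induction with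
  | mem y hy =>
    obtain ⟨e, μ, rfl, rfl, a, ha, rfl⟩ := hy
    rw [A.der_der_add (p := -1) (q := 1) (by decide) (by decide) A.hasDegree_d hD.hasDegree
      (c := fun j => -(μ j : k)) fun j => hD.bdry _ _ _ (ha j)]
    simp
  | zero => simp
  | add a b _ _ ha hb =>
    rw [smul_add, ← ha, ← hb]
    simp only [map_add]
    abel
  | smul c a _ ha =>
    rw [smul_comm, ← ha]
    simp only [map_smul, smul_add]

variable [Algebra ℚ k] {H : ThickSeq A A}

theorem isThick (hD : IsWeightedHomotopy W D) (hH : IsAveraged W D H) : ThickSeq.IsThick 1 H := by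
  intro n
  refine hasDegree_of_span (tpowWt_le hD.le n) (iSup_tpowWt hD.span n) fun i m y hy => ?_
  rw [hH n i m y hy]
  exact Submodule.smul_mem _ _ (tpowWt_le hD.le n _ m (der_mem_tpowWt hD.le hD.map_mem hy))

/-- Permutations preserve the total weight, hence the factor `1 / m`, and commute with derivations.
-/
theorem isSymmetric (hD : IsWeightedHomotopy W D) (hH : IsAveraged W D H) : H.IsSymmetric := by
  intro n σ
  refine tpowWt_ext hD.span fun i m y hy => ?_
  rw [LinearMap.comp_apply, LinearMap.comp_apply, hH n i m y hy,
    hH n i m _ (perm_mem_tpowWt hD.le σ hy), map_smul,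
    A.perm_der (p := 1) (by decide) hD.hasDegree]

/-- Let `x` and `y` have weights `l` and `m`. By the Leibniz rule and `D² = 0`, every term of either
composite is a multiple of `D x ⊗ D y`, where `D` stands for the derivations it induces. Both
composites, with the sign of the statement, are `(-1)^|x| (1 / (l + m)) (1 / l + 1 / m) (D x ⊗ D
y)`, whereas `H_p ⊗ H_q` gives `(-1)^|x| (1 / l) (1 / m) (D x ⊗ D y)`. -/
theorem isPseudoDerivation (hD : IsWeightedHomotopy W D) (hH : IsAveraged W D H) :
    ThickSeq.IsPseudoDerivation 1 H := by
  have htop : ∀ n, Submodule.span k {y : A.tpow n | ∃ i m, y ∈ tpowWt W n i m} = ⊤ := fun n => by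
    rw [eq_top_iff, ← iSup_tpowWt hD.span n]
    exact iSup_le fun i => iSup_le fun m y hy => Submodule.subset_span ⟨i, m, hy⟩
  refine ⟨hD.isThick hH, fun p q => ?_⟩
  obtain ⟨T, hTdef⟩ : ∃ T : A.tpow (p + q) →ₗ[k] A.tpow (p + q), T =
    ThickSeq.tens 0 (H p) (LinearMap.id : A.tpow q →ₗ[k] A.tpow q) -
      ThickSeq.tens 1 (LinearMap.id : A.tpow p →ₗ[k] A.tpow p) (H q) := ⟨_, rfl⟩
  rw [← hTdef]
  have key : ∀ (i j : ℤ) (l m : ℕ), ∀ x ∈ tpowWt W p i l, ∀ y ∈ tpowWt W q j m,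
      T (H (p + q) (A.tmul x y)) = ThickSeq.tens 1 (H p) (H q) (A.tmul x y) ∧
        -(H (p + q) (T (A.tmul x y))) = ThickSeq.tens 1 (H p) (H q) (A.tmul x y) := by
    intro i j l m x hx y hy
    have hDx := der_mem_tpowWt hD.le hD.map_mem hx
    have hDy := der_mem_tpowWt hD.le hD.map_mem hy
    have gx := tpowWt_le hD.le p i l hx
    have gDx := tpowWt_le hD.le p _ l hDx
    have dd : ∀ {n : ℕ} (z : A.tpow n), A.der D n (A.der D n z) = 0 := fun z =>
      A.der_der (p := 1) (by decide) hD.hasDegree hD.sq_zero z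
    have hs : ksgn k ((i + 1 : ℤ) : ZMod 2) = -ksgn k (i : ZMod 2) := by
      push_cast
      rw [ksgn_add, ksgn_one, mul_neg_one]
    have h1 : ((1 : ℤ) : ZMod 2) = 1 := by decide
    -- If `l` or `m` is 0, the scalars may differ, but then `D x` or `D y` vanishes.
    have hc : (invNat k (l + m) * (invNat k l + invNat k m)) • A.tmul (A.der D p x) (A.der D q y) =
        (invNat k l * invNat k m) • A.tmul (A.der D p x) (A.der D q y) := by
      by_cases hl : l = 0
      · subst hl
        rw [der_eq_zero_of_mem_tpowWt hD.map_zero hx, LinearMap.map_zero, LinearMap.zero_apply,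
          smul_zero, smul_zero]
      · by_cases hm : m = 0
        · subst hm
          rw [der_eq_zero_of_mem_tpowWt hD.map_zero hy, LinearMap.map_zero, smul_zero, smul_zero]
        · rw [invNat_add k hl hm]
    have hR : ThickSeq.tens 1 (H p) (H q) (A.tmul x y) = ksgn k (i : ZMod 2) •
        (invNat k l * invNat k m) • A.tmul (A.der D p x) (A.der D q y) := by
      rw [tens_tmul _ _ _ gx, hH p i l x hx, hH q j m y hy, h1, one_mul, map_smul, map_smul,
        LinearMap.smul_apply, smul_smul (invNat k m), mul_comm (invNat k m)]
    -- The degrees and elements are quantified anew, while the weights stay fixed: the formula is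
    -- needed for `(x, y)`, `(D x, y)` and `(x, D y)`, which differ in degree only.
    have hT : ∀ {i j : ℤ} {x : A.tpow p} {y : A.tpow q}, x ∈ tpowWt W p i l → y ∈ tpowWt W q j m →
        T (A.tmul x y) =
          invNat k l • A.tmul (A.der D p x) y -
            (ksgn k (i : ZMod 2) * invNat k m) • A.tmul x (A.der D q y) := by
      intro i j x y hx hy
      have gx := tpowWt_le hD.le p i l hx
      rw [hTdef, LinearMap.sub_apply, tens_tmul _ _ _ gx, tens_tmul _ _ _ gx, hH p i l x hx,
        hH q j m y hy, h1]
      simp only [LinearMap.id_apply, map_smul, LinearMap.smul_apply, Int.cast_zero, zero_mul,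
        ksgn_zero, one_mul, smul_smul]
    have hV : ∀ {i j : ℤ} {x : A.tpow p} {y : A.tpow q}, x ∈ tpowWt W p i l → y ∈ tpowWt W q j m →
        H (p + q) (A.tmul x y) = invNat k (l + m) • (A.tmul (A.der D p x) y +
          ksgn k (i : ZMod 2) • A.tmul x (A.der D q y)) := by
      intro i j x y hx hy
      rw [hH _ _ _ _ (tmul_mem_tpowWt hx hy), der_tmul A D (tpowWt_le hD.le p i l hx)]
    constructor
    · rw [hV hx hy, map_smul, map_add, map_smul, hT hDx hy, hT hx hDy, hR, dd, dd, hs, ← hc]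
      simp only [LinearMap.map_zero, LinearMap.zero_apply, smul_zero, zero_sub, sub_zero]
      module
    · rw [hT hx hy, map_sub, map_smul, map_smul, hV hDx hy, hV hx hDy, hR, dd, dd, hs, ← hc]
      simp only [LinearMap.map_zero, LinearMap.zero_apply, smul_zero, zero_add, add_zero]
      module
  have hext : ∀ f g : A.tpow (p + q) →ₗ[k] A.tpow (p + q),
      (∀ (i j : ℤ) (l m : ℕ), ∀ x ∈ tpowWt W p i l, ∀ y ∈ tpowWt W q j m,
        f (A.tmul x y) = g (A.tmul x y)) → f = g := by
    intro f g h
    refine tmul_ext fun x y => ?_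
    have : (A.tmul (p := p) (q := q)).compr₂ f = (A.tmul (p := p) (q := q)).compr₂ g :=
      tpowWt_ext hD.span fun i l x hx => tpowWt_ext hD.span fun j m y hy => h i j l m x hx y hy
    exact LinearMap.congr_fun (LinearMap.congr_fun this x) y
  exact ⟨hext _ _ fun i j l m x hx y hy => (key i j l m x hx y hy).1,
    hext _ _ fun i j l m x hx y hy => (key i j l m x hx y hy).2⟩

end IsWeightedHomotopy

/-! ### Tensor powers of chain maps and the contraction at each level -/

theorem ThickSeq.pow_tprod {A : DGMod.{u, v} k} {B : DGMod.{u, w} k} (f : A →ₗ[k] B) {n : ℕ}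
    (a : Fin n → A) : ThickSeq.pow f n (PiTensorProduct.tprod k a) =
      PiTensorProduct.tprod k fun i => f (a i) :=
  PiTensorProduct.map_tprod _ _

theorem ThickSeq.pow_hasDegree {A : DGMod.{u, v} k} {B : DGMod.{u, w} k} {f : A →ₗ[k] B}
    (hf : HasDegree 0 f) : ThickSeq.IsThick 0 (ThickSeq.pow f) := by
  intro n i y hy
  change y ∈ A.tpowGr n i at hy
  induction hy using Submodule.span_induction with
  | mem y hy =>
    obtain ⟨e, rfl, a, ha, rfl⟩ := hy
    rw [pow_tprod]
    exact B.tprod_mem_tpowGr (fun j => by simpa using hf _ _ (ha j)) (add_zero _).symm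
  | zero => rw [LinearMap.map_zero]; exact zero_mem _
  | add a b _ _ ha hb => rw [map_add]; exact add_mem ha hb
  | smul c a _ ha => rw [map_smul]; exact Submodule.smul_mem _ _ ha

/-- A chain map of degree 0 commutes with `d` and with the sign operator, so it passes through each
summand of the differential separately. -/
theorem ThickSeq.pow_bdry {A : DGMod.{u, v} k} {B : DGMod.{u, w} k} {f : A →ₗ[k] B}
    (hf : HasDegree 0 f) (hd : bdry 0 f = 0) (n : ℕ) : bdry 0 (ThickSeq.pow f n) = 0 := by
  have hfd : ∀ x, B.d (f x) = f (A.d x) := fun x => by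
    simpa [bdry, ksgn_zero, sub_eq_zero] using LinearMap.congr_fun hd x
  have hs : ∀ x, B.sgn 1 (f x) = f (A.sgn 1 x) := fun x => by
    simpa [ksgn_zero] using sgn_comm hf 1 x
  rw [bdry, Int.cast_zero, ksgn_zero, one_smul, sub_eq_zero]
  apply PiTensorProduct.ext
  ext a
  simp only [LinearMap.compMultilinearMap_apply, LinearMap.comp_apply]
  rw [pow_tprod]
  change B.der B.d n _ = ThickSeq.pow f n (A.der A.d n _)
  rw [der_apply, der_apply, map_sum]
  refine Finset.sum_congr rfl fun i _ => ?_
  rw [insertAt, insertAt, PiTensorProduct.map_tprod, PiTensorProduct.map_tprod, pow_tprod]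
  congr 1
  funext j
  split_ifs
  · exact hs _
  · exact hfd _
  · rfl

/-- The hypotheses make `G F` the projection onto weight 0, so its tensor power is the projection
onto total weight 0. As `d` preserves weights, the factor `1 / m` comes out of `∂ H`, and `der_bdry`
gives `(1 / m) (-m) = -1` for `m ≠ 0`. In weight 0 both `H` and `G F - 1` vanish. The side
conditions come from `F D = 0`, `D² = 0` and the vanishing of `D` on weight 0, which contains the
values of `G` on a spanning set. -/
theorem IsWeightedHomotopy.isContraction [Algebra ℚ k] {A : DGMod.{u, v} k}
    {W : ℤ → ℕ → Submodule k A} {D : A →ₗ[k] A}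
    (hD : IsWeightedHomotopy W D) {H : ThickSeq A A} (hH : IsAveraged W D H) {B : DGMod.{u, w} k}
    {F : A →ₗ[k] B} {G : B →ₗ[k] A} (hF : HasDegree 0 F) (hG : HasDegree 0 G)
    (hdF : DGMod.bdry 0 F = 0) (hdG : DGMod.bdry 0 G = 0) (hFG : F ∘ₗ G = LinearMap.id)
    (h0 : ∀ i, ∀ x ∈ W i 0, G (F x) = x) (h1 : ∀ i m, m ≠ 0 → ∀ x ∈ W i m, G (F x) = 0)
    (hGW : Submodule.span k {y | ∃ i, G y ∈ W i 0} = ⊤) (n : ℕ) :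
    IsContraction (ThickSeq.pow F n) (ThickSeq.pow G n) (H n) := by
  have hFG' : ∀ y, F (G y) = y := LinearMap.congr_fun hFG
  have hFD : ∀ x, F (D x) = 0 := by
    have : F ∘ₗ D = 0 := by
      refine LinearMap.ext_on hD.span ?_
      rintro x ⟨i, m, hx⟩
      rw [LinearMap.comp_apply, LinearMap.zero_apply]
      by_cases hm : m = 0
      · subst hm
        rw [hD.map_zero i x hx, LinearMap.map_zero]
      -- As `F G = 1`, the vanishing of `F (D x)` can be tested after applying `G`, and `G F` kills
      -- the nonzero weight of `D x`.
      · rw [← hFG' (F (D x)), h1 _ m hm _ (hD.map_mem i m x hx), LinearMap.map_zero]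
    exact LinearMap.congr_fun this
  have dd : ∀ z : A.tpow n, A.der D n (A.der D n z) = 0 := fun z =>
    A.der_der (p := 1) (by decide) hD.hasDegree hD.sq_zero z
  have hPder : ∀ z : A.tpow n, ThickSeq.pow F n (A.der D n z) = 0 := by
    have : ThickSeq.pow F n ∘ₗ A.der D n = 0 := by
      apply PiTensorProduct.ext
      ext a
      simp only [LinearMap.compMultilinearMap_apply, LinearMap.comp_apply, der_apply, map_sum,
        LinearMap.zero_apply]
      refine Finset.sum_eq_zero fun i _ => ?_
      rw [insertAt, PiTensorProduct.map_tprod, ThickSeq.pow_tprod]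
      exact MultilinearMap.map_coord_zero _ i (by simp [hFD])
    exact LinearMap.congr_fun this
  have hP : ∀ i m, ∀ y ∈ tpowWt W n i m,
      ThickSeq.pow G n (ThickSeq.pow F n y) = if m = 0 then y else 0 := by
    intro i m y hy
    induction hy using Submodule.span_induction with
    | mem y hy =>
      obtain ⟨e, μ, rfl, rfl, a, ha, rfl⟩ := hy
      rw [ThickSeq.pow_tprod, ThickSeq.pow_tprod]
      split_ifs with hm
      · congr 1
        funext j
        have := Finset.sum_eq_zero_iff.1 hm j (Finset.mem_univ j)
        exact h0 (e j) _ (this ▸ ha j)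
      -- A nonzero total weight forces a factor of nonzero weight, which `G F` kills.
      · obtain ⟨j, -, hj⟩ := Finset.exists_ne_zero_of_sum_ne_zero hm
        exact MultilinearMap.map_coord_zero _ j (h1 _ _ hj _ (ha j))
    | zero => simp
    | add a b _ _ ha hb => rw [map_add, map_add, ha, hb]; split_ifs <;> simp
    | smul c a _ ha => rw [map_smul, map_smul, ha]; split_ifs <;> simp
  refine ⟨ThickSeq.pow_hasDegree hF n, ThickSeq.pow_hasDegree hG n, hD.isThick hH n,
    ThickSeq.pow_bdry hF hdF n, ThickSeq.pow_bdry hG hdG n, ?_, ?_, ?_, ?_, ?_⟩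
  · refine tpowWt_ext hD.span fun i m y hy => ?_
    have hdy : A.der A.d n y ∈ tpowWt W n (i + -1) m := der_mem_tpowWt hD.le hD.d_mem hy
    have e1 : DGMod.bdry 1 (H n) y = A.der A.d n (H n y) + H n (A.der A.d n y) := by
      rw [DGMod.bdry, Int.cast_one, ksgn_one, neg_one_smul, sub_neg_eq_add]
      rfl
    rw [e1, hH n i m y hy, hH n _ m _ hdy, map_smul, ← smul_add, hD.der_bdry hy,
      LinearMap.sub_apply, LinearMap.comp_apply, hP i m y hy, LinearMap.id_apply, smul_smul]
    split_ifs with hm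
    · subst hm
      rw [invNat_zero, zero_mul, zero_smul, sub_self]
    · rw [mul_neg, invNat_mul_self k hm, neg_one_smul, zero_sub]
  · apply PiTensorProduct.ext
    ext y
    simp only [LinearMap.compMultilinearMap_apply, LinearMap.comp_apply]
    rw [ThickSeq.pow_tprod, ThickSeq.pow_tprod]
    simp only [hFG', LinearMap.id_apply]
  · refine tpowWt_ext hD.span fun i m y hy => ?_
    rw [LinearMap.comp_apply, hH n i m y hy, map_smul, hPder, smul_zero, LinearMap.zero_apply]
  · refine tpowWt_ext hD.span fun i m y hy => ?_
    rw [LinearMap.comp_apply, hH n i m y hy, map_smul,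
      hH n _ m _ (der_mem_tpowWt hD.le hD.map_mem hy), dd, smul_zero, smul_zero,
      LinearMap.zero_apply]
  · refine tprod_ext_of_span _ hGW fun b hb => ?_
    choose e he using hb
    rw [LinearMap.comp_apply, ThickSeq.pow_tprod,
      hH n _ _ _ (tprod_mem_tpowWt (W := W) (e := e) (μ := fun _ => 0) he), Finset.sum_const_zero,
      invNat_zero, zero_smul, LinearMap.zero_apply]

end Weighted

/-! ### Counting the permutations that are maximal at a given element of a set -/

section Counting

/-- Composition with the transposition of `i` and `i'`, which maps `S` to itself, exchanges the
permutations whose maximum on `S` is at `i` with those whose maximum is at `i'`. -/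
theorem card_argmax_eq {n : ℕ} (S : Finset (Fin n)) {i i' : Fin n} (hi : i ∈ S) (hi' : i' ∈ S) :
    (Finset.univ.filter fun σ : Equiv.Perm (Fin n) => ∀ j ∈ S, σ j ≤ σ i').card =
      (Finset.univ.filter fun σ : Equiv.Perm (Fin n) => ∀ j ∈ S, σ j ≤ σ i).card := by
  have hS : ∀ j ∈ S, Equiv.swap i i' j ∈ S := by
    intro j hj
    rw [Equiv.swap_apply_def]
    split_ifs <;> assumption
  have hle : ∀ {i i' : Fin n} (σ : Equiv.Perm (Fin n)), (∀ j ∈ S, Equiv.swap i i' j ∈ S) →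
      (∀ j ∈ S, σ j ≤ σ i) → ∀ j ∈ S, (σ * Equiv.swap i i') j ≤ (σ * Equiv.swap i i') i' := by
    intro i i' σ hS hσ j hj
    simpa using hσ _ (hS j hj)
  refine Finset.card_bij' (fun σ _ => σ * Equiv.swap i i') (fun σ _ => σ * Equiv.swap i i')
    ?_ ?_ ?_ ?_
  · intro σ hσ
    simp only [Finset.mem_filter, Finset.mem_univ, true_and] at hσ ⊢
    rw [Equiv.swap_comm] at hS ⊢
    exact hle σ hS hσ
  · intro σ hσ
    simp only [Finset.mem_filter, Finset.mem_univ, true_and] at hσ ⊢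
    exact hle σ hS hσ
  · intro σ _
    simp [mul_assoc]
  · intro σ _
    simp [mul_assoc]

/-- Every permutation attains its maximum on `S` at exactly one element, so the `n!` permutations
fall into `|S|` classes, of equal size by the previous lemma. -/
theorem card_argmax_mul {n : ℕ} (S : Finset (Fin n)) {i : Fin n} (hi : i ∈ S) :
    (Finset.univ.filter fun σ : Equiv.Perm (Fin n) => ∀ j ∈ S, σ j ≤ σ i).card * S.card =
      n.factorial := by
  have h1 : ∑ i' ∈ S, (Finset.univ.filter fun σ : Equiv.Perm (Fin n) =>
      ∀ j ∈ S, σ j ≤ σ i').card = n.factorial := by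
    simp only [Finset.card_filter]
    rw [Finset.sum_comm]
    have : ∀ σ : Equiv.Perm (Fin n),
        (∑ i' ∈ S, if ∀ j ∈ S, σ j ≤ σ i' then 1 else 0) = 1 := by
      intro σ
      obtain ⟨m, hm, hmax⟩ := S.exists_max_image σ ⟨i, hi⟩
      rw [Finset.sum_eq_single_of_mem m hm, if_pos hmax]
      intro b hb hbm
      rw [if_neg]
      intro hb'
      exact hbm (σ.injective (le_antisymm (hmax b hb) (hb' m hm)))
    rw [Finset.sum_congr rfl fun σ _ => this σ]
    simp [Fintype.card_perm]
  rw [← h1, Finset.sum_congr rfl fun i' hi' => card_argmax_eq S hi hi', Finset.sum_const,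
    smul_eq_mul, mul_comm]

end Counting

/-! ### The symmetrized tensor trick in terms of weights -/

section SymTrick

variable {k : Type u} [CommRing k]

/-- `x` is fixed by the idempotent `π` (weight `0`) or killed by it (weight `1`). -/
def HasWeight {M : Type v} [AddCommGroup M] [Module k M] (π : M →ₗ[k] M) (m : ℕ) (x : M) : Prop :=
  (m = 0 ∧ π x = x) ∨ (m = 1 ∧ π x = 0)

theorem HasWeight.zero_iff {M : Type v} [AddCommGroup M] [Module k M] {π : M →ₗ[k] M} {x : M} :
    HasWeight π 0 x ↔ π x = x := by simp [HasWeight]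

theorem HasWeight.apply_eq_zero {M : Type v} [AddCommGroup M] [Module k M] {π : M →ₗ[k] M} {m : ℕ}
    {x : M} (h : HasWeight π m x) (hm : m ≠ 0) : m = 1 ∧ π x = 0 :=
  h.resolve_left fun h => hm h.1

namespace DGMod.IsContraction

variable {A : DGMod.{u, v} k} {B : DGMod.{u, w} k} {f : A →ₗ[k] B} {g : B →ₗ[k] A}
  {h : A →ₗ[k] A}

theorem h_eq_zero (hD : IsContraction f g h) {x : A} (hx : HasWeight (g ∘ₗ f) 0 x) : h x = 0 := by
  rw [← HasWeight.zero_iff.1 hx]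
  exact LinearMap.congr_fun hD.hg (f x)

/-- The factors after position `i` are hit by `g f`, which kills weight 1 and fixes weight 0. Thus
the `i`-th term dies if a factor of weight 1 follows, and otherwise `g f` may be replaced by the
identity. -/
theorem trick_tprod (n : ℕ) {μ : Fin n → ℕ} {a : Fin n → A}
    (ha : ∀ j, HasWeight (g ∘ₗ f) (μ j) (a j)) :
    ThickSeq.trick f g h n (PiTensorProduct.tprod k a) =
      ∑ i, if ∀ j, i < j → μ j = 0 then
        A.insertAt 1 h LinearMap.id i (PiTensorProduct.tprod k a) else 0 := by
  rw [ThickSeq.trick, LinearMap.sum_apply]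
  refine Finset.sum_congr rfl fun i _ => ?_
  rw [insertAt, PiTensorProduct.map_tprod]
  split_ifs with hi
  · rw [insertAt, PiTensorProduct.map_tprod]
    congr 1
    funext j
    split_ifs with h1 h2
    · rfl
    · rfl
    · have hij : i < j := lt_of_le_of_ne (not_lt.1 h1) (Ne.symm h2)
      exact HasWeight.zero_iff.1 (hi j hij ▸ ha j)
  · push Not at hi
    obtain ⟨j, hij, hj⟩ := hi
    refine MultilinearMap.map_coord_zero _ j ?_
    rw [if_neg (not_lt_of_gt hij), if_neg hij.ne']
    exact ((ha j).apply_eq_zero hj).2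

/-- Conjugation by `σ` takes the insertion of `h` at `σ i` back to the insertion at `i`, Koszul
signs included. Only the condition in `trick_tprod` depends on `σ`: "later" now refers to the order
that `σ` puts on the positions. -/
theorem perm_trick_perm_tprod (hD : IsContraction f g h) {n : ℕ} (σ : Equiv.Perm (Fin n))
    {e : Fin n → ℤ} {μ : Fin n → ℕ} {a : Fin n → A}
    (hae : ∀ j, a j ∈ A.gr (e j)) (ha : ∀ j, HasWeight (g ∘ₗ f) (μ j) (a j)) :
    A.perm σ⁻¹ (ThickSeq.trick f g h n (A.perm σ (PiTensorProduct.tprod k a))) =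
      ∑ i, if ∀ j, σ i < σ j → μ j = 0 then
        A.insertAt 1 h LinearMap.id i (PiTensorProduct.tprod k a) else 0 := by
  have h1 : ThickSeq.trick f g h n (A.perm σ (PiTensorProduct.tprod k a)) =
      ∑ i, if ∀ j, i < j → μ (σ.symm j) = 0 then
        A.insertAt 1 h LinearMap.id i (A.perm σ (PiTensorProduct.tprod k a)) else 0 := by
    rw [perm_tprod A σ hae, map_smul,
      trick_tprod n (μ := fun j => μ (σ.symm j)) fun j => ha (σ.symm j), Finset.smul_sum]
    refine Finset.sum_congr rfl fun i _ => ?_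
    split_ifs
    · rw [map_smul]
    · rw [smul_zero]
  have h2 : A.perm σ⁻¹ (A.perm σ (PiTensorProduct.tprod k a)) = PiTensorProduct.tprod k a := by
    rw [← LinearMap.comp_apply, ← ThickSeq.perm_mul, inv_mul_cancel]
    exact LinearMap.congr_fun (A.permRep n).map_one _
  rw [h1, map_sum, ← Equiv.sum_comp σ]
  refine Finset.sum_congr rfl fun i _ => ?_
  have hc : (∀ j, σ i < j → μ (σ.symm j) = 0) ↔ ∀ j, σ i < σ j → μ j = 0 :=
    ⟨fun H j hj => by simpa using H (σ j) hj, fun H j hj => H (σ.symm j) (by simpa using hj)⟩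
  simp only [hc]
  split_ifs
  · rw [A.perm_insertAt (p := 1) (by decide) hD.deg_h, h2]
    congr 1
    simp
  · rw [map_zero]

/-- For `i` of weight 1, the summand with `h` in position `i` survives for those `σ` that put `i`
last among the positions of weight 1. There are `n! / m` of them, so that after division by `n!`
each such summand has coefficient `1 / m`. This does not depend on `i`, and a derivation results. -/
theorem symTrick_tprod [Algebra ℚ k] (hD : IsContraction f g h) {n : ℕ}
    {e : Fin n → ℤ} {μ : Fin n → ℕ} {a : Fin n → A}
    (hae : ∀ j, a j ∈ A.gr (e j)) (ha : ∀ j, HasWeight (g ∘ₗ f) (μ j) (a j)) :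
    ThickSeq.symTrick f g h n (PiTensorProduct.tprod k a) =
      invNat k (∑ j, μ j) • A.der h n (PiTensorProduct.tprod k a) := by
  rw [ThickSeq.symTrick, LinearMap.smul_apply, LinearMap.sum_apply]
  simp only [LinearMap.comp_apply]
  rw [Finset.sum_congr rfl fun σ _ => perm_trick_perm_tprod hD σ hae ha, Finset.sum_comm,
    der_apply, Finset.smul_sum, Finset.smul_sum]
  refine Finset.sum_congr rfl fun i _ => ?_
  -- In a position of weight 0 the summand vanishes because `h g f = 0`, so its coefficient does not
  -- matter.
  by_cases hi : μ i = 0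
  · have h0 : A.insertAt 1 h LinearMap.id i (PiTensorProduct.tprod k a) = 0 := by
      rw [insertAt, PiTensorProduct.map_tprod]
      refine MultilinearMap.map_coord_zero _ i ?_
      rw [if_neg (lt_irrefl i), if_pos rfl]
      exact hD.h_eq_zero (hi ▸ ha i)
    simp [h0]
  -- The positions of weight 1. Since weights are 0 or 1, their number is the total weight.
  · let S : Finset (Fin n) := Finset.univ.filter fun j => μ j ≠ 0
    have hS : ∑ j, μ j = S.card := by
      rw [Finset.card_filter]
      refine Finset.sum_congr rfl fun j _ => ?_
      split_ifs with hj
      · exact ((ha j).apply_eq_zero hj).1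
      · exact not_not.1 hj
    have hiS : i ∈ S := by simp [S, hi]
    have hcond : ∀ σ : Equiv.Perm (Fin n),
        (∀ j, σ i < σ j → μ j = 0) ↔ ∀ j ∈ S, σ j ≤ σ i := by
      intro σ
      simp only [S, Finset.mem_filter, Finset.mem_univ, true_and]
      exact forall_congr' fun j => by rw [← not_le, ne_eq, not_imp_comm]
    simp only [hcond]
    rw [← Finset.sum_filter, Finset.sum_const, ← Nat.cast_smul_eq_nsmul k, smul_smul]
    congr 1
    have hc := card_argmax_mul S hiS
    have hS0 : (S.card : ℚ) ≠ 0 := by exact_mod_cast (Finset.card_pos.2 ⟨i, hiS⟩).ne'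
    rw [hS, invNat, ← map_natCast (algebraMap ℚ k), ← map_mul, ← hc]
    congr 1
    have hF0 : ((Finset.univ.filter fun σ : Equiv.Perm (Fin n) =>
        ∀ j ∈ S, σ j ≤ σ i).card : ℚ) ≠ 0 := by
      intro h0
      have := congrArg (Nat.cast : ℕ → ℚ) hc
      rw [Nat.cast_mul, h0, zero_mul] at this
      exact n.factorial_ne_zero (by exact_mod_cast this.symm)
    push_cast
    field_simp

end DGMod.IsContraction

end SymTrick

/-! ### Generators of `O[A]` with degree and weight -/

section SchurGenerators

variable {k : Type u} [CommRing k]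

namespace SymSeq

open PiTensorProduct (tprod)

/-- The elements `[o ⊗ a_1 ⊗ ⋯ ⊗ a_r]` of degree `i` and weight `m` of `O[A]`, where `o` is
homogeneous of weight `0` and the elements of degree `e` and weight `μ` of `A` are those of
`T e μ`. -/
def schurGen (O : SymSeq.{u, v} k) (A : DGMod.{u, w} k) (T : ℤ → ℕ → Set A) (i : ℤ) (m : ℕ) :
    Set (O.schur A) :=
  {x | ∃ (r : ℕ) (d : ℤ) (e : Fin r → ℤ) (μ : Fin r → ℕ) (o : O.obj r) (a : Fin r → A),
    d + ∑ j, e j = i ∧ ∑ j, μ j = m ∧ o ∈ (O.obj r).gr d ∧ (∀ j, a j ∈ T (e j) (μ j)) ∧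
      x = O.incl A r (o ⊗ₜ[k] (tprod k a : A.tpow r))}

theorem incl_mem (O : SymSeq.{u, v} k) (A : DGMod.{u, w} k) {r : ℕ} {d e : ℤ} {o : O.obj r}
    (ho : o ∈ (O.obj r).gr d) {y : A.tpow r} (hy : y ∈ (A.tpow r).gr e) :
    O.incl A r (o ⊗ₜ[k] y) ∈ (O.schur A).gr (d + e) :=
  Submodule.mem_iSup_of_mem r ⟨O.proj A r (o ⊗ₜ[k] y),
    ⟨o ⊗ₜ[k] y, Submodule.subset_span ⟨d, e, rfl, o, ho, y, hy, rfl⟩, rfl⟩, rfl⟩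

theorem schurGen_subset (O : SymSeq.{u, v} k) {A : DGMod.{u, w} k} {T : ℤ → ℕ → Set A}
    (hT : ∀ i m, T i m ⊆ A.gr i) (i : ℤ) (m : ℕ) :
    O.schurGen A T i m ⊆ (O.schur A).gr i := by
  rintro _ ⟨r, d, e, μ, o, a, rfl, rfl, ho, ha, rfl⟩
  exact O.incl_mem A ho (A.tprod_mem_tpowGr (fun j => hT _ _ (ha j)) rfl)

theorem schur_ext {O : SymSeq.{u, v} k} {A : DGMod.{u, w} k} {T : ℤ → ℕ → Set A}
    (hT : Submodule.span k {x | ∃ i m, x ∈ T i m} = ⊤) {N : Type*} [AddCommGroup N] [Module k N]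
    {f g : O.schur A →ₗ[k] N} (h : ∀ i m, ∀ x ∈ O.schurGen A T i m, f x = g x) : f = g := by
  apply DirectSum.linearMap_ext
  intro r
  apply Representation.Coinvariants.hom_ext
  apply TensorProduct.ext
  refine DGMod.hom_ext fun d o ho => ?_
  refine tprod_ext_of_span _ hT fun a ha => ?_
  choose e μ ha using ha
  exact h _ _ _ ⟨r, d, e, μ, o, a, rfl, rfl, ho, ha, rfl⟩

theorem span_schurGen (O : SymSeq.{u, v} k) {A : DGMod.{u, w} k} {T : ℤ → ℕ → Set A}
    (hT : Submodule.span k {x | ∃ i m, x ∈ T i m} = ⊤) :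
    Submodule.span k {x | ∃ i m, x ∈ O.schurGen A T i m} = ⊤ := by
  rw [← (Submodule.span k _).ker_mkQ, LinearMap.ker_eq_top]
  refine schur_ext hT fun i m x hx => ?_
  exact (Submodule.Quotient.mk_eq_zero _).2 (Submodule.subset_span ⟨i, m, hx⟩)

theorem iSup_span_schurGen (O : SymSeq.{u, v} k) {A : DGMod.{u, w} k} {T : ℤ → ℕ → Set A}
    (hT : Submodule.span k {x | ∃ i m, x ∈ T i m} = ⊤) :
    ⨆ i, ⨆ m, Submodule.span k (O.schurGen A T i m) = ⊤ := by
  rw [eq_top_iff, ← O.span_schurGen hT, Submodule.span_le]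
  rintro x ⟨i, m, hx⟩
  exact Submodule.mem_iSup_of_mem i (Submodule.mem_iSup_of_mem m (Submodule.subset_span hx))

/-- The homogeneous elements of `A`, all of weight `0`. -/
def homogGen (A : DGMod.{u, w} k) (i : ℤ) (m : ℕ) : Set A := {x | x ∈ A.gr i ∧ m = 0}

theorem span_homogGen (A : DGMod.{u, w} k) :
    Submodule.span k {x | ∃ i m, x ∈ homogGen A i m} = ⊤ := by
  rw [eq_top_iff, ← A.span_homog]
  refine Submodule.span_mono ?_
  rintro _ ⟨⟨x, i, hx⟩, rfl⟩
  exact ⟨i, 0, hx, rfl⟩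

theorem d_incl (O : SymSeq.{u, v} k) (A : DGMod.{u, w} k) {r : ℕ} {d : ℤ} {o : O.obj r}
    (ho : o ∈ (O.obj r).gr d) (y : A.tpow r) :
    (O.schur A).d (O.incl A r (o ⊗ₜ[k] y)) = O.incl A r ((O.obj r).d o ⊗ₜ[k] y) +
      ksgn k (d : ZMod 2) • O.incl A r (o ⊗ₜ[k] A.der A.d r y) := by
  have h1 : (O.schur A).d (O.incl A r (o ⊗ₜ[k] y)) =
      O.incl A r (tensorD (O.obj r) (A.tpow r) (o ⊗ₜ[k] y)) := by
    rw [incl, LinearMap.comp_apply]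
    refine (DirectSum.toModule_lof k r _).trans ?_
    rfl
  rw [h1, tensorD_tmul _ _ ho, map_add, map_smul]
  rfl

/-! ### Functoriality -/

section Functor

variable {A : DGMod.{u, w} k} {B : DGMod.{u, x} k}

theorem schurMap_incl (O : SymSeq.{u, v} k) (f : A →ₗ[k] B) (hf : HasDegree 0 f) {r : ℕ}
    (o : O.obj r) (y : A.tpow r) : O.schurMap f hf (O.incl A r (o ⊗ₜ[k] y)) =
      O.incl B r (o ⊗ₜ[k] ThickSeq.pow f r y) := by
  rw [incl, LinearMap.comp_apply]
  refine (DirectSum.toModule_lof k r _).trans ?_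
  rfl

theorem schurMap_hasDegree (O : SymSeq.{u, v} k) {f : A →ₗ[k] B} (hf : HasDegree 0 f) :
    HasDegree 0 (O.schurMap f hf) := by
  have hT : ∀ i m, homogGen A i m ⊆ A.gr i := fun i m x hx => hx.1
  refine hasDegree_of_span (fun i m => Submodule.span_le.2 (O.schurGen_subset hT i m))
    (O.iSup_span_schurGen (span_homogGen A)) fun i m => ?_
  change _ ≤ ((O.schur B).gr (i + 0)).comap (O.schurMap f hf)
  refine Submodule.span_le.2 ?_
  rintro _ ⟨r, d, e, μ, o, a, rfl, rfl, ho, ha, rfl⟩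
  change O.schurMap f hf _ ∈ (O.schur B).gr _
  rw [schurMap_incl, add_assoc]
  exact O.incl_mem B ho (ThickSeq.pow_hasDegree hf r _ _ (A.tprod_mem_tpowGr (fun j => (ha j).1) rfl))

theorem schurMap_bdry (O : SymSeq.{u, v} k) {f : A →ₗ[k] B} (hf : HasDegree 0 f)
    (hd : bdry 0 f = 0) : bdry 0 (O.schurMap f hf) = 0 := by
  rw [bdry, Int.cast_zero, ksgn_zero, one_smul, sub_eq_zero]
  refine schur_ext (span_homogGen A) ?_
  rintro _ _ _ ⟨r, d, e, μ, o, a, rfl, rfl, ho, ha, rfl⟩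
  have h1 := LinearMap.congr_fun (ThickSeq.pow_bdry hf hd r) (tprod k a)
  rw [bdry, Int.cast_zero, ksgn_zero, one_smul, LinearMap.sub_apply, LinearMap.zero_apply,
    sub_eq_zero] at h1
  have h2 : B.der B.d r (ThickSeq.pow f r (tprod k a)) =
    ThickSeq.pow f r (A.der A.d r (tprod k a)) := h1
  rw [LinearMap.comp_apply, LinearMap.comp_apply, schurMap_incl, d_incl O B ho, d_incl O A ho,
    map_add, map_smul, schurMap_incl, schurMap_incl, h2]

/-! ### The extended Schur functor on generators -/

theorem join_split_flat (O : SymSeq.{u, v} k) (A : DGMod.{u, w} k) {n : ℕ} (r : Fin n → ℕ)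
    (o : ∀ i, O.obj (r i)) (a : ∀ i, Fin (r i) → A) :
    O.join A r (tprod k o) (A.split r (tprod k (flat a))) =
      (tprod k fun i => O.incl A (r i) (o i ⊗ₜ[k] (tprod k (a i) : A.tpow (r i))) :
        (O.schur A).tpow n) := by
  rw [split_tprod, join]
  refine (PiTensorProduct.map₂_tprod_tprod _ _ _).trans ?_
  simp only [flat_apply]
  rfl

theorem blockSgn_tprod (A : DGMod.{u, w} k) {n : ℕ} (r : Fin n → ℕ) (t : Fin n → ZMod 2)
    {e : Fin (∑ i, r i) → ℤ} {b : Fin (∑ i, r i) → A} (hb : ∀ l, b l ∈ A.gr (e l)) :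
    A.blockSgn r t (tprod k b) =
      ksgn k (∑ l, t (finSigmaFinEquiv.symm l).1 * (e l : ZMod 2)) • tprod k b := by
  rw [blockSgn, PiTensorProduct.map_tprod, ksgn_sum, ← MultilinearMap.map_smul_univ]
  congr 1
  funext l
  exact A.sgn_of_mem _ (hb l)

theorem flat_mem {n : ℕ} {r : Fin n → ℕ} {a : ∀ i, Fin (r i) → A}
    {e : ∀ i, Fin (r i) → ℤ} (ha : ∀ i j, a i j ∈ A.gr (e i j)) (l : Fin (∑ i, r i)) :
    flat a l ∈ A.gr (flat e l) := ha _ _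

/-- As `f` has degree 0, it passes the `o_i` without sign and preserves the degree of each block, so
the signs of the shuffle and of its inverse are equal and cancel. What remains is `f^{⊗ r_i}` in
each block. -/
theorem extSchur_pow (O : SymSeq.{u, v} k) {f : A →ₗ[k] B} (hf : HasDegree 0 f) :
    O.extSchur 0 (ThickSeq.pow f) (ThickSeq.pow_symmetric hf) = ThickSeq.pow (O.schurMap f hf) := by
  funext n
  refine tprod_ext_of_span _ (O.span_schurGen (span_homogGen A)) fun x hx => ?_
  choose i m r d e μ o a hi hm ho ha hx using hx
  obtain rfl : x = _ := funext hx
  have hfl := flat_mem fun i j => (ha i j).1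
  have hfl' : ∀ l, flat (fun i j => f (a i j)) l ∈ B.gr (flat e l) :=
    flat_mem fun i j => by simpa using hf _ _ (ha i j).1
  rw [extSchur_apply, schurLevel_of_mem O 0 _ r d o ho, Int.cast_zero, zero_mul, ksgn_zero,
    one_smul, blockSgn_tprod A r _ hfl, map_smul, map_smul, ThickSeq.pow_tprod]
  have h1 : (fun l => f (flat a l)) = flat fun i j => f (a i j) := rfl
  rw [h1, blockSgn_tprod B r _ hfl', smul_smul, ksgn_mul_self, one_smul, join_split_flat,
    ThickSeq.pow_tprod]
  congr 1
  funext j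
  rw [schurMap_incl, ThickSeq.pow_tprod]

end Functor

/-! ### The derivation of `O[A]` induced by a map of degree one -/

section Derivation

variable {A : DGMod.{u, w} k}

theorem sgn_act (O : SymSeq.{u, v} k) {r : ℕ} (σ : Equiv.Perm (Fin r)) (o : O.obj r) :
    (O.obj r).sgn 1 (O.act r σ o) = O.act r σ ((O.obj r).sgn 1 o) := by
  simpa [ksgn_zero] using sgn_comm (O.act_mem r σ) 1 o

/-- The map `[o ⊗ y] ↦ (-1)^|o| [o ⊗ φ y]` on `O[A]`, where `φ` of degree `1` acts on tensor powers
as a derivation. -/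
def schurDer (O : SymSeq.{u, v} k) (φ : A →ₗ[k] A) (hφ : HasDegree 1 φ) :
    O.schur A →ₗ[k] O.schur A :=
  DirectSum.toModule k ℕ _ fun r => Representation.Coinvariants.lift (O.diagAct A r)
    (O.incl A r ∘ₗ TensorProduct.map ((O.obj r).sgn 1) (A.der φ r)) fun σ => by
      apply TensorProduct.ext'
      intro o y
      rw [LinearMap.comp_apply, diagAct_tmul, LinearMap.comp_apply, LinearMap.comp_apply,
        TensorProduct.map_tmul, TensorProduct.map_tmul, ← A.perm_der (p := 1) (by decide) hφ,
        sgn_act, incl, LinearMap.comp_apply, LinearMap.comp_apply, proj_act]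

theorem schurDer_incl (O : SymSeq.{u, v} k) {φ : A →ₗ[k] A} (hφ : HasDegree 1 φ) {r : ℕ} {d : ℤ}
    {o : O.obj r} (ho : o ∈ (O.obj r).gr d) (y : A.tpow r) :
    O.schurDer φ hφ (O.incl A r (o ⊗ₜ[k] y)) =
      ksgn k (d : ZMod 2) • O.incl A r (o ⊗ₜ[k] A.der φ r y) := by
  rw [incl, LinearMap.comp_apply]
  refine (DirectSum.toModule_lof k r _).trans ?_
  have : O.incl A r ((O.obj r).sgn 1 o ⊗ₜ[k] A.der φ r y) =
      ksgn k (d : ZMod 2) • O.incl A r (o ⊗ₜ[k] A.der φ r y) := by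
    rw [sgn_of_mem _ _ ho, one_mul, ← TensorProduct.smul_tmul', map_smul]
  exact this

/-- Needed for `φ = h` with `p = 1` and for `φ = d` with `p = -1`: both preserve the weights of `A`,
so the maps they induce preserve those of `O[A]`. -/
theorem incl_der_mem (O : SymSeq.{u, v} k) {T : ℤ → ℕ → Set A} (hT : ∀ i m, T i m ⊆ A.gr i) {p : ℤ}
    {φ : A →ₗ[k] A} (hφ : ∀ i m, ∀ x ∈ T i m, φ x ∈ T (i + p) m) {r : ℕ} {d : ℤ} {o : O.obj r}
    (ho : o ∈ (O.obj r).gr d) {e : Fin r → ℤ} {μ : Fin r → ℕ} {a : Fin r → A}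
    (ha : ∀ j, a j ∈ T (e j) (μ j)) :
    O.incl A r (o ⊗ₜ[k] A.der φ r (tprod k a)) ∈
      Submodule.span k (O.schurGen A T (d + ∑ j, e j + p) (∑ j, μ j)) := by
  rw [der_tprod A φ fun j => hT _ _ (ha j), TensorProduct.tmul_sum, map_sum]
  refine Submodule.sum_mem _ fun j _ => ?_
  rw [TensorProduct.tmul_smul, map_smul]
  refine Submodule.smul_mem _ _ (Submodule.subset_span
    ⟨r, d, Function.update e j (e j + p), μ, o, _, ?_, rfl, ho, fun l => ?_, rfl⟩)
  · rw [Finset.sum_update_of_mem (Finset.mem_univ j),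
      ← Finset.add_sum_erase _ e (Finset.mem_univ j), Finset.sdiff_singleton_eq_erase]
    ring
  · by_cases h : l = j
    · subst h; simpa using hφ _ _ _ (ha l)
    · simpa [Function.update_of_ne h] using ha l

end Derivation

end SymSeq

end SchurGenerators

/-! ### The weighted homotopy on `O[A]` and the comparison with `O_•[h^Σ]` -/

section SchurContraction

open PiTensorProduct (tprod)

variable {k : Type u} [CommRing k]

/-- The elements of degree `i` and weight `m` with respect to the idempotent `π`. -/
def weightGen (A : DGMod.{u, v} k) (π : A →ₗ[k] A) (i : ℤ) (m : ℕ) : Set A :=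
  {x | x ∈ A.gr i ∧ HasWeight π m x}

namespace SymSeq

/-- Before the `j`-th letter of block `i` stand all earlier blocks and the earlier letters of block
`i`. Applied to parities, this splits the sign that `h` picks up on its way to that letter. -/
theorem sum_lt_finSigma {n : ℕ} {r : Fin n → ℕ} {M : Type*} [AddCommMonoid M]
    (e : ∀ i, Fin (r i) → M) (i : Fin n) (j : Fin (r i)) :
    (∑ l, if l < finSigmaFinEquiv ⟨i, j⟩ then flat e l else 0) =
      (∑ i', if i' < i then ∑ j', e i' j' else 0) + ∑ j', if j' < j then e i j' else 0 := by
  have h1 : ∀ i', (∑ j', if (finSigmaFinEquiv ⟨i', j'⟩ : Fin (∑ i, r i)) < finSigmaFinEquiv ⟨i, j⟩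
      then flat e (finSigmaFinEquiv ⟨i', j'⟩) else 0) =
      (if i' < i then ∑ j', e i' j' else 0) +
        if i' = i then ∑ j', (if j' < j then e i j' else 0) else 0 := by
    intro i'
    simp only [flat_apply]
    rcases lt_trichotomy i' i with h | rfl | h
    · simp [h, h.ne, finSigma_lt_of_lt r h]
    · simp [finSigma_lt_iff]
    · simp [h.ne', not_lt_of_gt h, not_lt_of_gt (finSigma_lt_of_lt r h _ _)]
  rw [← Equiv.sum_comp finSigmaFinEquiv, Fintype.sum_sigma, Finset.sum_congr rfl fun i' _ => h1 i',
    Finset.sum_add_distrib]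
  simp

variable {A : DGMod.{u, w} k} {B : DGMod.{u, x} k} {f : A →ₗ[k] B} {g : B →ₗ[k] A}
  {h : A →ₗ[k] A}

theorem pi_pi (hD : IsContraction f g h) (x : A) : g (f (g (f x))) = g (f x) :=
  congrArg g (LinearMap.congr_fun hD.fg (f x))

/-- The decomposition `x = g f x + (x - g f x)` by the idempotent `g f`, which has degree 0. -/
theorem span_weightGen (hD : IsContraction f g h) :
    Submodule.span k {x | ∃ i m, x ∈ weightGen A (g ∘ₗ f) i m} = ⊤ := by
  rw [eq_top_iff, ← A.span_homog, Submodule.span_le]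
  rintro _ ⟨⟨x, i, hx⟩, rfl⟩
  have hpx : g (f x) ∈ A.gr i := by simpa using hD.deg_g _ _ (hD.deg_f _ _ hx)
  have : x = g (f x) + (x - g (f x)) := by abel
  change x ∈ _
  rw [this]
  refine add_mem (Submodule.subset_span ⟨i, 0, hpx, ?_⟩)
    (Submodule.subset_span ⟨i, 1, sub_mem hx hpx, Or.inr ⟨rfl, ?_⟩⟩)
  · exact HasWeight.zero_iff.2 (pi_pi hD x)
  · simp [pi_pi hD]

theorem h_mem_weightGen (hD : IsContraction f g h) (i : ℤ) (m : ℕ) (x : A)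
    (hx : x ∈ weightGen A (g ∘ₗ f) i m) : h x ∈ weightGen A (g ∘ₗ f) (i + 1) m := by
  refine ⟨hD.deg_h _ _ hx.1, ?_⟩
  rcases hx.2 with ⟨rfl, h0⟩ | ⟨rfl, h0⟩
  · rw [hD.h_eq_zero hx.2, HasWeight.zero_iff, map_zero]
  · refine Or.inr ⟨rfl, ?_⟩
    have := LinearMap.congr_fun hD.fh x
    rw [LinearMap.comp_apply, LinearMap.zero_apply] at this
    rw [LinearMap.comp_apply, this, map_zero]

theorem pi_d (hD : IsContraction f g h) (x : A) : g (f (A.d x)) = A.d (g (f x)) := by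
  have h1 := LinearMap.congr_fun hD.bdry_f x
  have h2 := LinearMap.congr_fun hD.bdry_g (f x)
  simp only [bdry, Int.cast_zero, ksgn_zero, one_smul, LinearMap.sub_apply, LinearMap.comp_apply,
    LinearMap.zero_apply, sub_eq_zero] at h1 h2
  rw [← h1, ← h2]

theorem d_mem_weightGen (hD : IsContraction f g h) (i : ℤ) (m : ℕ) (x : A)
    (hx : x ∈ weightGen A (g ∘ₗ f) i m) : A.d x ∈ weightGen A (g ∘ₗ f) (i + -1) m := by
  refine ⟨A.hasDegree_d _ _ hx.1, ?_⟩
  rcases hx.2 with ⟨rfl, h0⟩ | ⟨rfl, h0⟩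
  · exact Or.inl ⟨rfl, (pi_d hD x).trans (congrArg _ h0)⟩
  · exact Or.inr ⟨rfl, (pi_d hD x).trans ((congrArg _ h0).trans (map_zero _))⟩

/-- The operator `g f - 1` is 0 on the image of `g f` and `-1` on its kernel. -/
theorem h_bdry_of_weight (hD : IsContraction f g h) {m : ℕ} {x : A}
    (hx : HasWeight (g ∘ₗ f) m x) : A.d (h x) + h (A.d x) = -(m : k) • x := by
  have h1 := LinearMap.congr_fun hD.bdry_h x
  simp only [bdry, Int.cast_one, ksgn_one, neg_one_smul, sub_neg_eq_add, LinearMap.add_apply,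
    LinearMap.comp_apply, LinearMap.sub_apply, LinearMap.id_apply] at h1
  rw [h1]
  rcases hx with ⟨rfl, h0⟩ | ⟨rfl, h0⟩
  · rw [LinearMap.comp_apply] at h0
    simp [h0]
  · rw [LinearMap.comp_apply] at h0
    simp [h0]

/-- All properties are inherited from the derivation of `A^{⊗ r}` extending `h`, since the weight of
`[o ⊗ a_1 ⊗ ⋯ ⊗ a_r]` is read off from the `a_j`. In particular `d D + D d` reduces to the
anticommutator of the derivations extending `d` and `h`, which is `-∑ μ j`. -/
theorem isWeightedHomotopy_schurDer (O : SymSeq.{u, v} k) (hD : IsContraction f g h) :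
    IsWeightedHomotopy
      (fun i m => Submodule.span k (O.schurGen A (weightGen A (g ∘ₗ f)) i m))
      (O.schurDer h hD.deg_h) := by
  have hT : ∀ i m, weightGen A (g ∘ₗ f) i m ⊆ A.gr i := fun i m x hx => hx.1
  constructor
  · exact fun i m => Submodule.span_le.2 (O.schurGen_subset hT i m)
  · rw [eq_top_iff, ← O.span_schurGen (span_weightGen hD)]
    exact Submodule.span_mono fun x ⟨i, m, hx⟩ => ⟨i, m, Submodule.subset_span hx⟩
  · intro i m
    change _ ≤ (Submodule.span k _).comap (O.schurDer h hD.deg_h)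
    refine Submodule.span_le.2 ?_
    rintro _ ⟨r, d, e, μ, o, a, rfl, rfl, ho, ha, rfl⟩
    change O.schurDer h hD.deg_h _ ∈ Submodule.span k _
    rw [schurDer_incl O hD.deg_h ho]
    exact Submodule.smul_mem _ _ (O.incl_der_mem hT (h_mem_weightGen hD) ho ha)
  · intro i m
    change _ ≤ (Submodule.span k _).comap (O.schur A).d
    refine Submodule.span_le.2 ?_
    rintro _ ⟨r, d, e, μ, o, a, rfl, rfl, ho, ha, rfl⟩
    change (O.schur A).d _ ∈ Submodule.span k _
    rw [d_incl O A ho]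
    refine add_mem (Submodule.subset_span
      ⟨r, d - 1, e, μ, _, a, by ring, rfl, (O.obj r).d_mem _ _ ho, ha, rfl⟩) ?_
    exact Submodule.smul_mem _ _ (O.incl_der_mem hT (d_mem_weightGen hD) ho ha)
  · have : O.schurDer h hD.deg_h ∘ₗ O.schurDer h hD.deg_h = 0 := by
      refine schur_ext (span_weightGen hD) ?_
      rintro _ _ _ ⟨r, d, e, μ, o, a, rfl, rfl, ho, ha, rfl⟩
      rw [LinearMap.comp_apply, schurDer_incl O hD.deg_h ho, map_smul,
        schurDer_incl O hD.deg_h ho,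
        A.der_der (p := 1) (by decide) hD.deg_h (LinearMap.congr_fun hD.hh),
        TensorProduct.tmul_zero, map_zero, smul_zero, smul_zero, LinearMap.zero_apply]
    exact LinearMap.congr_fun this
  · intro i
    change _ ≤ LinearMap.ker (O.schurDer h hD.deg_h)
    refine Submodule.span_le.2 ?_
    rintro _ ⟨r, d, e, μ, o, a, rfl, hμ, ho, ha, rfl⟩
    change O.schurDer h hD.deg_h _ = 0
    rw [schurDer_incl O hD.deg_h ho, der_tprod_of_eq_zero, TensorProduct.tmul_zero, map_zero,
      smul_zero]
    intro j
    exact hD.h_eq_zero (Finset.sum_eq_zero_iff.1 hμ j (Finset.mem_univ j) ▸ (ha j).2)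
  · intro i m
    change _ ≤ LinearMap.eqLocus ((O.schur A).d ∘ₗ O.schurDer h hD.deg_h +
      O.schurDer h hD.deg_h ∘ₗ (O.schur A).d) (-(m : k) • LinearMap.id)
    refine Submodule.span_le.2 ?_
    rintro _ ⟨r, d, e, μ, o, a, rfl, rfl, ho, ha, rfl⟩
    refine LinearMap.mem_eqLocus.2 ?_
    rw [LinearMap.add_apply, LinearMap.comp_apply, LinearMap.comp_apply, LinearMap.smul_apply,
      LinearMap.id_apply]
    have h1 := A.der_der_add (p := -1) (q := 1) (by decide) (by decide) A.hasDegree_d hD.deg_h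
      (c := fun j => -(μ j : k)) fun j => h_bdry_of_weight hD (ha j).2
    -- As `d o` has degree one less than `o`, the terms containing `d o` in `d D` and in `D d` have
    -- opposite signs and cancel.
    have hs : ksgn k ((d - 1 : ℤ) : ZMod 2) = -ksgn k (d : ZMod 2) := by
      push_cast
      rw [ksgn_sub_one]
    rw [schurDer_incl O hD.deg_h ho, map_smul, d_incl O A ho, d_incl O A ho, map_add, map_smul,
      schurDer_incl O hD.deg_h ho, schurDer_incl O hD.deg_h ((O.obj r).d_mem _ _ ho), hs,
      smul_add, smul_smul, smul_smul, ksgn_mul_self, one_smul, one_smul, neg_smul]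
    have h2 : O.incl A r (o ⊗ₜ[k] A.der A.d r (A.der h r (tprod k a))) +
        O.incl A r (o ⊗ₜ[k] A.der h r (A.der A.d r (tprod k a))) =
        -((∑ j, μ j : ℕ) : k) • O.incl A r (o ⊗ₜ[k] (tprod k a : A.tpow r)) := by
      rw [← map_add, ← TensorProduct.tmul_add, ← map_smul, ← TensorProduct.tmul_smul, h1]
      simp
    rw [← h2]
    abel

/-- The scalar `1 / m` depends only on the total weight of the concatenated tensor, which is the sum
of the weights of the blocks. The derivation extending `h` is a sum over all letters; the letters of
block `i` together form `D` in the `i`-th factor of `O[A]^{⊗ n}`. What has to be checked is that the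
Koszul signs agree letter by letter. -/
theorem schurLevel_symTrick [Algebra ℚ k] (O : SymSeq.{u, v} k) (hD : IsContraction f g h) {n : ℕ}
    {r : Fin n → ℕ} {d : Fin n → ℤ} {o : ∀ i, O.obj (r i)}
    (ho : ∀ i, o i ∈ (O.obj (r i)).gr (d i)) {e : ∀ i, Fin (r i) → ℤ} {μ : ∀ i, Fin (r i) → ℕ}
    {a : ∀ i, Fin (r i) → A} (ha : ∀ i j, a i j ∈ weightGen A (g ∘ₗ f) (e i j) (μ i j)) :
    O.schurLevel 1 (ThickSeq.symTrick f g h) r (tprod k o) (tprod k (flat a)) =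
      invNat k (∑ i, ∑ j, μ i j) • (O.schur A).der (O.schurDer h hD.deg_h) n
        (tprod k fun i => O.incl A (r i) (o i ⊗ₜ[k] (tprod k (a i) : A.tpow (r i)))) := by
  have hfl := flat_mem fun i j => (ha i j).1
  have hμ : ∑ l, flat μ l = ∑ i, ∑ j, μ i j := by
    rw [← Equiv.sum_comp finSigmaFinEquiv, Fintype.sum_sigma]
    simp only [flat_apply]
  have hx : ∀ i, O.incl A (r i) (o i ⊗ₜ[k] (tprod k (a i) : A.tpow (r i))) ∈
      (O.schur A).gr (d i + ∑ j, e i j) := fun i =>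
    O.incl_mem A (ho i) (A.tprod_mem_tpowGr (fun j => (ha i j).1) rfl)
  rw [schurLevel_of_mem O 1 _ r d o ho, blockSgn_tprod A r _ hfl, map_smul,
    hD.symTrick_tprod (μ := flat μ) hfl fun l => (ha _ _).2,
    hμ, der_tprod A h hfl, der_tprod _ _ hx]
  simp only [map_smul, map_sum]
  rw [smul_comm (ksgn k (∑ l, _)) (invNat k _), smul_comm (ksgn k (_ * _)) (invNat k _)]
  congr 1
  rw [Finset.smul_sum, Finset.smul_sum, ← Equiv.sum_comp finSigmaFinEquiv, Fintype.sum_sigma]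
  refine Finset.sum_congr rfl fun i _ => ?_
  rw [schurDer_incl O hD.deg_h (ho i), MultilinearMap.map_update_smul,
    der_tprod A h fun j => (ha i j).1, TensorProduct.tmul_sum, map_sum,
    MultilinearMap.map_update_sum, Finset.smul_sum, Finset.smul_sum]
  refine Finset.sum_congr rfl fun j _ => ?_
  have hup : ∀ l, Function.update (flat a) (finSigmaFinEquiv ⟨i, j⟩)
      (h (flat a (finSigmaFinEquiv ⟨i, j⟩))) l ∈
      A.gr (Function.update (flat e) (finSigmaFinEquiv ⟨i, j⟩)
        (flat e (finSigmaFinEquiv ⟨i, j⟩) + 1) l) :=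
    fun l => update_mem hfl _ (hD.deg_h _ _ (hfl _)) l
  have hflat : Function.update (flat a) (finSigmaFinEquiv ⟨i, j⟩) (h (a i j)) =
      flat (Function.update a i (Function.update (a i) j (h (a i j)))) := by
    rw [flat_update, Function.update_eq_self]
  have hgen : (fun i' => O.incl A (r i') (o i' ⊗ₜ[k]
        (tprod k (Function.update a i (Function.update (a i) j (h (a i j))) i') :
          A.tpow (r i')))) =
      Function.update (fun i' => O.incl A (r i') (o i' ⊗ₜ[k] (tprod k (a i') : A.tpow (r i')))) i
        (O.incl A (r i) (o i ⊗ₜ[k] (tprod k (Function.update (a i) j (h (a i j))) :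
          A.tpow (r i)))) := by
    funext i'
    by_cases hi : i' = i
    · subst hi; simp
    · simp [Function.update_of_ne hi]
  rw [blockSgn_tprod A r _ hup, flat_apply e, flat_apply a, hflat, map_smul, map_smul, join_split_flat, hgen,
    TensorProduct.tmul_smul, map_smul, MultilinearMap.map_update_smul]
  simp only [smul_smul, ← ksgn_add]
  congr 2
  set t := after fun i => (d i : ZMod 2)
  have h2 : ∀ z : ZMod 2, z + z = 0 := by decide
  -- On its way `h` passes all of `o_1, …, o_n`. In `O[A]^{⊗ n}` it passes only `o_1, …, o_i`, so
  -- the excess is `t i`, the parity of `o_{i+1} ⊗ ⋯ ⊗ o_n`.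
  have hS1 : ∑ i', (d i' : ZMod 2) =
      (∑ i', if i' < i then (d i' : ZMod 2) else 0) + (d i : ZMod 2) + t i := by
    have : ∀ i', (d i' : ZMod 2) = ((if i' < i then (d i' : ZMod 2) else 0) +
        if i' = i then (d i : ZMod 2) else 0) + if i < i' then (d i' : ZMod 2) else 0 := by
      intro i'
      rcases lt_trichotomy i' i with hi | rfl | hi
      · simp [hi, hi.ne, not_lt_of_gt hi]
      · simp
      · simp [hi, hi.ne', not_lt_of_gt hi]
    rw [Finset.sum_congr rfl fun i' _ => this i', Finset.sum_add_distrib, Finset.sum_add_distrib]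
    simp [t, after]
  have hS3 := sum_lt_finSigma (fun i j => (e i j : ZMod 2)) i j
  -- The shuffle after `h` moves a block `i` whose degree has grown by one, so its sign differs from
  -- that of the inverse shuffle before `h` by the same `t i`.
  have hS4 : (∑ l, t (finSigmaFinEquiv.symm l).1 *
        ((Function.update (flat e) (finSigmaFinEquiv ⟨i, j⟩) (e i j + 1) l : ℤ) : ZMod 2)) =
      (∑ l, t (finSigmaFinEquiv.symm l).1 * ((flat e l : ℤ) : ZMod 2)) + t i := by
    have : ∀ l, t (finSigmaFinEquiv.symm l).1 *
        ((Function.update (flat e) (finSigmaFinEquiv ⟨i, j⟩) (e i j + 1) l : ℤ) : ZMod 2) =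
        t (finSigmaFinEquiv.symm l).1 * ((flat e l : ℤ) : ZMod 2) +
          if l = finSigmaFinEquiv ⟨i, j⟩ then t i else 0 := by
      intro l
      by_cases hl : l = finSigmaFinEquiv ⟨i, j⟩
      · subst hl
        rw [Function.update_self, if_pos rfl, flat_apply, Equiv.symm_apply_apply]
        push_cast
        ring
      · rw [Function.update_of_ne hl, if_neg hl, add_zero]
    rw [Finset.sum_congr rfl fun l _ => this l, Finset.sum_add_distrib]
    simp
  have hS5 : (∑ i', if i' < i then ((d i' + ∑ j', e i' j' : ℤ) : ZMod 2) else 0) =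
      (∑ i', if i' < i then (d i' : ZMod 2) else 0) +
        ∑ i', if i' < i then ∑ j', (e i' j' : ZMod 2) else 0 := by
    rw [← Finset.sum_add_distrib]
    refine Finset.sum_congr rfl fun i' _ => ?_
    split_ifs
    · push_cast
      ring
    · ring
  have hS3' : (∑ l, if l < finSigmaFinEquiv ⟨i, j⟩ then ((flat e l : ℤ) : ZMod 2) else 0) = _ := hS3
  rw [hS4, hS5, hS3', hS1]
  -- The common part of the two shuffle signs occurs twice, and so does `t i`; both disappear modulo
  -- 2.
  linear_combination h2 (∑ l, t (finSigmaFinEquiv.symm l).1 * ((flat e l : ℤ) : ZMod 2)) + h2 (t i)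

/-- This transfers the formula `h^Σ_n = (1 / m) der h` from `A` to `O[A]`; from here on the
properties of `O_•[h^Σ]` follow from those of weighted homotopies. -/
theorem isAveraged_extSchur_symTrick [Algebra ℚ k] (O : SymSeq.{u, v} k)
    (hD : IsContraction f g h) :
    IsAveraged (fun i m => Submodule.span k (O.schurGen A (weightGen A (g ∘ₗ f)) i m))
      (O.schurDer h hD.deg_h)
      (O.extSchur 1 (ThickSeq.symTrick f g h) (ThickSeq.symTrick_symmetric f g h)) := by
  intro n i m y hy
  induction hy using Submodule.span_induction with
  | mem y hy =>
    obtain ⟨i, m, rfl, rfl, x, hx, rfl⟩ := hy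
    rw [← LinearMap.smul_apply]
    -- Degree and weight of each factor are fixed, so the right side is one linear map with a
    -- constant scalar, and each factor can be taken among the generators of its own bidegree.
    refine eq_of_eqOn_span_tprod (fun j => O.schurGen A (weightGen A (g ∘ₗ f)) (i j) (m j)) ?_ hx
    intro x hx
    choose r d e μ o a hi hm ho ha hx using hx
    obtain rfl : x = _ := funext hx
    rw [extSchur_apply, O.schurLevel_symTrick hD ho ha, LinearMap.smul_apply]
    simp only [hm]
  | zero => simp
  | add a b _ _ ha hb => rw [map_add, ha, hb, map_add, smul_add]
  | smul c a _ ha => rw [map_smul, ha, map_smul, smul_comm]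

theorem schurMap_comp_schurMap (O : SymSeq.{u, v} k) (hD : IsContraction f g h) :
    O.schurMap f hD.deg_f ∘ₗ O.schurMap g hD.deg_g = LinearMap.id := by
  refine schur_ext (span_homogGen B) ?_
  rintro _ _ _ ⟨r, d, e, μ, o, b, rfl, rfl, ho, hb, rfl⟩
  rw [LinearMap.comp_apply, schurMap_incl, schurMap_incl, ThickSeq.pow_tprod, ThickSeq.pow_tprod]
  have : (fun j => f (g (b j))) = b := funext fun j => LinearMap.congr_fun hD.fg (b j)
  rw [this, LinearMap.id_apply]

/-- On a generator `(g f)^{⊗ r}` acts as the identity if all letters have weight 0, and as zero if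
some letter has weight 1. -/
theorem schurMap_schurMap_of_mem (O : SymSeq.{u, v} k) (hD : IsContraction f g h) {i : ℤ} {m : ℕ}
    {x : O.schur A} (hx : x ∈ Submodule.span k (O.schurGen A (weightGen A (g ∘ₗ f)) i m)) :
    O.schurMap g hD.deg_g (O.schurMap f hD.deg_f x) = if m = 0 then x else 0 := by
  induction hx using Submodule.span_induction with
  | mem x hx =>
    obtain ⟨r, d, e, μ, o, a, rfl, rfl, ho, ha, rfl⟩ := hx
    rw [schurMap_incl, schurMap_incl, ThickSeq.pow_tprod, ThickSeq.pow_tprod]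
    split_ifs with hm
    · congr 3
      funext j
      exact HasWeight.zero_iff.1 (Finset.sum_eq_zero_iff.1 hm j (Finset.mem_univ j) ▸ (ha j).2)
    · obtain ⟨j, -, hj⟩ := Finset.exists_ne_zero_of_sum_ne_zero hm
      rw [MultilinearMap.map_coord_zero _ j ((ha j).2.apply_eq_zero hj).2, TensorProduct.tmul_zero,
        map_zero]
  | zero => simp
  | add a b _ _ ha hb => rw [map_add, map_add, ha, hb]; split_ifs <;> simp
  | smul c a _ ha => rw [map_smul, map_smul, ha]; split_ifs <;> simp

/-- From `f g = 1` follows `g f g = g`, so the image of `g` has weight 0. This is what gives `H G =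
0`. -/
theorem schurMap_mem_weight_zero (O : SymSeq.{u, v} k) (hD : IsContraction f g h) :
    Submodule.span k {y : O.schur B | ∃ i, O.schurMap g hD.deg_g y ∈
      Submodule.span k (O.schurGen A (weightGen A (g ∘ₗ f)) i 0)} = ⊤ := by
  rw [eq_top_iff, ← O.span_schurGen (span_homogGen B)]
  refine Submodule.span_mono ?_
  rintro _ ⟨_, _, ⟨r, d, e, μ, o, b, rfl, rfl, ho, hb, rfl⟩⟩
  refine ⟨_, Submodule.subset_span ⟨r, d, e, fun _ => 0, o, fun j => g (b j), rfl,
    Finset.sum_const_zero, ho, fun j => ⟨?_, ?_⟩, ?_⟩⟩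
  · simpa using hD.deg_g _ _ (hb j).1
  · exact HasWeight.zero_iff.2 (congrArg g (LinearMap.congr_fun hD.fg (b j)))
  · rw [schurMap_incl, ThickSeq.pow_tprod]

end SymSeq

end SchurContraction

/-! ### Tensor powers as morphisms of thick maps, and the theorem -/

theorem ThickSeq.first_pow {k : Type u} [CommRing k] {A : DGMod.{u, v} k} {B : DGMod.{u, w} k}
    (f : A →ₗ[k] B) : (ThickSeq.pow f).first = f := by
  refine LinearMap.ext fun x => ?_
  rw [ThickSeq.first, LinearMap.comp_apply, LinearMap.comp_apply]
  have : (PiTensorProduct.subsingletonEquiv (R := k) (s := fun _ : Fin 1 => (A : Type v)) 0).symm x =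
      PiTensorProduct.tprod k fun _ => x := by
    rw [LinearEquiv.symm_apply_eq, PiTensorProduct.subsingletonEquiv_apply_tprod]
  refine (congrArg _ (congrArg _ this)).trans ?_
  refine (congrArg _ (ThickSeq.pow_tprod f _)).trans ?_
  exact PiTensorProduct.subsingletonEquiv_apply_tprod _ _

theorem ThickSeq.pow_isMorphism {k : Type u} [CommRing k] {A : DGMod.{u, v} k} {B : DGMod.{u, w} k}
    {f : A →ₗ[k] B} (hf : HasDegree 0 f) : (ThickSeq.pow f).IsMorphism :=
  ⟨ThickSeq.pow_hasDegree hf, by rw [ThickSeq.first_pow]⟩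

end

theorem mainTheorem7 {k : Type u} [CommRing k] [Algebra ℚ k]
    {A : DGMod.{u, v} k} {B : DGMod.{u, w} k}
    (f : A →ₗ[k] B) (g : B →ₗ[k] A) (h : A →ₗ[k] A) (hD : DGMod.IsContraction f g h)
    (O : SymSeq.{u, x} k) :
    ∃ (F : ThickSeq (O.schur A) (O.schur B)) (G : ThickSeq (O.schur B) (O.schur A))
      (H : ThickSeq (O.schur A) (O.schur A)),
      F = O.extSchur 0 (ThickSeq.pow f) (ThickSeq.pow_symmetric hD.deg_f) ∧
      G = O.extSchur 0 (ThickSeq.pow g) (ThickSeq.pow_symmetric hD.deg_g) ∧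
      H = O.extSchur 1 (ThickSeq.symTrick f g h) (ThickSeq.symTrick_symmetric f g h) ∧
      ThickSeq.IsSymmetricThickContraction F G H ∧
      F.IsMorphism ∧ F.first = O.schurMap f hD.deg_f ∧
      G.IsMorphism ∧ G.first = O.schurMap g hD.deg_g ∧
      ThickSeq.IsPseudoDerivation 1 H := by
  have hW := O.isWeightedHomotopy_schurDer hD
  have hH := O.isAveraged_extSchur_symTrick hD
  refine ⟨_, _, _, rfl, rfl, rfl, ?_⟩
  -- Once `F` and `G` are the tensor powers of `O[f]` and `O[g]`, the general results on weighted
  -- homotopies apply to `O[A]` with `D` induced by `h`.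
  rw [O.extSchur_pow hD.deg_f, O.extSchur_pow hD.deg_g]
  have hF := O.schurMap_hasDegree hD.deg_f
  have hG := O.schurMap_hasDegree hD.deg_g
  refine ⟨⟨fun n => ?_, ThickSeq.pow_symmetric hF, ThickSeq.pow_symmetric hG, hW.isSymmetric hH⟩,
    ThickSeq.pow_isMorphism hF, ThickSeq.first_pow _, ThickSeq.pow_isMorphism hG,
    ThickSeq.first_pow _, hW.isPseudoDerivation hH⟩
  exact hW.isContraction hH hF hG (O.schurMap_bdry hD.deg_f hD.bdry_f)
    (O.schurMap_bdry hD.deg_g hD.bdry_g) (O.schurMap_comp_schurMap hD)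
    (fun i x hx => (O.schurMap_schurMap_of_mem hD hx).trans (if_pos rfl))
    (fun i m hm x hx => (O.schurMap_schurMap_of_mem hD hx).trans (if_neg hm))
    (O.schurMap_mem_weight_zero hD) n
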